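/- Let $H$ be a complex Hilbert space, $\omega>0$, and $\mathcal H=L^2([0,\omega],H)$ with $\langle x,y\rangle=\frac1\omega\int_0^\omega\langle x(s),y(s)\rangle_H\,ds$. Put $\lambda_\ell=2\pi i\ell/\omega$ and $(P_\ell x)(s)=\widehat x(\ell)e^{\lambda_\ell s}$, where $\widehat x(\ell)=\frac1\omega\int_0^\omega x(s)e^{-\lambda_\ell s}ds$ ($\ell\in\mathbb Z$), $P_{(k)}=\sum_{|\ell|\le k}P_\ell$, $\mathcal H_\ell=\mathrm{Im}\,P_\ell$, $\mathcal H_{(k)}=\mathrm{Im}\,P_{(k)}$. Let $L_0=d/ds$ with domain $D(L_0)=\{y\in W_2^1([0,\omega],H):y(0)=y(\omega)\}$. Let $\mathcal V:[0,\omega]\to B(H)$ be such that $s\mapsto\mathcal V(s)x$ belongs to $L^2([0,\omega],H)$ for every $x\in H$, with Fourier coefficients $\widehat{\mathcal V}(n)x=\frac1\omega\int_0^\omega\mathcal V(s)x\,e^{-\lambda_n s}ds$, and assume $$\sum_{n}\|\widehat{\mathcal V}(n)\|^2<\infty,\qquad \sum_{j,\ell}\Big\|\sum_{n\ne\ell}\frac{\widehat{\mathcal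 V}(j+n)\widehat{\mathcal V}(\ell+n)}{\ell-n}\Big\|^2<\infty .$$ Let $(Vy)(s)=\mathcal V(s)y(\omega-s)$. Let $\mathfrak S_2$ be the space of $X\in B(\mathcal H)$ with $\|X\|_2^2:=\sum_{j,\ell}\|P_jXP_\ell\|^2<\infty$. For $r\in\mathbb Z_+$ and an operator $X$ (bounded, or $X=V$) let $J_rX$ and $\Gamma_rX$ be the bounded operators whose block matrices are $$P_j(J_rX)P_\ell=\begin{cases}P_jXP_\ell,& j=\ell\text{ or }\max\{|j|,|\ell|\}\le r,\\0,&\text{otherwise,}\end{cases}\qquad P_j(\Gamma_rX)P_\ell=\begin{cases}\dfrac{P_jXP_\ell}{\lambda_j-\lambda_\ell},& j\ne\ell,\ \max\{|j|,|\ell|\}>r,\\0,&\text{otherwise.}\end{cases}$$ Let $m\in\mathbb Z_+$ be such that $I+\Gamma_mV$ is invertible in $B(\mathcal H)$, and put $$\widetilde V=J_mV+(I+\Gamma_mV)^{-1}\big(V\Gamma_mV-(\Gamma_mV)J_mV\big),$$ where $V\Gamma_mV$ is the bounded extension of $x\mapsto V(\Gamma_mVx)$, $x\in D(L_0)$. Assume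 that $P_{(n)}\widetilde VP_{(n)}\ne\widetilde V$ for all $n\in\mathbb Z_+$. For $n\in\mathbb Z$ let $$\alpha_n=\|\widetilde V\|_2^{-1/2}\max\Big\{\Big(\sum_{|\ell|\ge|n|}\|P_\ell\widetilde V\|_2^2\Big)^{1/4},\Big(\sum_{|\ell|\ge|n|}\|\widetilde VP_\ell\|_2^2\Big)^{1/4}\Big\},\qquad F=\sum_{n}\alpha_nP_n,$$ and for $n\in\mathbb N$ let $\alpha_n'=\max_{|i|\ge n,\,|j|<n}\frac{|\alpha_i-\alpha_j|}{|i-j|}$ and $\widetilde\alpha_n=\frac{\omega}{2\pi}(2\alpha_n+\alpha_n')$. Let $\mathcal M$ be the space of all $X\in\mathfrak S_2$ of the form $X=X_lF=FX_r$ with $X_l,X_r\in\mathfrak S_2$, with the norm $\|X\|_{\mathcal M}=\max\{\|X_l\|_2,\|X_r\|_2\}$. **Theorem.** The operators $J_mV$, $\Gamma_mV$, $V\Gamma_mV$ exist as bounded operators, and $\widetilde V\in\mathcal M$. Let $k\ge m$ be such that $4\widetilde\alpha_{k+1}\|\widetilde V\|_{\mathcal M}<1$. Then the map $$\Phi(X)=\widetilde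 V\,\Gamma_kX-(\Gamma_kX)(J_k\widetilde V)-(\Gamma_kX)J_k(\widetilde V\,\Gamma_kX)+\widetilde V$$ has exactly one fixed point $X_*$ in the ball $\{X\in\mathcal M:\|X-\widetilde V\|_{\mathcal M}\le3\|\widetilde V\|_{\mathcal M}\}$. With $V_0=J_kX_*$, the operator $L_0-\widetilde V$ is similar to $L_0-V_0$ with similarity transform $U=I+\Gamma_kX_*$; that is, $U\in B(\mathcal H)$ is invertible with bounded inverse, $UD(L_0)=D(L_0)$, and $(L_0-\widetilde V)Ux=U(L_0-V_0)x$ for $x\in D(L_0)$. Moreover, $V_0$ is the orthogonal direct sum $$V_0=V_{0(k)}\oplus\Big(\bigoplus_{|j|>k}V_{0,j}\Big)$$ of bounded operators on $\mathcal H_{(k)}$ and on the $\mathcal H_j$, $|j|>k$, with respect to the orthogonal decomposition $\mathcal H=\mathcal H_{(k)}\oplus\big(\bigoplus_{|j|>k}\mathcal H_j\big)$. -/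

import Mathlib

open MeasureTheory Filter Topology
open scoped ENNReal

noncomputable section

namespace InvolutionOperator

/-! ### The Hilbert space of square integrable functions on an interval -/

/-- Normalized Lebesgue measure on `[0, ω]`; the inner product of its `L²` space is
`⟨x, y⟩ = (1 / ω) ∫₀^ω ⟨x s, y s⟩ ds`. -/
def meanMeasure (ω : ℝ) : Measure ℝ :=
  (ENNReal.ofReal ω)⁻¹ • volume.restrict (Set.Icc 0 ω)

/-- `L²([0, ω], H)`. -/
abbrev L2 (ω : ℝ) (H : Type*) [NormedAddCommGroup H] : Type _ :=
  Lp H 2 (meanMeasure ω)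

instance instIsProbabilityMeasureMean (ω : ℝ) [Fact (0 < ω)] :
    IsProbabilityMeasure (meanMeasure ω) := by
  constructor
  have h : 0 < ω := Fact.out
  simp only [meanMeasure, Measure.smul_apply, Measure.restrict_apply_univ, Real.volume_Icc,
    sub_zero, smul_eq_mul]
  exact ENNReal.inv_mul_cancel (by simpa using h) ENNReal.ofReal_ne_top

theorem ae_meanMeasure_iff (ω : ℝ) {p : ℝ → Prop} :
    (∀ᵐ s ∂(meanMeasure ω), p s) ↔ ∀ᵐ s ∂(volume.restrict (Set.Icc 0 ω)), p s := by
  have h : (ENNReal.ofReal ω)⁻¹ ≠ 0 := ENNReal.inv_ne_zero.2 ENNReal.ofReal_ne_top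
  rw [meanMeasure, Measure.ae_ennreal_smul_measure_iff h]

/-- Reflection `s ↦ ω - s` preserves the measure on `[0, ω]`. -/
theorem measurePreserving_reflect (ω : ℝ) :
    MeasurePreserving (fun s : ℝ => ω - s) (meanMeasure ω) (meanMeasure ω) := by
  have h1 : MeasurePreserving (fun s : ℝ => ω - s) (volume.restrict (Set.Icc 0 ω))
      (volume.restrict (Set.Icc 0 ω)) := by
    have h := (Measure.measurePreserving_sub_left (volume : Measure ℝ) ω).restrict_preimage
      (measurableSet_Icc (a := (0 : ℝ)) (b := ω))
    have hs : (fun s : ℝ => ω - s) ⁻¹' Set.Icc 0 ω = Set.Icc 0 ω := by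
      ext s
      simp only [Set.mem_preimage, Set.mem_Icc]
      constructor <;> rintro ⟨h1, h2⟩ <;> constructor <;> linarith
    rwa [hs] at h
  exact h1.smul_measure _

section Fourier

variable (ω : ℝ)

/-- The eigenvalue `λ_n = 2πin/ω` of `d/ds`. -/
def freq (n : ℤ) : ℂ := 2 * Real.pi * Complex.I * n / ω

/-- The exponential `s ↦ e^{λ_n s}`. -/
def expMode (n : ℤ) (s : ℝ) : ℂ := Complex.exp (freq ω n * s)

theorem norm_expMode (n : ℤ) (s : ℝ) : ‖expMode ω n s‖ = 1 := by
  have : freq ω n * s = ((2 * Real.pi * n / ω * s : ℝ) : ℂ) * Complex.I := by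
    simp only [freq]; push_cast; ring
  rw [expMode, this, Complex.norm_exp_ofReal_mul_I]

theorem continuous_expMode (n : ℤ) : Continuous (expMode ω n) := by
  unfold expMode; fun_prop

variable (H : Type*) [NormedAddCommGroup H] [InnerProductSpace ℂ H]

/-- The Fourier coefficient `x ↦ x̂(n) = (1 / ω) ∫₀^ω e^{-λ_n s} x(s) ds`, as a bounded operator
from `L²([0, ω], H)` to `H`. -/
def coeff [Fact (0 < ω)] (n : ℤ) : L2 ω H →L[ℂ] H :=
  have hint : ∀ x : L2 ω H, Integrable (fun s => expMode ω (-n) s • x s) (meanMeasure ω) := by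
    intro x
    have hx : Integrable (x : ℝ → H) (meanMeasure ω) :=
      (Lp.memLp x).integrable (by norm_num)
    exact hx.bdd_smul 1 (continuous_expMode ω (-n)).aestronglyMeasurable
      (Eventually.of_forall fun s => (norm_expMode ω (-n) s).le)
  LinearMap.mkContinuous
    { toFun := fun x => ∫ s, expMode ω (-n) s • x s ∂(meanMeasure ω)
      map_add' := by
        intro x y
        rw [← integral_add (hint x) (hint y)]
        refine integral_congr_ae ?_
        filter_upwards [Lp.coeFn_add x y] with s hs
        rw [hs, Pi.add_apply, smul_add]
      map_smul' := by
        intro c x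
        rw [RingHom.id_apply, ← integral_smul]
        refine integral_congr_ae ?_
        filter_upwards [Lp.coeFn_smul c x] with s hs
        rw [hs, Pi.smul_apply, smul_comm c] }
    1 (by
      intro x
      have h1 : ‖∫ s, expMode ω (-n) s • x s ∂(meanMeasure ω)‖
          ≤ (eLpNorm (x : ℝ → H) 1 (meanMeasure ω)).toReal := by
        refine (norm_integral_le_lintegral_norm _).trans (le_of_eq ?_)
        rw [eLpNorm_one_eq_lintegral_enorm]
        congr 1
        refine lintegral_congr fun s => ?_
        rw [norm_smul, norm_expMode, one_mul, ofReal_norm]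
      have h2 : (eLpNorm (x : ℝ → H) 1 (meanMeasure ω)).toReal ≤ ‖x‖ := by
        rw [Lp.norm_def]
        exact ENNReal.toReal_mono (Lp.eLpNorm_ne_top x)
          (eLpNorm_le_eLpNorm_of_exponent_le (by norm_num) (Lp.aestronglyMeasurable x))
      simpa using h1.trans h2)

theorem memLp_mode [Fact (0 < ω)] (n : ℤ) (h : H) :
    MemLp (fun s => expMode ω n s • h) 2 (meanMeasure ω) :=
  (memLp_const h).of_le
    ((continuous_expMode ω n).smul continuous_const).aestronglyMeasurable
    (Eventually.of_forall fun s => by rw [norm_smul, norm_expMode, one_mul])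

/-- The map sending `h : H` to the function `s ↦ e^{λ_n s} h` in `L²([0, ω], H)`. -/
def mode [Fact (0 < ω)] (n : ℤ) : H →L[ℂ] L2 ω H :=
  LinearMap.mkContinuous
    { toFun := fun h => (memLp_mode ω H n h).toLp _
      map_add' := by
        intro x y
        rw [← MemLp.toLp_add]
        congr 1
        funext s
        simp
      map_smul' := by
        intro c x
        rw [RingHom.id_apply, ← MemLp.toLp_const_smul]
        congr 1
        funext s
        simp [smul_comm c] }
    1 (by
      intro h
      change ‖(memLp_mode ω H n h).toLp _‖ ≤ _
      rw [Lp.norm_toLp, eLpNorm_congr_norm_ae (g := fun _ => h)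
        (Eventually.of_forall fun s => by rw [norm_smul, norm_expMode, one_mul])]
      rw [eLpNorm_const' h (by norm_num) (by norm_num)]
      simp)

variable [Fact (0 < ω)]

/-- The spectral projection `P_n` of `d/ds`: `(P_n x)(s) = x̂(n) e^{λ_n s}`. -/
def proj (n : ℤ) : L2 ω H →L[ℂ] L2 ω H := mode ω H n ∘L coeff ω H n

/-- `P_{(m)} = ∑_{|ℓ| ≤ m} P_ℓ`. -/
def centralProj (m : ℕ) : L2 ω H →L[ℂ] L2 ω H :=
  ∑ l ∈ Finset.Icc (-(m : ℤ)) m, proj ω H l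

/-- The coarse family of projections `{P_{(m)}} ∪ {P_ℓ : |ℓ| > m}`, indexed by `none` and by the
integers `ℓ` with `|ℓ| > m`. -/
def coarseProj (m : ℕ) : Option {l : ℤ // (m : ℤ) < |l|} → (L2 ω H →L[ℂ] L2 ω H)
  | none => centralProj ω H m
  | some l => proj ω H l

end Fourier

/-! ### The operator `L₀ = d/ds` with periodic boundary conditions -/

section Derivative

variable (ω : ℝ) (H : Type*) [NormedAddCommGroup H] [InnerProductSpace ℂ H] [Fact (0 < ω)]

theorem integrableOn_L2 (x : L2 ω H) : IntegrableOn (x : ℝ → H) (Set.Icc 0 ω) := by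
  have hx : Integrable (x : ℝ → H) (meanMeasure ω) := (Lp.memLp x).integrable (by norm_num)
  have h0 : (ENNReal.ofReal ω)⁻¹ ≠ 0 := ENNReal.inv_ne_zero.2 ENNReal.ofReal_ne_top
  have h1 : (ENNReal.ofReal ω)⁻¹ ≠ ∞ := by
    simpa using (Fact.out : 0 < ω)
  exact (integrable_smul_measure h0 h1).1 hx

theorem intervalIntegrable_L2 (x : L2 ω H) {s : ℝ} (hs : s ∈ Set.Icc 0 ω) :
    IntervalIntegrable (x : ℝ → H) volume 0 s :=
  (intervalIntegrable_iff_integrableOn_Icc_of_le hs.1).2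
    ((integrableOn_L2 ω H x).mono_set (Set.Icc_subset_Icc_right hs.2))

theorem intervalIntegral_congr_L2 {f g : ℝ → H} (h : f =ᵐ[meanMeasure ω] g) {s : ℝ}
    (hs : s ∈ Set.Icc 0 ω) : ∫ τ in (0 : ℝ)..s, f τ = ∫ τ in (0 : ℝ)..s, g τ := by
  rw [intervalIntegral.integral_of_le hs.1, intervalIntegral.integral_of_le hs.1]
  refine integral_congr_ae ?_
  have h' := (ae_meanMeasure_iff ω).1 h
  exact ae_restrict_of_ae_restrict_of_subset
    (Set.Ioc_subset_Icc_self.trans (Set.Icc_subset_Icc_right hs.2)) h'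

/-- The pairs `(y, y')` where `y ∈ W₂¹([0, ω], H)` is periodic: `y` has a representative that is
a primitive of the square integrable function `y'` and satisfies `y(0) = y(ω)`. -/
def derivGraph : Submodule ℂ (L2 ω H × L2 ω H) where
  carrier := {p | ∃ y : ℝ → H, (p.1 : ℝ → H) =ᵐ[meanMeasure ω] y ∧
    (∀ s ∈ Set.Icc 0 ω, y s = y 0 + ∫ τ in (0 : ℝ)..s, p.2 τ) ∧ y 0 = y ω}
  add_mem' := by
    rintro ⟨p, p'⟩ ⟨q, q'⟩ ⟨y, hy1, hy2, hy3⟩ ⟨z, hz1, hz2, hz3⟩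
    refine ⟨fun s => y s + z s, ?_, ?_, ?_⟩
    · filter_upwards [hy1, hz1, Lp.coeFn_add p q] with s h1 h2 h3
      change (p + q : L2 ω H) s = _
      rw [h3, Pi.add_apply]
      exact congrArg₂ _ h1 h2
    · intro s hs
      have h1 := intervalIntegral_congr_L2 ω H (Lp.coeFn_add p' q') hs
      simp only [Pi.add_apply] at h1
      rw [intervalIntegral.integral_add (intervalIntegrable_L2 ω H p' hs)
        (intervalIntegrable_L2 ω H q' hs)] at h1
      change y s + z s = y 0 + z 0 + ∫ τ in (0 : ℝ)..s, (p' + q' : L2 ω H) τ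
      rw [h1, hy2 s hs, hz2 s hs]
      abel
    · simp [hy3, hz3]
  zero_mem' := by
    refine ⟨fun _ => 0, Lp.coeFn_zero _ _ _, ?_, rfl⟩
    intro s hs
    have h1 := intervalIntegral_congr_L2 ω H (Lp.coeFn_zero H 2 (meanMeasure ω)) hs
    change (0 : H) = 0 + ∫ τ in (0 : ℝ)..s, (0 : L2 ω H) τ
    rw [h1]
    simp
  smul_mem' := by
    rintro c ⟨p, p'⟩ ⟨y, hy1, hy2, hy3⟩
    refine ⟨fun s => c • y s, ?_, ?_, ?_⟩
    · filter_upwards [hy1, Lp.coeFn_smul c p] with s h1 h3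
      change (c • p : L2 ω H) s = _
      rw [h3, Pi.smul_apply]
      exact congrArg _ h1
    · intro s hs
      have h1 := intervalIntegral_congr_L2 ω H (Lp.coeFn_smul c p') hs
      simp only [Pi.smul_apply] at h1
      rw [intervalIntegral.integral_smul] at h1
      change c • y s = c • y 0 + ∫ τ in (0 : ℝ)..s, (c • p' : L2 ω H) τ
      rw [h1, hy2 s hs, smul_add]
    · simp [hy3]

/-- The derivative is determined by the function. -/
theorem derivGraph_unique [CompleteSpace H] :
    ∀ p ∈ derivGraph ω H, p.1 = 0 → p.2 = 0 := by
  rintro ⟨p, p'⟩ ⟨y, hy1, hy2, -⟩ (rfl : p = 0)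
  have hω : 0 < ω := Fact.out
  have hae : (fun s => y 0 + ∫ τ in (0 : ℝ)..s, p' τ) =ᵐ[volume.restrict (Set.Icc 0 ω)]
      fun _ => 0 := by
    have h1 := (ae_meanMeasure_iff ω).1 (hy1.symm.trans (Lp.coeFn_zero H 2 (meanMeasure ω)))
    filter_upwards [h1, ae_restrict_mem measurableSet_Icc] with s h2 h3
    rw [← hy2 s h3]
    exact h2
  have hcont : ContinuousOn (fun s => y 0 + ∫ τ in (0 : ℝ)..s, p' τ) (Set.Icc 0 ω) := by
    have := intervalIntegral.continuousOn_primitive_interval (μ := volume) (f := p')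
      (a := 0) (b := ω) (by rw [Set.uIcc_of_le hω.le]; exact integrableOn_L2 ω H p')
    rw [Set.uIcc_of_le hω.le] at this
    exact continuousOn_const.add this
  have heq := Measure.eqOn_Icc_of_ae_eq volume hω.ne hae hcont continuousOn_const
  refine Lp.ext ?_
  refine EventuallyEq.trans ?_ (Lp.coeFn_zero H 2 (meanMeasure ω)).symm
  refine (ae_meanMeasure_iff ω).2 ?_
  have hd := (intervalIntegrable_L2 ω H p' (Set.right_mem_Icc.2 hω.le)).ae_hasDerivAt_integral
  rw [← restrict_Ioo_eq_restrict_Icc]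
  filter_upwards [ae_restrict_of_ae hd, ae_restrict_mem measurableSet_Ioo] with s h1 h2
  rw [Set.uIcc_of_le hω.le] at h1
  have h3 := h1 (Set.Ioo_subset_Icc_self h2) 0 (Set.left_mem_Icc.2 hω.le)
  have h4 : HasDerivAt (fun x => ∫ t in (0 : ℝ)..x, p' t) 0 s := by
    refine (hasDerivAt_const s (-y 0)).congr_of_eventuallyEq ?_
    filter_upwards [Ioo_mem_nhds h2.1 h2.2] with x hx
    have h5 := heq (Set.Ioo_subset_Icc_self hx)
    simp only at h5
    exact (neg_eq_of_add_eq_zero_right h5).symm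
  exact h3.unique h4

/-- The operator `L₀ y = dy/ds` with domain `{y ∈ W₂¹ : y(0) = y(ω)}`. -/
def derivOp : L2 ω H →ₗ.[ℂ] L2 ω H := (derivGraph ω H).toLinearPMap

/-- The operator `L₀` really is differentiation. -/
theorem derivOp_graph [CompleteSpace H] : (derivOp ω H).graph = derivGraph ω H :=
  Submodule.toLinearPMap_graph_eq _ (derivGraph_unique ω H)

end Derivative

/-! ### The potential and the perturbation `V` -/

section Potential

variable (ω : ℝ) {H : Type*} [NormedAddCommGroup H] [InnerProductSpace ℂ H] [CompleteSpace H]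
variable [Fact (0 < ω)] (𝒱 : ℝ → H →L[ℂ] H)

/-- The map `x ↦ 𝒱(·) x` from `H` to `L²([0, ω], H)`; it is bounded by the closed graph theorem. -/
def potentialMap (h𝒱 : ∀ x : H, MemLp (fun s => 𝒱 s x) 2 (meanMeasure ω)) : H →L[ℂ] L2 ω H :=
  let T : H →ₗ[ℂ] L2 ω H :=
    { toFun := fun x => (h𝒱 x).toLp _
      map_add' := by
        intro x y
        rw [← MemLp.toLp_add]
        congr 1
        funext s
        simp
      map_smul' := by
        intro c x
        rw [RingHom.id_apply, ← MemLp.toLp_const_smul]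
        congr 1
        funext s
        simp }
  ⟨T, by
    refine T.continuous_of_seq_closed_graph ?_
    intro u x y hu hy
    obtain ⟨ns, hns, hlim⟩ := (tendstoInMeasure_of_tendsto_Lp hy).exists_seq_tendsto_ae
    have hall : ∀ᵐ s ∂(meanMeasure ω), ∀ n, (T (u n) : ℝ → H) s = 𝒱 s (u n) :=
      ae_all_iff.2 fun n => (h𝒱 (u n)).coeFn_toLp
    refine Lp.ext ?_
    filter_upwards [hlim, hall, (h𝒱 x).coeFn_toLp] with s h1 h2 h3
    change _ = ((h𝒱 x).toLp _ : L2 ω H) s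
    rw [h3]
    refine tendsto_nhds_unique h1 ?_
    have h4 := ((𝒱 s).continuous.tendsto x).comp (hu.comp hns.tendsto_atTop)
    refine h4.congr fun n => ?_
    exact (h2 (ns n)).symm⟩

/-- The Fourier coefficient `𝒱̂(n) x = (1 / ω) ∫₀^ω e^{-λ_n s} 𝒱(s) x ds` of the potential. -/
def potentialCoeff (h𝒱 : ∀ x : H, MemLp (fun s => 𝒱 s x) 2 (meanMeasure ω)) (n : ℤ) :
    H →L[ℂ] H :=
  coeff ω H n ∘L potentialMap ω 𝒱 h𝒱

/-- The operator `(V y)(s) = 𝒱(s) y(ω - s)` with its natural domain, all `y` in `L²([0, ω], H)` for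
which the right-hand side is in `L²([0, ω], H)`. -/
def perturbation : L2 ω H →ₗ.[ℂ] L2 ω H where
  domain :=
    { carrier := {y | MemLp (fun s => 𝒱 s (y (ω - s))) 2 (meanMeasure ω)}
      add_mem' := by
        intro y z hy hz
        refine (MemLp.add hy hz).ae_eq ?_
        filter_upwards [(measurePreserving_reflect ω).quasiMeasurePreserving.ae
          (Lp.coeFn_add y z)] with s hs
        rw [hs]
        simp
      zero_mem' := by
        refine (MemLp.zero (ε := H) (p := 2) (μ := meanMeasure ω)).ae_eq ?_
        filter_upwards [(measurePreserving_reflect ω).quasiMeasurePreserving.ae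
          (Lp.coeFn_zero H 2 (meanMeasure ω))] with s hs
        rw [hs]
        simp
      smul_mem' := by
        intro c y hy
        refine (MemLp.const_smul hy c).ae_eq ?_
        filter_upwards [(measurePreserving_reflect ω).quasiMeasurePreserving.ae
          (Lp.coeFn_smul c y)] with s hs
        rw [hs]
        simp }
  toFun :=
    { toFun := fun y => MemLp.toLp (fun s => 𝒱 s (y.1 (ω - s))) y.2
      map_add' := by
        intro y z
        rw [← MemLp.toLp_add]
        refine MemLp.toLp_congr _ _ ?_
        filter_upwards [(measurePreserving_reflect ω).quasiMeasurePreserving.ae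
          (Lp.coeFn_add y.1 z.1)] with s hs
        change 𝒱 s ((y.1 + z.1 : L2 ω H) (ω - s)) = _
        rw [hs]
        simp
      map_smul' := by
        intro c y
        rw [RingHom.id_apply, ← MemLp.toLp_const_smul]
        refine MemLp.toLp_congr _ _ ?_
        filter_upwards [(measurePreserving_reflect ω).quasiMeasurePreserving.ae
          (Lp.coeFn_smul c y.1)] with s hs
        change 𝒱 s ((c • y.1 : L2 ω H) (ω - s)) = _
        rw [hs]
        simp }

end Potential

/-! ### Operators in a Hilbert space with a resolution of the identity -/

section Abstract

variable {E : Type*} [NormedAddCommGroup E] [InnerProductSpace ℂ E] [CompleteSpace E]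

/-- A bounded operator viewed as an operator with domain the whole space. -/
def ofBounded (X : E →L[ℂ] E) : E →ₗ.[ℂ] E := (X : E →ₗ[ℂ] E).toPMap ⊤

/-- `U` is a similarity transform of `A₁` into `A₂`: it is bounded and continuously invertible,
`U D(A₂) = D(A₁)`, and `A₁ U x = U A₂ x` for `x ∈ D(A₂)`. -/
structure IsSimilarityTransform (A₁ A₂ : E →ₗ.[ℂ] E) (U : E →L[ℂ] E) : Prop where
  isUnit : IsUnit U
  map_domain : A₂.domain.map (U : E →ₗ[ℂ] E) = A₁.domain
  intertwine : ∀ (x : A₂.domain) (hx : U x ∈ A₁.domain), A₁ ⟨U x, hx⟩ = U (A₂ x)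

/-- A disjunctive resolution of the identity: nonzero, pairwise orthogonal, self-adjoint
idempotents `Q i` with `x = ∑ Q i x` (unconditionally) and `‖x‖² = ∑ ‖Q i x‖²`. -/
structure IsResolutionOfIdentity {ι : Type*} (Q : ι → E →L[ℂ] E) : Prop where
  ne_zero : ∀ i, Q i ≠ 0
  selfAdjoint : ∀ i, IsSelfAdjoint (Q i)
  idempotent : ∀ i, Q i * Q i = Q i
  orthogonal : ∀ i j, i ≠ j → Q i * Q j = 0
  hasSum : ∀ x, HasSum (fun i => Q i x) x
  hasSum_norm : ∀ x, HasSum (fun i => ‖Q i x‖ ^ 2) (‖x‖ ^ 2)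

/-- The closed operator `A` is the orthogonal direct sum of its parts `part i`, which are bounded
operators on the subspaces `Im (Q i)`, where `Q` is a resolution of the identity. -/
structure IsOrthogonalDirectSum {ι : Type*} (A : E →ₗ.[ℂ] E) (Q : ι → E →L[ℂ] E)
    (part : ∀ i, (Q i : E →ₗ[ℂ] E).range →L[ℂ] (Q i : E →ₗ[ℂ] E).range) : Prop where
  resolution : IsResolutionOfIdentity Q
  closed : A.IsClosed
  mem_domain : ∀ x, x ∈ A.domain ↔
    Summable fun i => ‖part i ⟨Q i x, LinearMap.mem_range_self _ x⟩‖ ^ 2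
  range_le : ∀ i, (Q i : E →ₗ[ℂ] E).range ≤ A.domain
  restrict : ∀ i (x : (Q i : E →ₗ[ℂ] E).range), A ⟨x, range_le i x.2⟩ = part i x
  hasSum : ∀ x : A.domain,
    HasSum (fun i => (part i ⟨Q i x, LinearMap.mem_range_self _ (x : E)⟩ : E)) (A x)

variable (P : ℤ → E →L[ℂ] E)

/-- The Hilbert--Schmidt class with respect to the family `P`. -/
def MemHS (X : E →L[ℂ] E) : Prop :=
  Summable fun p : ℤ × ℤ => ‖P p.1 * X * P p.2‖ ^ 2

/-- The norm `‖X‖_{2,P} = (∑_{j,ℓ} ‖P_j X P_ℓ‖²)^{1/2}`. -/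
def hsNorm (X : E →L[ℂ] E) : ℝ :=
  √(∑' p : ℤ × ℤ, ‖P p.1 * X * P p.2‖ ^ 2)

/-- The bounded operator `Y` has the block matrix `(c_{jℓ} P_j X P_ℓ)`, where `X` is a possibly
unbounded operator whose domain contains all the subspaces `Im P_ℓ`. -/
def IsBlockMultiplier (c : ℤ → ℤ → ℂ) (X : E →ₗ.[ℂ] E) (Y : E →L[ℂ] E) : Prop :=
  ∀ (l : ℤ) (x : E), ∃ hx : P l x ∈ X.domain,
    ∀ j : ℤ, P j (Y (P l x)) = c j l • P j (X ⟨P l x, hx⟩)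

open Classical in
/-- The bounded operator with block matrix `(c_{jℓ} P_j X P_ℓ)`, if there is one. It is unique if
`P` is a resolution of the identity. -/
def blockMultiplier (c : ℤ → ℤ → ℂ) (X : E →ₗ.[ℂ] E) : E →L[ℂ] E :=
  if h : ∃ Y, IsBlockMultiplier P c X Y then h.choose else 0

/-- The bounded operator `Y` extends `x ↦ X (G x)`, `x ∈ D`. -/
def IsCompExtension (X : E →ₗ.[ℂ] E) (D : Submodule ℂ E) (G Y : E →L[ℂ] E) : Prop :=
  ∀ x ∈ D, ∃ hx : G x ∈ X.domain, Y x = X ⟨G x, hx⟩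

open Classical in
/-- The bounded extension of `x ↦ X (G x)`, `x ∈ D`, if there is one. It is unique if `D` is
dense. -/
def compExtension (X : E →ₗ.[ℂ] E) (D : Submodule ℂ E) (G : E →L[ℂ] E) : E →L[ℂ] E :=
  if h : ∃ Y, IsCompExtension X D G Y then h.choose else 0

/-! ### The weighted space of admissible perturbations -/

/-- `α_n(X) = ‖X‖_{2,P}^{-1/2} max {(∑_{|ℓ| ≥ |n|} ‖P_ℓ X‖_{2,P}²)^{1/4},
(∑_{|ℓ| ≥ |n|} ‖X P_ℓ‖_{2,P}²)^{1/4}}`. -/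
def alpha (X : E →L[ℂ] E) (n : ℤ) : ℝ :=
  hsNorm P X ^ (-(1 / 2) : ℝ) *
    max ((∑' l : {l : ℤ // |n| ≤ |l|}, hsNorm P (P l * X) ^ 2) ^ (1 / 4 : ℝ))
      ((∑' l : {l : ℤ // |n| ≤ |l|}, hsNorm P (X * P l) ^ 2) ^ (1 / 4 : ℝ))

/-- The operator `F_W = ∑_n α_n(W) P_n`. -/
def weightOp (W : E →L[ℂ] E) (x : E) : E := ∑' n : ℤ, (alpha P W n : ℂ) • P n x

/-- `X = X_l F_W` and `X = F_W X_r`, with `X_l` and `X_r` in the Hilbert--Schmidt class. -/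
structure IsFactorization (W X Xl Xr : E →L[ℂ] E) : Prop where
  left_mem : MemHS P Xl
  right_mem : MemHS P Xr
  left_eq : ∀ x, X x = Xl (weightOp P W x)
  right_eq : ∀ x, X x = weightOp P W (Xr x)

/-- The space `ℳ` of the operators `X` in the Hilbert--Schmidt class that can be written
`X = X_l F_W = F_W X_r`. -/
def MemM (W X : E →L[ℂ] E) : Prop :=
  MemHS P X ∧ ∃ Xl Xr, IsFactorization P W X Xl Xr

/-- The norm `‖X‖_ℳ = max {‖X_l‖_{2,P}, ‖X_r‖_{2,P}}` of `X ∈ ℳ`. The pair `(X_l, X_r)` is unique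
if all `α_n(W)` are nonzero, so that the infimum is then over a single number. -/
def normM (W X : E →L[ℂ] E) : ℝ :=
  sInf {r | ∃ Xl Xr, IsFactorization P W X Xl Xr ∧ r = max (hsNorm P Xl) (hsNorm P Xr)}

/-- `α'_n = max {|α_i - α_j| / |i - j| : |i| ≥ n, |j| < n}`. -/
def alphaPrime (W : E →L[ℂ] E) (n : ℕ) : ℝ :=
  ⨆ p : {p : ℤ × ℤ // (n : ℤ) ≤ |p.1| ∧ |p.2| < n},
    |alpha P W p.1.1 - alpha P W p.1.2| / |(p.1.1 : ℝ) - p.1.2|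

/-- `α̃_n = (ω / 2π) (2 α_n + α'_n)`. -/
def alphaTilde (ω : ℝ) (W : E →L[ℂ] E) (n : ℕ) : ℝ :=
  ω / (2 * Real.pi) * (2 * alpha P W n + alphaPrime P W n)

end Abstract

/-! ### The transforms `J_m`, `Γ_m` and the operator `Ṽ` -/

section Transforms

variable (ω : ℝ) [Fact (0 < ω)]

/-- The weights of `J_m X = P_{(m)} X P_{(m)} + ∑_{|ℓ| > m} P_ℓ X P_ℓ`. -/
def weightJ (m : ℕ) (j l : ℤ) : ℂ :=
  if (|j| ≤ m ∧ |l| ≤ m) ∨ j = l then 1 else 0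

/-- The weights of `Γ_m X = ∑ (P_j X P_ℓ) / (λ_j - λ_ℓ)`, where the sum is over `j ≠ ℓ` with
`max {|j|, |ℓ|} > m`. -/
def weightΓ (m : ℕ) (j l : ℤ) : ℂ :=
  if (m : ℤ) < max |j| |l| ∧ j ≠ l then 1 / (freq ω j - freq ω l) else 0

variable {H : Type*} [NormedAddCommGroup H] [InnerProductSpace ℂ H] [CompleteSpace H]

/-- The transform `J_m`, for possibly unbounded `X` (bounded extension). -/
def transformJ (m : ℕ) (X : L2 ω H →ₗ.[ℂ] L2 ω H) : L2 ω H →L[ℂ] L2 ω H :=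
  blockMultiplier (proj ω H) (weightJ m) X

/-- The transform `Γ_m`, for possibly unbounded `X` (bounded extension). -/
def transformΓ (m : ℕ) (X : L2 ω H →ₗ.[ℂ] L2 ω H) : L2 ω H →L[ℂ] L2 ω H :=
  blockMultiplier (proj ω H) (weightΓ ω m) X

/-- The transform `J_m` of a bounded operator. -/
abbrev bddJ (m : ℕ) (X : L2 ω H →L[ℂ] L2 ω H) : L2 ω H →L[ℂ] L2 ω H :=
  transformJ ω m (ofBounded X)

/-- The transform `Γ_m` of a bounded operator. -/
abbrev bddΓ (m : ℕ) (X : L2 ω H →L[ℂ] L2 ω H) : L2 ω H →L[ℂ] L2 ω H :=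
  transformΓ ω m (ofBounded X)

variable (𝒱 : ℝ → H →L[ℂ] H)

/-- The bounded operator `J_m V`. -/
def JV (m : ℕ) : L2 ω H →L[ℂ] L2 ω H := transformJ ω m (perturbation ω 𝒱)

/-- The bounded operator `Γ_m V`. -/
def ΓV (m : ℕ) : L2 ω H →L[ℂ] L2 ω H := transformΓ ω m (perturbation ω 𝒱)

/-- The bounded operator `V Γ_m V`, the bounded extension of `x ↦ V (Γ_m V x)`, `x ∈ D(L₀)`. -/
def VΓV (m : ℕ) : L2 ω H →L[ℂ] L2 ω H :=
  compExtension (perturbation ω 𝒱) (derivOp ω H).domain (ΓV ω 𝒱 m)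

/-- The operators `J_m V`, `Γ_m V` and `V Γ_m V` exist as bounded operators. -/
structure HasBoundedTransforms (m : ℕ) : Prop where
  specJ : IsBlockMultiplier (proj ω H) (weightJ m) (perturbation ω 𝒱) (JV ω 𝒱 m)
  specΓ : IsBlockMultiplier (proj ω H) (weightΓ ω m) (perturbation ω 𝒱) (ΓV ω 𝒱 m)
  specVΓV : IsCompExtension (perturbation ω 𝒱) (derivOp ω H).domain (ΓV ω 𝒱 m) (VΓV ω 𝒱 m)

/-- `Ṽ = J_m V + (I + Γ_m V)⁻¹ (V Γ_m V - (Γ_m V) (J_m V))`. -/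
def tildeV (m : ℕ) : L2 ω H →L[ℂ] L2 ω H :=
  JV ω 𝒱 m + Ring.inverse (1 + ΓV ω 𝒱 m) * (VΓV ω 𝒱 m - ΓV ω 𝒱 m * JV ω 𝒱 m)

/-- The nonlinear map `Φ(X) = B Γ_k X - (Γ_k X) (J_k B) - (Γ_k X) J_k (B Γ_k X) + B`. -/
def nonlinearΦ (k : ℕ) (B X : L2 ω H →L[ℂ] L2 ω H) : L2 ω H →L[ℂ] L2 ω H :=
  B * bddΓ ω k X - bddΓ ω k X * bddJ ω k B - bddΓ ω k X * bddJ ω k (B * bddΓ ω k X) + B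

/-- `X ∈ ℳ` is a fixed point of `Φ` in the closed ball `‖X - B‖_ℳ ≤ 3 ‖B‖_ℳ` of the space `ℳ`
associated with `B`. -/
structure IsFixedPointInBall (k : ℕ) (B X : L2 ω H →L[ℂ] L2 ω H) : Prop where
  mem : MemM (proj ω H) B X
  ball : normM (proj ω H) B (X - B) ≤ 3 * normM (proj ω H) B B
  fixed : nonlinearΦ ω k B X = X

end Transforms

end InvolutionOperator

end

open InvolutionOperator

noncomputable section

namespace InvolutionOperator

set_option linter.unusedSectionVars false

/-! ### Square summable families -/

/-! This is the method of similar operators, carried out on block matrices. The projections `P_n`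
form a resolution of the identity (completeness of the exponentials), so a bounded operator is
determined by its blocks `P_j X P_l`. A square summable block matrix defines a bounded operator, and
such operators form an algebra. On them `J_k` and `Γ_k` multiply blocks by bounded scalars.

Membership of `Ṽ` in `𝔖₂`. Reflection makes `V` a Hankel matrix: its `(j, l)` block is `𝒱̂(j + l)`.
Square summability of the coefficients makes `J_m V` and `Γ_m V` square summable
(`summable_weightJ_mul`, `summable_weightΓ_mul`). The blocks of `V Γ_m V` are those of the second
hypothesis up to a constant and finitely many products, and closedness of `V` identifies the
operator with its matrix (`VΓV_spec`). Finally `(I + Γ_m V)⁻¹ - I` is again in `𝔖₂`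
(`MemHS.inverse_sub_one`).

Membership of `Ṽ` in `ℳ`. Factoring through `F` on the right or left amounts to square summability
with weight `1/α_l` on columns or `1/α_j` on rows. Since `‖Ṽ‖₂ α_l²` dominates the square root of
the tail `t_l`, this follows from the convergence of `∑ c_l / √t_l` for the tails of a convergent
series.

Fixed point. The bounds `‖Γ_k X‖₂ ≤ α̃_{k+1} ‖X‖_ℳ` and `α_j |γ_{jl}| ≤ α̃_{k+1}`, where `γ_{jl}`
are the weights of `Γ_k`, give `‖X Γ_k Y‖_ℳ, ‖(Γ_k X) Y‖_ℳ ≤ α̃_{k+1} ‖X‖_ℳ ‖Y‖_ℳ`. With `4 α̃_{k+1}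
‖Ṽ‖_ℳ < 1` the map `Φ` is then a contraction of the ball of radius `3 ‖Ṽ‖_ℳ`.

Similarity. As `J_k((Γ_k X) J_k Z) = 0`, a fixed point satisfies `X = B + B Γ_k X - (Γ_k X) J_k X`
with `B = Ṽ`. Combined with `L₀ Γ_k X - (Γ_k X) L₀ = X - J_k X`, this is the intertwining relation;
the resolvent of `L₀` takes care of the domains. Since `J_k X` has blocks only in the coarse block
diagonal, it commutes with the coarse projections and splits. -/

theorem summable_sq_add {ι : Type*} {f g : ι → ℝ} (hf0 : ∀ i, 0 ≤ f i) (hg0 : ∀ i, 0 ≤ g i)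
    (hf : Summable fun i => f i ^ 2) (hg : Summable fun i => g i ^ 2) :
    (Summable fun i => (f i + g i) ^ 2) ∧
      √(∑' i, (f i + g i) ^ 2) ≤ √(∑' i, f i ^ 2) + √(∑' i, g i ^ 2) := by
  have h := Real.Lp_add_le_tsum_of_nonneg (p := 2) (by norm_num) hf0 hg0
    (by simpa using hf) (by simpa using hg)
  simpa [Real.sqrt_eq_rpow] using h

theorem summable_mul_of_sq {ι : Type*} {f g : ι → ℝ} (hf0 : ∀ i, 0 ≤ f i) (hg0 : ∀ i, 0 ≤ g i)
    (hf : Summable fun i => f i ^ 2) (hg : Summable fun i => g i ^ 2) :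
    Summable fun i => f i * g i := by
  refine Summable.of_nonneg_of_le (fun i => mul_nonneg (hf0 i) (hg0 i)) (fun i => ?_) (hf.add hg)
  nlinarith [sq_nonneg (f i - g i), sq_nonneg (f i + g i)]

/-- Cauchy--Schwarz for finite sums bounded by the full square sums. -/
theorem sum_mul_le_sqrt_tsum {ι : Type*} {f g : ι → ℝ}
    (hf : Summable fun i => f i ^ 2) (hg : Summable fun i => g i ^ 2) (s : Finset ι) :
    ∑ i ∈ s, f i * g i ≤ √(∑' i, f i ^ 2) * √(∑' i, g i ^ 2) := by
  rw [← Real.sqrt_mul (tsum_nonneg fun i => sq_nonneg _)]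
  refine Real.le_sqrt_of_sq_le ((Finset.sum_mul_sq_le_sq_mul_sq s f g).trans ?_)
  exact mul_le_mul (hf.sum_le_tsum s fun i _ => sq_nonneg _)
    (hg.sum_le_tsum s fun i _ => sq_nonneg _) (Finset.sum_nonneg fun i _ => sq_nonneg _)
    (tsum_nonneg fun i => sq_nonneg _)

/-! ### Bounded operators as block matrices. -/

section Blocks

variable {E : Type*} [NormedAddCommGroup E] [InnerProductSpace ℂ E] [CompleteSpace E]
variable {P : ℤ → E →L[ℂ] E}

namespace IsResolutionOfIdentity

variable (hP : IsResolutionOfIdentity P)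
include hP

theorem mul_eq_ite (i j : ℤ) : P i * P j = if i = j then P i else 0 := by
  split_ifs with h
  · rw [h, hP.idempotent]
  · exact hP.orthogonal i j h

theorem apply_apply (i j : ℤ) (x : E) : P i (P j x) = if i = j then P i x else 0 := by
  have := congrArg (fun T : E →L[ℂ] E => T x) (hP.mul_eq_ite i j)
  simp only [mul_apply_eq_comp] at this
  rw [this]
  split_ifs <;> rfl

theorem norm_apply_le (i : ℤ) (x : E) : ‖P i x‖ ≤ ‖x‖ := by
  have h := le_hasSum (hP.hasSum_norm x) i fun j _ => sq_nonneg _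
  exact le_of_sq_le_sq h (norm_nonneg _) |>.trans le_rfl

theorem ext_vec {x y : E} (h : ∀ i, P i x = P i y) : x = y :=
  (hP.hasSum x).unique (by simpa only [h] using hP.hasSum y)

/-- Continuity carries `X` and `Y` through `x = ∑ P_l x`, so blocks suffice. Operator identities
below are reduced to scalar identities between multipliers in this way. -/
theorem ext_blocks {X Y : E →L[ℂ] E} (h : ∀ j l, P j * X * P l = P j * Y * P l) : X = Y := by
  ext x
  have key : ∀ l, X (P l x) = Y (P l x) := fun l => hP.ext_vec fun j =>
    congrArg (fun T : E →L[ℂ] E => T x) (h j l)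
  exact ((hP.hasSum x).mapL X).unique (by simpa only [key] using (hP.hasSum x).mapL Y)

/-- Multiplication of block matrices. -/
theorem hasSum_mul (X Y : E →L[ℂ] E) (j l : ℤ) (x : E) :
    HasSum (fun n => (P j * X * P n) ((P n * Y * P l) x)) ((P j * (X * Y) * P l) x) := by
  have h := (hP.hasSum (Y (P l x))).mapL (P j * X)
  have hn : ∀ n, (P j * X * P n) ((P n * Y * P l) x) = (P j * X) (P n (Y (P l x))) := fun n => by
    simp [hP.apply_apply]
  simp only [hn]
  exact h

/-- Vectors in the ranges of the projections with square summable norms can be summed. -/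
theorem summable_of_sq {v : ℤ → E} (hv : ∀ n, P n (v n) = v n)
    (hs : Summable fun n => ‖v n‖ ^ 2) : Summable v := by
  have hPv : ∀ i n, P i (v n) = if i = n then v n else 0 := fun i n => by
    rw [← hv n, hP.apply_apply]
    split_ifs with h
    · rw [h]
    · rfl
  -- Pythagoras for finite sums is Parseval applied to a partial sum; the Cauchy criterion for `∑ ‖v
  -- n‖²` then transfers to `∑ v n`.
  have hnorm : ∀ s : Finset ℤ, ‖∑ n ∈ s, v n‖ ^ 2 = ∑ n ∈ s, ‖v n‖ ^ 2 := fun s => by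
    refine (hP.hasSum_norm _).unique ?_
    have hi : ∀ i, P i (∑ n ∈ s, v n) = if i ∈ s then v i else 0 := fun i => by
      rw [map_sum]
      simp [hPv]
    have h1 := hasSum_sum_of_ne_finset_zero (L := .unconditional _)
      (f := fun i => ‖P i (∑ n ∈ s, v n)‖ ^ 2) (s := s)
      (fun i hi' => by simp [hi, hi'])
    convert h1 using 1
    refine Finset.sum_congr rfl fun i hi' => ?_
    rw [hi, if_pos hi']
  rw [summable_iff_vanishing_norm] at hs ⊢
  intro ε hε
  obtain ⟨s, hs⟩ := hs (ε ^ 2) (by positivity)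
  refine ⟨s, fun t ht => ?_⟩
  have := hs t ht
  rw [← hnorm, Real.norm_of_nonneg (sq_nonneg _)] at this
  exact lt_of_pow_lt_pow_left₀ 2 hε.le this

theorem apply_tsum {v : ℤ → E} (hv : ∀ n, P n (v n) = v n)
    (hs : Summable fun n => ‖v n‖ ^ 2) (i : ℤ) : P i (∑' n, v n) = v i := by
  rw [(P i).map_tsum (hP.summable_of_sq hv hs), tsum_eq_single i]
  · exact hv i
  · intro n hn
    rw [← hv n, hP.apply_apply, if_neg hn.symm]

/-- Diagonal operators with bounded entries. -/
theorem exists_diagonal {c : ℤ → ℂ} {C : ℝ} (hc : ∀ n, ‖c n‖ ≤ C) :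
    ∃ D : E →L[ℂ] E, (∀ x, D x = ∑' n, c n • P n x) ∧ (∀ n, P n * D = c n • P n) ∧
      (∀ n, D * P n = c n • P n) ∧ ‖D‖ ≤ C := by
  have hC : 0 ≤ C := (norm_nonneg _).trans (hc 0)
  have hv : ∀ x n, P n (c n • P n x) = c n • P n x := fun x n => by simp [hP.apply_apply]
  have hle : ∀ x n, ‖c n • P n x‖ ^ 2 ≤ C ^ 2 * ‖P n x‖ ^ 2 := fun x n => by
    rw [norm_smul, mul_pow]
    gcongr
    exact hc n
  have hs2 : ∀ x, Summable fun n => ‖c n • P n x‖ ^ 2 := fun x =>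
    .of_nonneg_of_le (fun n => sq_nonneg _) (hle x) ((hP.hasSum_norm x).summable.mul_left _)
  have hs : ∀ x, Summable fun n => c n • P n x := fun x => hP.summable_of_sq (hv x) (hs2 x)
  let L : E →ₗ[ℂ] E :=
    { toFun := fun x => ∑' n, c n • P n x
      map_add' := fun x y => by
        rw [← (hs x).tsum_add (hs y)]
        simp
      map_smul' := fun a x => by
        rw [RingHom.id_apply, ← (hs x).tsum_const_smul a]
        simp only [map_smul, smul_comm a] }
  have hPL : ∀ n x, P n (L x) = c n • P n x := fun n x => hP.apply_tsum (hv x) (hs2 x) n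
  have hb : ∀ x, ‖L x‖ ≤ C * ‖x‖ := fun x => by
    refine le_of_sq_le_sq ?_ (by positivity)
    rw [mul_pow]
    refine hasSum_le (fun n => ?_) (hP.hasSum_norm (L x)) ((hP.hasSum_norm x).mul_left _)
    rw [hPL]
    exact hle x n
  refine ⟨L.mkContinuous C hb, fun x => rfl, fun n => ?_, fun n => ?_,
    L.mkContinuous_norm_le hC hb⟩
  · ext x
    exact hPL n x
  · ext x
    refine hP.ext_vec fun i => ?_
    change P i (L (P n x)) = P i (c n • P n x)
    rw [hPL, map_smul, hP.apply_apply]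
    split_ifs with h
    · rw [h]
    · simp

end IsResolutionOfIdentity

/-! ### Weighted Hilbert--Schmidt classes -/

variable (P) in
/-- Operators with `∑ (w_{jℓ} ‖P_j X P_ℓ‖)² < ∞`. -/
def WMem (w : ℤ → ℤ → ℝ) (X : E →L[ℂ] E) : Prop :=
  Summable fun p : ℤ × ℤ => (w p.1 p.2 * ‖P p.1 * X * P p.2‖) ^ 2

variable (P) in
/-- The weighted Hilbert--Schmidt norm. -/
def wNorm (w : ℤ → ℤ → ℝ) (X : E →L[ℂ] E) : ℝ :=
  √(∑' p : ℤ × ℤ, (w p.1 p.2 * ‖P p.1 * X * P p.2‖) ^ 2)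

theorem wMem_one {X : E →L[ℂ] E} : WMem P (fun _ _ => 1) X ↔ MemHS P X := by
  simp [WMem, MemHS]

theorem wNorm_one (X : E →L[ℂ] E) : wNorm P (fun _ _ => 1) X = hsNorm P X := by
  simp [wNorm, hsNorm]

theorem wNorm_nonneg (w : ℤ → ℤ → ℝ) (X : E →L[ℂ] E) : 0 ≤ wNorm P w X := Real.sqrt_nonneg _

theorem wNorm_sq (w : ℤ → ℤ → ℝ) (X : E →L[ℂ] E) :
    wNorm P w X ^ 2 = ∑' p : ℤ × ℤ, (w p.1 p.2 * ‖P p.1 * X * P p.2‖) ^ 2 :=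
  Real.sq_sqrt (tsum_nonneg fun _ => sq_nonneg _)

/-- The comparison is entrywise and lets both the weight and the operator change, so it serves for
changes of weight and for scalar multipliers alike. -/
theorem WMem.of_le {w w' : ℤ → ℤ → ℝ} {X Y : E →L[ℂ] E} {C : ℝ} (hC : 0 ≤ C)
    (hw' : ∀ j l, 0 ≤ w' j l)
    (h : ∀ j l, w' j l * ‖P j * Y * P l‖ ≤ C * (w j l * ‖P j * X * P l‖)) (hX : WMem P w X) :
    WMem P w' Y ∧ wNorm P w' Y ≤ C * wNorm P w X := by
  have hle : ∀ p : ℤ × ℤ, (w' p.1 p.2 * ‖P p.1 * Y * P p.2‖) ^ 2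
      ≤ C ^ 2 * (w p.1 p.2 * ‖P p.1 * X * P p.2‖) ^ 2 := fun p => by
    rw [← mul_pow]
    exact pow_le_pow_left₀ (mul_nonneg (hw' _ _) (norm_nonneg _)) (h _ _) 2
  have hs : WMem P w' Y := Summable.of_nonneg_of_le (fun _ => sq_nonneg _) hle (hX.mul_left _)
  refine ⟨hs, Real.sqrt_le_iff.2 ⟨mul_nonneg hC (wNorm_nonneg _ _), ?_⟩⟩
  rw [mul_pow, wNorm_sq, ← tsum_mul_left]
  exact hs.tsum_le_tsum hle (hX.mul_left _)

theorem WMem.add {w : ℤ → ℤ → ℝ} {X Y : E →L[ℂ] E} (hw : ∀ j l, 0 ≤ w j l)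
    (hX : WMem P w X) (hY : WMem P w Y) :
    WMem P w (X + Y) ∧ wNorm P w (X + Y) ≤ wNorm P w X + wNorm P w Y := by
  have h := summable_sq_add (fun p : ℤ × ℤ => mul_nonneg (hw p.1 p.2) (norm_nonneg _))
    (fun p : ℤ × ℤ => mul_nonneg (hw p.1 p.2) (norm_nonneg _)) hX hY
  have hle : ∀ p : ℤ × ℤ, (w p.1 p.2 * ‖P p.1 * (X + Y) * P p.2‖) ^ 2 ≤
      (w p.1 p.2 * ‖P p.1 * X * P p.2‖ + w p.1 p.2 * ‖P p.1 * Y * P p.2‖) ^ 2 := fun p => by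
    refine pow_le_pow_left₀ (mul_nonneg (hw _ _) (norm_nonneg _)) ?_ 2
    rw [← mul_add, mul_add, add_mul]
    exact mul_le_mul_of_nonneg_left (norm_add_le _ _) (hw _ _)
  have hs : WMem P w (X + Y) := Summable.of_nonneg_of_le (fun _ => sq_nonneg _) hle h.1
  exact ⟨hs, (Real.sqrt_le_sqrt (hs.tsum_le_tsum hle h.1)).trans h.2⟩

theorem WMem.smul {w : ℤ → ℤ → ℝ} {X : E →L[ℂ] E} (c : ℂ) (hX : WMem P w X) :
    WMem P w (c • X) ∧ wNorm P w (c • X) = ‖c‖ * wNorm P w X := by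
  have he : ∀ p : ℤ × ℤ, (w p.1 p.2 * ‖P p.1 * (c • X) * P p.2‖) ^ 2
      = ‖c‖ ^ 2 * (w p.1 p.2 * ‖P p.1 * X * P p.2‖) ^ 2 := fun p => by
    rw [mul_smul_comm, smul_mul_assoc, norm_smul]
    ring
  refine ⟨?_, ?_⟩
  · simp only [WMem, he]
    exact hX.mul_left _
  · simp only [wNorm, he]
    rw [tsum_mul_left, Real.sqrt_mul (sq_nonneg _), Real.sqrt_sq (norm_nonneg _)]

theorem wMem_zero (w : ℤ → ℤ → ℝ) : WMem P w 0 ∧ wNorm P w 0 = 0 := by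
  simp [WMem, wNorm, summable_zero]

theorem WMem.neg {w : ℤ → ℤ → ℝ} {X : E →L[ℂ] E} (hX : WMem P w X) :
    WMem P w (-X) ∧ wNorm P w (-X) = wNorm P w X := by
  simpa using hX.smul (-1)

theorem WMem.sub {w : ℤ → ℤ → ℝ} {X Y : E →L[ℂ] E} (hw : ∀ j l, 0 ≤ w j l)
    (hX : WMem P w X) (hY : WMem P w Y) :
    WMem P w (X - Y) ∧ wNorm P w (X - Y) ≤ wNorm P w X + wNorm P w Y := by
  rw [sub_eq_add_neg, ← hY.neg.2]
  exact hX.add hw hY.neg.1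

/-- The weighted norms are lower semicontinuous. -/
theorem wMem_of_tendsto {ι : Type*} {f : Filter ι} [f.NeBot] {w : ℤ → ℤ → ℝ} {X : E →L[ℂ] E}
    {u : ι → E →L[ℂ] E} {C : ℝ} (hC : 0 ≤ C) (hu : Tendsto u f (𝓝 X))
    (h : ∀ᶠ n in f, WMem P w (u n) ∧ wNorm P w (u n) ≤ C) : WMem P w X ∧ wNorm P w X ≤ C := by
  have hs : ∀ s : Finset (ℤ × ℤ),
      ∑ p ∈ s, (w p.1 p.2 * ‖P p.1 * X * P p.2‖) ^ 2 ≤ C ^ 2 := fun s => by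
    have ht : Tendsto (fun n => ∑ p ∈ s, (w p.1 p.2 * ‖P p.1 * u n * P p.2‖) ^ 2) f
        (𝓝 (∑ p ∈ s, (w p.1 p.2 * ‖P p.1 * X * P p.2‖) ^ 2)) :=
      tendsto_finsetSum _ fun p _ =>
        ((((hu.const_mul (P p.1)).mul_const (P p.2)).norm).const_mul _).pow 2
    refine le_of_tendsto ht (h.mono fun n hn => ?_)
    refine (hn.1.sum_le_tsum s fun _ _ => sq_nonneg _).trans ?_
    rw [← wNorm_sq]
    exact pow_le_pow_left₀ (wNorm_nonneg _ _) hn.2 2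
  exact ⟨summable_of_sum_le (fun _ => sq_nonneg _) hs,
    Real.sqrt_le_iff.2 ⟨hC, Real.tsum_le_of_sum_le (fun _ => sq_nonneg _) hs⟩⟩

variable (hP : IsResolutionOfIdentity P)
include hP

/-- Cauchy–Schwarz over the intermediate index, with the weight split as `w j l ≤ u j n * v n l`.
Different splittings of `1/α_l` and `1/α_j` yield all the product estimates in `ℳ`. -/
theorem WMem.mul {u v w : ℤ → ℤ → ℝ} {X Y : E →L[ℂ] E} (hw : ∀ j l, 0 ≤ w j l)
    (h : ∀ j n l, w j l ≤ u j n * v n l) (hX : WMem P u X) (hY : WMem P v Y) :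
    WMem P w (X * Y) ∧ wNorm P w (X * Y) ≤ wNorm P u X * wNorm P v Y := by
  have hX1 : ∀ j, Summable fun n => (u j n * ‖P j * X * P n‖) ^ 2 := fun j => hX.prod_factor j
  have hY1 : ∀ l, Summable fun n => (v n l * ‖P n * Y * P l‖) ^ 2 := fun l =>
    hY.prod_symm.prod_factor l
  have entry : ∀ j l, w j l * ‖P j * (X * Y) * P l‖ ≤
      √(∑' n, (u j n * ‖P j * X * P n‖) ^ 2) * √(∑' n, (v n l * ‖P n * Y * P l‖) ^ 2) := by
    intro j l
    set K := √(∑' n, (u j n * ‖P j * X * P n‖) ^ 2) * √(∑' n, (v n l * ‖P n * Y * P l‖) ^ 2)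
      with hK
    have hK0 : 0 ≤ K := by positivity
    have hn : w j l * ‖P j * (X * Y) * P l‖ = ‖((w j l : ℝ) : ℂ) • (P j * (X * Y) * P l)‖ := by
      rw [norm_smul, Complex.norm_real, Real.norm_of_nonneg (hw j l)]
    rw [hn]
    refine ContinuousLinearMap.opNorm_le_bound _ hK0 fun x => ?_
    have ht := ((hP.hasSum_mul X Y j l x).const_smul ((w j l : ℝ) : ℂ)).norm
    refine le_of_tendsto ht (Eventually.of_forall fun s => ?_)
    refine (norm_sum_le _ _).trans ?_
    calc ∑ n ∈ s, ‖((w j l : ℝ) : ℂ) • (P j * X * P n) ((P n * Y * P l) x)‖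
        ≤ ∑ n ∈ s, ((u j n * ‖P j * X * P n‖) * (v n l * ‖P n * Y * P l‖)) * ‖x‖ := by
          refine Finset.sum_le_sum fun n _ => ?_
          rw [norm_smul, Complex.norm_real, Real.norm_of_nonneg (hw j l)]
          have h1 : ‖(P j * X * P n) ((P n * Y * P l) x)‖ ≤
              ‖P j * X * P n‖ * (‖P n * Y * P l‖ * ‖x‖) :=
            (ContinuousLinearMap.le_opNorm _ _).trans
              (mul_le_mul_of_nonneg_left (ContinuousLinearMap.le_opNorm _ _) (norm_nonneg _))
          calc _ ≤ (u j n * v n l) * (‖P j * X * P n‖ * (‖P n * Y * P l‖ * ‖x‖)) :=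
                mul_le_mul (h j n l) h1 (norm_nonneg _) ((hw j l).trans (h j n l))
            _ = _ := by ring
      _ ≤ K * ‖x‖ := by
          rw [← Finset.sum_mul]
          exact mul_le_mul_of_nonneg_right (sum_mul_le_sqrt_tsum (hX1 j) (hY1 l) s)
            (norm_nonneg _)
  have hle : ∀ p : ℤ × ℤ, (w p.1 p.2 * ‖P p.1 * (X * Y) * P p.2‖) ^ 2 ≤
      (∑' n, (u p.1 n * ‖P p.1 * X * P n‖) ^ 2) * (∑' n, (v n p.2 * ‖P n * Y * P p.2‖) ^ 2) := by
    intro p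
    refine (pow_le_pow_left₀ (mul_nonneg (hw _ _) (norm_nonneg _)) (entry p.1 p.2) 2).trans ?_
    rw [mul_pow, Real.sq_sqrt (tsum_nonneg fun _ => sq_nonneg _),
      Real.sq_sqrt (tsum_nonneg fun _ => sq_nonneg _)]
  have hA : Summable fun j => ∑' n, (u j n * ‖P j * X * P n‖) ^ 2 := hX.prod
  have hB : Summable fun l => ∑' n, (v n l * ‖P n * Y * P l‖) ^ 2 := hY.prod_symm.prod
  have hAB := hA.mul_of_nonneg hB (fun _ => tsum_nonneg fun _ => sq_nonneg _)
    (fun _ => tsum_nonneg fun _ => sq_nonneg _)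
  have hs : WMem P w (X * Y) := Summable.of_nonneg_of_le (fun _ => sq_nonneg _) hle hAB
  refine ⟨hs, Real.sqrt_le_iff.2 ⟨mul_nonneg (wNorm_nonneg _ _) (wNorm_nonneg _ _), ?_⟩⟩
  refine (hs.tsum_le_tsum hle hAB).trans (le_of_eq ?_)
  rw [← hA.tsum_mul_tsum hB hAB, mul_pow, wNorm_sq, wNorm_sq]
  have hYs : Summable fun p : ℤ × ℤ => (v p.2 p.1 * ‖P p.2 * Y * P p.1‖) ^ 2 := hY.prod_symm
  rw [Summable.tsum_prod hX, ← (Equiv.prodComm ℤ ℤ).tsum_eq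
    (fun p : ℤ × ℤ => (v p.1 p.2 * ‖P p.1 * Y * P p.2‖) ^ 2)]
  exact congrArg _ (Summable.tsum_prod hYs).symm

theorem MemHS.mul {X Y : E →L[ℂ] E} (hX : MemHS P X) (hY : MemHS P Y) :
    MemHS P (X * Y) ∧ hsNorm P (X * Y) ≤ hsNorm P X * hsNorm P Y := by
  simpa only [wMem_one, wNorm_one] using WMem.mul hP (w := fun _ _ => 1)
    (fun _ _ => zero_le_one) (by simp) (wMem_one.2 hX) (wMem_one.2 hY)

/-- Cauchy–Schwarz along each block row bounds `‖P_j X x‖`; Parseval then sums over `j`. -/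
theorem MemHS.norm_le {X : E →L[ℂ] E} (hX : MemHS P X) : ‖X‖ ≤ hsNorm P X := by
  refine ContinuousLinearMap.opNorm_le_bound _ (Real.sqrt_nonneg _) fun x => ?_
  have hX1 : ∀ j, Summable fun n => ‖P j * X * P n‖ ^ 2 := fun j => hX.prod_factor j
  have entry : ∀ j, ‖P j (X x)‖ ≤ √(∑' n, ‖P j * X * P n‖ ^ 2) * ‖x‖ := fun j => by
    have ht := ((hP.hasSum x).mapL (P j * X)).norm
    refine le_of_tendsto ht (Eventually.of_forall fun s => ?_)
    refine (norm_sum_le _ _).trans ?_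
    have h1 : ∀ n ∈ s, ‖(P j * X) (P n x)‖ ≤ ‖P j * X * P n‖ * ‖P n x‖ := fun n _ => by
      have := (P j * X * P n).le_opNorm (P n x)
      simpa [hP.apply_apply] using this
    refine (Finset.sum_le_sum h1).trans
      ((sum_mul_le_sqrt_tsum (hX1 j) (hP.hasSum_norm x).summable s).trans (le_of_eq ?_))
    rw [(hP.hasSum_norm x).tsum_eq, Real.sqrt_sq (norm_nonneg _)]
  refine le_of_sq_le_sq ?_ (mul_nonneg (Real.sqrt_nonneg _) (norm_nonneg _))
  rw [mul_pow, hsNorm, Real.sq_sqrt (tsum_nonneg fun _ => sq_nonneg _), Summable.tsum_prod hX]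
  refine hasSum_le (fun j => ?_) (hP.hasSum_norm (X x)) (hX.prod.hasSum.mul_right _)
  refine (pow_le_pow_left₀ (norm_nonneg _) (entry j) 2).trans (le_of_eq ?_)
  rw [mul_pow, Real.sq_sqrt (tsum_nonneg fun _ => sq_nonneg _)]

/-- A square summable block matrix defines a bounded operator. -/
theorem exists_of_blocks {A : ℤ × ℤ → E →L[ℂ] E} (hA : ∀ p, P p.1 * A p * P p.2 = A p)
    (hs : Summable fun p => ‖A p‖ ^ 2) : ∃ Y : E →L[ℂ] E, ∀ j l, P j * Y * P l = A (j, l) := by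
  have hblk : ∀ (p : ℤ × ℤ) (j l : ℤ), P j * A p * P l = if p = (j, l) then A (j, l) else 0 := by
    rintro ⟨p, q⟩ j l
    have h1 : P j * A (p, q) * P l = (P j * P p) * A (p, q) * (P q * P l) := by
      conv_lhs => rw [← hA (p, q)]
      simp only [mul_assoc]
    rw [h1, hP.mul_eq_ite, hP.mul_eq_ite]
    by_cases h2 : j = p <;> by_cases h3 : q = l
    · subst h2 h3
      simpa using hA (j, q)
    · simp [h3]
    · simp [h2, Ne.symm h2]
    · simp [h3]
  have hsum : ∀ (s : Finset (ℤ × ℤ)) (j l : ℤ),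
      P j * (∑ p ∈ s, A p) * P l = if (j, l) ∈ s then A (j, l) else 0 := fun s j l => by
    rw [Finset.mul_sum, Finset.sum_mul]
    simp [hblk]
  -- The operator norm is at most the Hilbert–Schmidt norm, so the Cauchy criterion for `∑ ‖A p‖²`
  -- gives summability of `A` in operator norm.
  have hnorm : ∀ s : Finset (ℤ × ℤ), ‖∑ p ∈ s, A p‖ ^ 2 ≤ ∑ p ∈ s, ‖A p‖ ^ 2 := fun s => by
    have h0 := hasSum_sum_of_ne_finset_zero (L := .unconditional _)
      (f := fun p : ℤ × ℤ => ‖P p.1 * (∑ p ∈ s, A p) * P p.2‖ ^ 2) (s := s)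
      (fun p hp => by simp [hsum, hp])
    have hm : MemHS P (∑ p ∈ s, A p) := h0.summable
    refine (pow_le_pow_left₀ (norm_nonneg _) (hm.norm_le hP) 2).trans (le_of_eq ?_)
    rw [hsNorm, Real.sq_sqrt (tsum_nonneg fun _ => sq_nonneg _), h0.tsum_eq]
    refine Finset.sum_congr rfl fun p hp => ?_
    rw [hsum, if_pos hp]
  have hsA : Summable A := by
    rw [summable_iff_vanishing_norm] at hs ⊢
    intro ε hε
    obtain ⟨s, hs⟩ := hs (ε ^ 2) (by positivity)
    refine ⟨s, fun t ht => ?_⟩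
    have := hs t ht
    rw [Real.norm_of_nonneg (Finset.sum_nonneg fun _ _ => sq_nonneg _)] at this
    exact lt_of_pow_lt_pow_left₀ 2 hε.le ((hnorm t).trans_lt this)
  refine ⟨∑' p, A p, fun j l => ?_⟩
  rw [← hsA.tsum_mul_left, ← (hsA.mul_left _).tsum_mul_right, tsum_eq_single (j, l)]
  · exact hA (j, l)
  · intro p hp
    rw [hblk, if_neg hp]

/-- Entrywise products with scalars. -/
theorem exists_schur {X : E →L[ℂ] E} {c : ℤ → ℤ → ℂ} (hX : WMem P (fun j l => ‖c j l‖) X) :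
    ∃ Y : E →L[ℂ] E, ∀ j l, P j * Y * P l = c j l • (P j * X * P l) := by
  refine exists_of_blocks hP (A := fun p => c p.1 p.2 • (P p.1 * X * P p.2)) (fun p => ?_) ?_
  · have h1 : P p.1 * (c p.1 p.2 • (P p.1 * X * P p.2)) * P p.2
        = c p.1 p.2 • ((P p.1 * P p.1) * X * (P p.2 * P p.2)) := by
      simp only [mul_smul_comm, smul_mul_assoc, mul_assoc]
    rw [h1, hP.idempotent, hP.idempotent]
  · simp only [norm_smul]
    exact hX

end Blocks

/-! ### Tails of summable families indexed by the integers -/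

section Tail

/-- The tail sum `∑_{|ℓ| ≥ |n|} c_ℓ`. -/
def tailSum (c : ℤ → ℝ) (n : ℤ) : ℝ := ∑' l : {l : ℤ // |n| ≤ |l|}, c l

variable {c : ℤ → ℝ} (hc : ∀ l, 0 ≤ c l) (hs : Summable c)
include hc hs

theorem tailSum_eq (n : ℤ) : tailSum c n = ∑' l, {l : ℤ | |n| ≤ |l|}.indicator c l :=
  tsum_subtype {l : ℤ | |n| ≤ |l|} c

omit hs in
theorem tailSum_nonneg (n : ℤ) : 0 ≤ tailSum c n := tsum_nonneg fun _ => hc _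

theorem tailSum_anti {i j : ℤ} (h : |i| ≤ |j|) : tailSum c j ≤ tailSum c i := by
  rw [tailSum_eq hc hs, tailSum_eq hc hs]
  refine (hs.indicator _).tsum_le_tsum (fun l => ?_) (hs.indicator _)
  exact Set.indicator_le_indicator_of_subset (fun l hl => h.trans hl) hc l

theorem le_tailSum {n l : ℤ} (h : |n| ≤ |l|) : c l ≤ tailSum c n :=
  (hs.comp_injective Subtype.val_injective).le_tsum
    (⟨l, h⟩ : {l : ℤ // |n| ≤ |l|}) fun _ _ => hc _

theorem tailSum_zero : tailSum c 0 = ∑' l, c l := by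
  rw [tailSum_eq hc hs]
  congr 1
  funext l
  simp

/-- Consecutive tails differ by one shell `|l| = n`. As a finite set, `{n, -n}` collapses to a
single point for `n = 0`, so `c 0` is counted once. -/
theorem tailSum_sub_succ (n : ℕ) :
    tailSum c n - tailSum c (n + 1) = ∑ l ∈ ({(n : ℤ), -(n : ℤ)} : Finset ℤ), c l := by
  rw [tailSum_eq hc hs, tailSum_eq hc hs, ← (hs.indicator _).tsum_sub (hs.indicator _)]
  have hmem : ∀ l : ℤ, l ∈ ({(n : ℤ), -(n : ℤ)} : Finset ℤ) ↔ |l| = n := fun l => by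
    rw [Finset.mem_insert, Finset.mem_singleton, abs_eq (by positivity)]
  have hn : |(n : ℤ) + 1| = n + 1 := abs_of_nonneg (by positivity)
  rw [tsum_eq_sum (s := ({(n : ℤ), -(n : ℤ)} : Finset ℤ))]
  · refine Finset.sum_congr rfl fun l hl => ?_
    have := (hmem l).1 hl
    simp [Set.indicator, this, hn]
  · intro l hl
    have := mt (hmem l).2 hl
    simp only [Set.indicator, Set.mem_ofPred_eq, Nat.abs_cast, hn]
    by_cases h1 : (n : ℤ) ≤ |l|
    · rw [if_pos h1, if_pos (by omega), sub_self]
    · rw [if_neg h1, if_neg (by omega), sub_self]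

/-- The classical comparison `∑ c_ℓ / √t_ℓ ≤ 2 √t_0` for the tails `t_ℓ` of `∑ c_ℓ`. -/
theorem summable_div_sqrt_tailSum : Summable fun l => c l / √(tailSum c l) := by
  -- The tail is constant on each shell `|l| = n`, where the terms add up to `(t_n - t_{n+1}) /
  -- √t_n`; the bound telescopes.
  have hstep : ∀ n : ℕ, ∑ l ∈ Finset.Ioo (-(n : ℤ)) n, c l / √(tailSum c l)
      ≤ 2 * √(tailSum c 0) - 2 * √(tailSum c n) := by
    intro n
    induction n with
    | zero => simp
    | succ n ih =>
      have hIoo : Finset.Ioo (-((n + 1 : ℕ) : ℤ)) ((n + 1 : ℕ) : ℤ)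
          = Finset.Ioo (-(n : ℤ)) n ∪ {(n : ℤ), -(n : ℤ)} := by
        ext l
        simp only [Finset.mem_Ioo, Finset.mem_union, Finset.mem_insert, Finset.mem_singleton]
        omega
      have hdis : Disjoint (Finset.Ioo (-(n : ℤ)) n) {(n : ℤ), -(n : ℤ)} := by
        rw [Finset.disjoint_left]
        simp only [Finset.mem_Ioo, Finset.mem_insert, Finset.mem_singleton]
        omega
      rw [hIoo, Finset.sum_union hdis]
      have hsame : ∀ l ∈ ({(n : ℤ), -(n : ℤ)} : Finset ℤ),
          c l / √(tailSum c l) = c l / √(tailSum c n) := by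
        intro l hl
        have habs : |l| = |(n : ℤ)| := by
          simp only [Finset.mem_insert, Finset.mem_singleton] at hl
          rcases hl with rfl | rfl
          · rfl
          · exact abs_neg _
        rw [le_antisymm (tailSum_anti hc hs habs.ge) (tailSum_anti hc hs habs.le)]
      rw [Finset.sum_congr rfl hsame, ← Finset.sum_div, ← tailSum_sub_succ hc hs]
      push_cast
      set a := tailSum c n
      set b := tailSum c (n + 1)
      have ha : 0 ≤ a := tailSum_nonneg hc _
      have hb : 0 ≤ b := tailSum_nonneg hc _
      have hba : b ≤ a := tailSum_anti hc hs (by rw [Nat.abs_cast, abs_of_nonneg] <;> omega)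
      -- For `a > 0` this is `(√a - √b)² ≥ 0`; for `a = 0` also `b = 0` and both sides vanish.
      have : (a - b) / √a ≤ 2 * √a - 2 * √b := by
        rcases ha.eq_or_lt with h0 | h0
        · have : b = 0 := le_antisymm (hba.trans h0.ge) hb
          simp [← h0, this]
        · rw [div_le_iff₀ (Real.sqrt_pos.2 h0)]
          nlinarith [Real.sq_sqrt ha, Real.sq_sqrt hb, sq_nonneg (√a - √b)]
      linarith
  refine summable_of_sum_le (c := 2 * √(tailSum c 0))
    (fun l => div_nonneg (hc l) (Real.sqrt_nonneg _)) fun s => ?_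
  obtain ⟨n, hn⟩ : ∃ n : ℕ, s ⊆ Finset.Ioo (-(n : ℤ)) n := by
    refine ⟨(s.sup Int.natAbs) + 1, fun l hl => ?_⟩
    have := Finset.le_sup (f := Int.natAbs) hl
    rw [Finset.mem_Ioo]
    omega
  refine (Finset.sum_le_sum_of_subset_of_nonneg hn fun l _ _ =>
    div_nonneg (hc l) (Real.sqrt_nonneg _)).trans ((hstep n).trans ?_)
  linarith [Real.sqrt_nonneg (tailSum c n)]

end Tail

/-! ### The weights and the space `ℳ` -/

section Weights

variable {E : Type*} [NormedAddCommGroup E] [InnerProductSpace ℂ E] [CompleteSpace E]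
variable {P : ℤ → E →L[ℂ] E} (hP : IsResolutionOfIdentity P)
include hP

theorem hsNorm_mul_proj_sq (W : E →L[ℂ] E) (l : ℤ) :
    hsNorm P (W * P l) ^ 2 = ∑' j, ‖P j * W * P l‖ ^ 2 := by
  rw [hsNorm, Real.sq_sqrt (tsum_nonneg fun _ => sq_nonneg _)]
  have hz : ∀ p : ℤ × ℤ, P p.1 * (W * P l) * P p.2 = if l = p.2 then P p.1 * W * P l else 0 :=
    fun p => by
      rw [mul_assoc, mul_assoc W, hP.mul_eq_ite]
      split_ifs <;> simp [mul_assoc]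
  rw [← Function.Injective.tsum_eq (g := fun j : ℤ => (j, l)) (fun a b h => by simpa using h)]
  · refine tsum_congr fun i => ?_
    rw [hz, if_pos rfl]
  · rintro ⟨a, b⟩ h
    refine ⟨a, ?_⟩
    by_contra hne
    apply h
    have : ¬ l = b := fun h' => hne (by rw [h'])
    change ‖P (a, b).1 * _ * P (a, b).2‖ ^ 2 = 0
    rw [hz, if_neg this, norm_zero, zero_pow two_ne_zero]

theorem hsNorm_proj_mul_sq (W : E →L[ℂ] E) (j : ℤ) :
    hsNorm P (P j * W) ^ 2 = ∑' l, ‖P j * W * P l‖ ^ 2 := by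
  rw [hsNorm, Real.sq_sqrt (tsum_nonneg fun _ => sq_nonneg _)]
  have hz : ∀ p : ℤ × ℤ, P p.1 * (P j * W) * P p.2 = if p.1 = j then P j * W * P p.2 else 0 :=
    fun p => by
      rw [← mul_assoc, hP.mul_eq_ite]
      split_ifs with h
      · rw [h]
      · simp
  rw [← Function.Injective.tsum_eq (g := fun l : ℤ => (j, l)) (fun a b h => by simpa using h)]
  · refine tsum_congr fun i => ?_
    rw [hz, if_pos rfl]
  · rintro ⟨a, b⟩ h
    refine ⟨b, ?_⟩
    by_contra hne
    apply h
    have : ¬ a = j := fun h' => hne (by rw [h'])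
    change ‖P (a, b).1 * _ * P (a, b).2‖ ^ 2 = 0
    rw [hz, if_neg this, norm_zero, zero_pow two_ne_zero]

theorem MemHS.summable_col {W : E →L[ℂ] E} (hW : MemHS P W) :
    Summable fun l => hsNorm P (W * P l) ^ 2 := by
  simp only [hsNorm_mul_proj_sq hP]
  exact hW.prod_symm.prod

theorem MemHS.summable_row {W : E →L[ℂ] E} (hW : MemHS P W) :
    Summable fun j => hsNorm P (P j * W) ^ 2 := by
  simp only [hsNorm_proj_mul_sq hP]
  exact hW.prod

theorem MemHS.tsum_col {W : E →L[ℂ] E} (hW : MemHS P W) :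
    ∑' l, hsNorm P (W * P l) ^ 2 = hsNorm P W ^ 2 := by
  rw [hsNorm, Real.sq_sqrt (tsum_nonneg fun _ => sq_nonneg _)]
  simp only [hsNorm_mul_proj_sq hP]
  rw [← (Equiv.prodComm ℤ ℤ).tsum_eq (fun p : ℤ × ℤ => ‖P p.1 * W * P p.2‖ ^ 2)]
  exact (Summable.tsum_prod (f := fun p : ℤ × ℤ => ‖P p.2 * W * P p.1‖ ^ 2) hW.prod_symm).symm

theorem MemHS.tsum_row {W : E →L[ℂ] E} (hW : MemHS P W) :
    ∑' j, hsNorm P (P j * W) ^ 2 = hsNorm P W ^ 2 := by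
  rw [hsNorm, Real.sq_sqrt (tsum_nonneg fun _ => sq_nonneg _)]
  simp only [hsNorm_proj_mul_sq hP]
  exact (Summable.tsum_prod hW).symm

theorem MemHS.block_sq_le_col {W : E →L[ℂ] E} (hW : MemHS P W) (j l : ℤ) :
    ‖P j * W * P l‖ ^ 2 ≤ hsNorm P (W * P l) ^ 2 := by
  rw [hsNorm_mul_proj_sq hP]
  exact (hW.prod_symm.prod_factor l).le_tsum j fun _ _ => sq_nonneg _

theorem MemHS.block_sq_le_row {W : E →L[ℂ] E} (hW : MemHS P W) (j l : ℤ) :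
    ‖P j * W * P l‖ ^ 2 ≤ hsNorm P (P j * W) ^ 2 := by
  rw [hsNorm_proj_mul_sq hP]
  exact (hW.prod_factor j).le_tsum l fun _ _ => sq_nonneg _

omit hP [CompleteSpace E] in
theorem alpha_eq (W : E →L[ℂ] E) (n : ℤ) :
    alpha P W n = hsNorm P W ^ (-(1 / 2) : ℝ) *
      max (tailSum (fun l => hsNorm P (P l * W) ^ 2) n ^ (1 / 4 : ℝ))
        (tailSum (fun l => hsNorm P (W * P l) ^ 2) n ^ (1 / 4 : ℝ)) := rfl

omit hP [CompleteSpace E] in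
theorem alpha_nonneg (W : E →L[ℂ] E) (n : ℤ) : 0 ≤ alpha P W n := by
  rw [alpha_eq]
  have := tailSum_nonneg (c := fun l => hsNorm P (P l * W) ^ 2) (fun _ => sq_nonneg _) n
  have hN : 0 ≤ hsNorm P W := Real.sqrt_nonneg _
  positivity

theorem alpha_anti {W : E →L[ℂ] E} (hW : MemHS P W) {i j : ℤ} (h : |i| ≤ |j|) :
    alpha P W j ≤ alpha P W i := by
  rw [alpha_eq, alpha_eq]
  refine mul_le_mul_of_nonneg_left (max_le_max ?_ ?_)
    (Real.rpow_nonneg (Real.sqrt_nonneg _) _)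
  · exact Real.rpow_le_rpow (tailSum_nonneg (fun _ => sq_nonneg _) _)
      (tailSum_anti (fun _ => sq_nonneg _) (hW.summable_row hP) h) (by norm_num)
  · exact Real.rpow_le_rpow (tailSum_nonneg (fun _ => sq_nonneg _) _)
      (tailSum_anti (fun _ => sq_nonneg _) (hW.summable_col hP) h) (by norm_num)

/-- At `n = 0` both tails equal `‖W‖₂²`, so `α_0 = 1`, or `0` by the convention for `0 ^ (-1/2)` if
`‖W‖₂ = 0`; the other values are smaller. -/
theorem alpha_le_one {W : E →L[ℂ] E} (hW : MemHS P W) (n : ℤ) : alpha P W n ≤ 1 := by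
  refine (alpha_anti hP hW (i := 0) (by simp)).trans ?_
  rw [alpha_eq, tailSum_zero (fun _ => sq_nonneg _) (hW.summable_row hP),
    tailSum_zero (fun _ => sq_nonneg _) (hW.summable_col hP), hW.tsum_col hP, hW.tsum_row hP,
    max_self]
  have hN : 0 ≤ hsNorm P W := Real.sqrt_nonneg _
  rcases hN.eq_or_lt with h0 | h0
  · rw [← h0]
    norm_num
  · rw [← Real.rpow_natCast, ← Real.rpow_mul hN, ← Real.rpow_add h0]
    norm_num

/-- The exponent `1/4` and the normalization of `α` are made for this: `‖W‖₂ α_n²` dominates the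
denominator in the comparison `∑ c_l / √t_l < ∞`. -/
theorem sqrt_tailSum_col_le {W : E →L[ℂ] E} (hN : 0 < hsNorm P W) (n : ℤ) :
    √(tailSum (fun l => hsNorm P (W * P l) ^ 2) n) ≤ hsNorm P W * alpha P W n ^ 2 := by
  set t := tailSum (fun l => hsNorm P (W * P l) ^ 2) n with ht
  have ht0 : 0 ≤ t := tailSum_nonneg (fun _ => sq_nonneg _) n
  have h1 : hsNorm P W ^ (-(1 / 2) : ℝ) * t ^ (1 / 4 : ℝ) ≤ alpha P W n := by
    rw [alpha_eq]
    exact mul_le_mul_of_nonneg_left (le_max_right _ _) (Real.rpow_nonneg hN.le _)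
  have h2 := pow_le_pow_left₀ (by positivity) h1 2
  refine le_trans (le_of_eq ?_) (mul_le_mul_of_nonneg_left h2 hN.le)
  rw [mul_pow, ← Real.rpow_natCast, ← Real.rpow_mul hN.le, ← Real.rpow_natCast,
    ← Real.rpow_mul ht0, Real.sqrt_eq_rpow]
  norm_num [Real.rpow_neg_one]
  field_simp

theorem sqrt_tailSum_row_le {W : E →L[ℂ] E} (hN : 0 < hsNorm P W) (n : ℤ) :
    √(tailSum (fun l => hsNorm P (P l * W) ^ 2) n) ≤ hsNorm P W * alpha P W n ^ 2 := by
  set t := tailSum (fun l => hsNorm P (P l * W) ^ 2) n with ht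
  have ht0 : 0 ≤ t := tailSum_nonneg (fun _ => sq_nonneg _) n
  have h1 : hsNorm P W ^ (-(1 / 2) : ℝ) * t ^ (1 / 4 : ℝ) ≤ alpha P W n := by
    rw [alpha_eq]
    exact mul_le_mul_of_nonneg_left (le_max_left _ _) (Real.rpow_nonneg hN.le _)
  have h2 := pow_le_pow_left₀ (by positivity) h1 2
  refine le_trans (le_of_eq ?_) (mul_le_mul_of_nonneg_left h2 hN.le)
  rw [mul_pow, ← Real.rpow_natCast, ← Real.rpow_mul hN.le, ← Real.rpow_natCast,
    ← Real.rpow_mul ht0, Real.sqrt_eq_rpow]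
  norm_num [Real.rpow_neg_one]
  field_simp

theorem proj_mul_sum (s : Finset ℤ) (j : ℤ) :
    P j * ∑ l ∈ s, P l = if j ∈ s then P j else 0 := by
  rw [Finset.mul_sum]
  simp [hP.mul_eq_ite]

theorem sum_mul_proj (s : Finset ℤ) (j : ℤ) :
    (∑ l ∈ s, P l) * P j = if j ∈ s then P j else 0 := by
  rw [Finset.sum_mul]
  have : ∀ l ∈ s, P l * P j = if l = j then P j else 0 := fun l _ => by
    rw [hP.mul_eq_ite]
    split_ifs with h
    · rw [h]
    · rfl
  rw [Finset.sum_congr rfl this]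
  simp

theorem block_truncation (W : E →L[ℂ] E) (s : Finset ℤ) (j l : ℤ) :
    P j * ((∑ i ∈ s, P i) * W * ∑ i ∈ s, P i) * P l
      = if j ∈ s ∧ l ∈ s then P j * W * P l else 0 := by
  have : P j * ((∑ i ∈ s, P i) * W * ∑ i ∈ s, P i) * P l
      = (P j * ∑ i ∈ s, P i) * W * ((∑ i ∈ s, P i) * P l) := by simp only [mul_assoc]
  rw [this, proj_mul_sum hP, sum_mul_proj hP]
  by_cases h1 : j ∈ s <;> by_cases h2 : l ∈ s <;> simp [h1, h2]

theorem hsNorm_pos {W : E →L[ℂ] E} (hW : MemHS P W) (h0 : W ≠ 0) : 0 < hsNorm P W := by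
  have := hW.norm_le hP
  exact (norm_pos_iff.2 h0).trans_le this

/-- If `α_n = 0`, both tails from `|n|` on vanish. Every block with an index of modulus at least
`|n|` is then zero, and `W` equals its truncation to `|j|, |l| ≤ |n|`. -/
theorem alpha_pos {W : E →L[ℂ] E} (hW : MemHS P W)
    (hne : ∀ n : ℕ, (∑ l ∈ Finset.Icc (-(n : ℤ)) n, P l) * W *
      (∑ l ∈ Finset.Icc (-(n : ℤ)) n, P l) ≠ W) (n : ℤ) : 0 < alpha P W n := by
  have hW0 : W ≠ 0 := fun h => hne 0 (by simp [h])
  have hN := hsNorm_pos hP hW hW0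
  refine (alpha_nonneg W n).lt_of_ne fun h0 => hne n.natAbs (hP.ext_blocks fun j l => ?_)
  have hcol := sqrt_tailSum_col_le hP hN n
  have hrow := sqrt_tailSum_row_le hP hN n
  rw [← h0] at hcol hrow
  have hcol0 := Real.sqrt_eq_zero'.1
    (le_antisymm (hcol.trans (by simp)) (Real.sqrt_nonneg _))
  have hrow0 := Real.sqrt_eq_zero'.1
    (le_antisymm (hrow.trans (by simp)) (Real.sqrt_nonneg _))
  rw [block_truncation hP]
  split_ifs with h
  · rfl
  · have hsq : ‖P j * W * P l‖ ^ 2 ≤ 0 := by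
      simp only [Finset.mem_Icc, Int.natCast_natAbs, ← abs_le] at h
      by_cases hj : |n| ≤ |j|
      · exact (hW.block_sq_le_row hP j l).trans
          ((le_tailSum (fun _ => sq_nonneg _) (hW.summable_row hP) hj).trans hrow0)
      · exact (hW.block_sq_le_col hP j l).trans
          ((le_tailSum (fun _ => sq_nonneg _) (hW.summable_col hP) (by omega)).trans hcol0)
    have := pow_eq_zero_iff (two_ne_zero) |>.1 (le_antisymm hsq (sq_nonneg _))
    exact (norm_eq_zero.1 this).symm

/-- With `c_l = ‖W P_l‖₂²`, the bound `√t_l ≤ ‖W‖₂ α_l²` reduces the claim to the convergence of `∑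
c_l / √t_l`. This and its row analogue put `W` into its own space `ℳ`. -/
theorem wMem_self_col {W : E →L[ℂ] E} (hW : MemHS P W) (hN : 0 < hsNorm P W) :
    WMem P (fun _ l => (alpha P W l)⁻¹) W := by
  set c : ℤ → ℝ := fun l => hsNorm P (W * P l) ^ 2 with hc
  have hsum := summable_div_sqrt_tailSum (c := c) (fun _ => sq_nonneg _) (hW.summable_col hP)
  have hle : ∀ p : ℤ × ℤ, ((alpha P W p.1)⁻¹ * ‖P p.2 * W * P p.1‖) ^ 2
      ≤ hsNorm P W * (‖P p.2 * W * P p.1‖ ^ 2 / √(tailSum c p.1)) := by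
    rintro ⟨l, j⟩
    have h1 := sqrt_tailSum_col_le hP hN l
    have h2 := (hW.block_sq_le_col hP j l).trans
      (le_tailSum (fun _ => sq_nonneg _) (hW.summable_col hP) (le_refl |l|))
    -- If the tail at `l` vanishes, so does the whole column `l`, and the value of `α_l⁻¹` is
    -- irrelevant.
    rcases (tailSum_nonneg (c := c) (fun _ => sq_nonneg _) l).eq_or_lt with h0 | h0
    · have h3 : ‖P j * W * P l‖ = 0 :=
        pow_eq_zero_iff (two_ne_zero) |>.1 (le_antisymm (h2.trans h0.ge) (sq_nonneg _))
      simp [h3]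
    · have h4 := Real.sqrt_pos.2 h0
      have h5 : 0 < alpha P W l ^ 2 := by
        have : 0 < hsNorm P W * alpha P W l ^ 2 := h4.trans_le h1
        exact (pos_iff_pos_of_mul_pos this).1 hN
      rw [mul_pow, inv_pow, ← mul_div_assoc, inv_mul_eq_div, div_le_div_iff₀ h5 h4]
      calc _ ≤ ‖P j * W * P l‖ ^ 2 * (hsNorm P W * alpha P W l ^ 2) :=
            mul_le_mul_of_nonneg_left h1 (sq_nonneg _)
        _ = _ := by ring
  have hs : Summable fun p : ℤ × ℤ => ‖P p.2 * W * P p.1‖ ^ 2 / √(tailSum c p.1) := by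
    have h1 : ∀ l, Summable fun j => ‖P j * W * P l‖ ^ 2 := fun l => hW.prod_symm.prod_factor l
    rw [summable_prod_of_nonneg fun _ => div_nonneg (sq_nonneg _) (Real.sqrt_nonneg _)]
    refine ⟨fun l => (h1 l).div_const (√(tailSum c l)), ?_⟩
    simp only [tsum_div_const, ← hsNorm_mul_proj_sq hP]
    exact hsum
  exact (Summable.of_nonneg_of_le (fun _ => sq_nonneg _) hle (hs.mul_left _)).prod_symm

theorem wMem_self_row {W : E →L[ℂ] E} (hW : MemHS P W) (hN : 0 < hsNorm P W) :
    WMem P (fun j _ => (alpha P W j)⁻¹) W := by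
  set c : ℤ → ℝ := fun l => hsNorm P (P l * W) ^ 2 with hc
  have hsum := summable_div_sqrt_tailSum (c := c) (fun _ => sq_nonneg _) (hW.summable_row hP)
  have hle : ∀ p : ℤ × ℤ, ((alpha P W p.1)⁻¹ * ‖P p.1 * W * P p.2‖) ^ 2
      ≤ hsNorm P W * (‖P p.1 * W * P p.2‖ ^ 2 / √(tailSum c p.1)) := by
    rintro ⟨j, l⟩
    have h1 := sqrt_tailSum_row_le hP hN j
    have h2 := (hW.block_sq_le_row hP j l).trans
      (le_tailSum (fun _ => sq_nonneg _) (hW.summable_row hP) (le_refl |j|))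
    rcases (tailSum_nonneg (c := c) (fun _ => sq_nonneg _) j).eq_or_lt with h0 | h0
    · have h3 : ‖P j * W * P l‖ = 0 :=
        pow_eq_zero_iff (two_ne_zero) |>.1 (le_antisymm (h2.trans h0.ge) (sq_nonneg _))
      simp [h3]
    · have h4 := Real.sqrt_pos.2 h0
      have h5 : 0 < alpha P W j ^ 2 := by
        have : 0 < hsNorm P W * alpha P W j ^ 2 := h4.trans_le h1
        exact (pos_iff_pos_of_mul_pos this).1 hN
      rw [mul_pow, inv_pow, ← mul_div_assoc, inv_mul_eq_div, div_le_div_iff₀ h5 h4]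
      calc _ ≤ ‖P j * W * P l‖ ^ 2 * (hsNorm P W * alpha P W j ^ 2) :=
            mul_le_mul_of_nonneg_left h1 (sq_nonneg _)
        _ = _ := by ring
  have hs : Summable fun p : ℤ × ℤ => ‖P p.1 * W * P p.2‖ ^ 2 / √(tailSum c p.1) := by
    have h1 : ∀ j, Summable fun l => ‖P j * W * P l‖ ^ 2 := fun j => hW.prod_factor j
    rw [summable_prod_of_nonneg fun _ => div_nonneg (sq_nonneg _) (Real.sqrt_nonneg _)]
    refine ⟨fun j => (h1 j).div_const (√(tailSum c j)), ?_⟩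
    simp only [tsum_div_const, ← hsNorm_proj_mul_sq hP]
    exact hsum
  exact Summable.of_nonneg_of_le (fun _ => sq_nonneg _) hle (hs.mul_left _)

/-! ### The space `ℳ` as an intersection of weighted Hilbert–Schmidt classes. -/

section Admissible

variable {W : E →L[ℂ] E} (hα0 : ∀ n, 0 < alpha P W n) (hα1 : ∀ n, alpha P W n ≤ 1)
include hα0 hα1

theorem exists_weightOp : ∃ F : E →L[ℂ] E, (∀ x, weightOp P W x = F x) ∧
    (∀ n, P n * F = (alpha P W n : ℂ) • P n) ∧ (∀ n, F * P n = (alpha P W n : ℂ) • P n) := by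
  obtain ⟨F, h1, h2, h3, -⟩ := hP.exists_diagonal (c := fun n => (alpha P W n : ℂ)) (C := 1)
    fun n => by
      rw [Complex.norm_real, Real.norm_of_nonneg (hα0 n).le]
      exact hα1 n
  exact ⟨F, fun x => (h1 x).symm, h2, h3⟩

theorem IsFactorization.blocks {X Xl Xr : E →L[ℂ] E} (h : IsFactorization P W X Xl Xr)
    (j l : ℤ) : P j * X * P l = (alpha P W l : ℂ) • (P j * Xl * P l) ∧
      P j * X * P l = (alpha P W j : ℂ) • (P j * Xr * P l) := by
  obtain ⟨F, h1, h2, h3⟩ := exists_weightOp hP hα0 hα1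
  have e1 : X = Xl * F := ContinuousLinearMap.ext fun x => by rw [h.left_eq, h1]; rfl
  have e2 : X = F * Xr := ContinuousLinearMap.ext fun x => by rw [h.right_eq, h1]; rfl
  constructor
  · rw [e1, mul_assoc, mul_assoc Xl, h3, mul_smul_comm, mul_smul_comm, mul_assoc]
  · rw [e2, ← mul_assoc (P j), h2, smul_mul_assoc, smul_mul_assoc]

/-- `F` on the right scales column `l` by `α_l`, and on the left row `j` by `α_j`. The
Hilbert–Schmidt norms of the factors are therefore weighted norms of `X`, the same for every
factorization, and the infimum in `normM` is over one number. -/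
theorem IsFactorization.norms {X Xl Xr : E →L[ℂ] E} (h : IsFactorization P W X Xl Xr) :
    (WMem P (fun _ l => (alpha P W l)⁻¹) X ∧ WMem P (fun j _ => (alpha P W j)⁻¹) X) ∧
      wNorm P (fun _ l => (alpha P W l)⁻¹) X = hsNorm P Xl ∧
      wNorm P (fun j _ => (alpha P W j)⁻¹) X = hsNorm P Xr := by
  have e1 : ∀ p : ℤ × ℤ, (alpha P W p.2)⁻¹ * ‖P p.1 * X * P p.2‖ = ‖P p.1 * Xl * P p.2‖ :=
    fun p => by
      rw [(h.blocks hP hα0 hα1 p.1 p.2).1, norm_smul, Complex.norm_real,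
        Real.norm_of_nonneg (hα0 _).le, inv_mul_cancel_left₀ (hα0 _).ne']
  have e2 : ∀ p : ℤ × ℤ, (alpha P W p.1)⁻¹ * ‖P p.1 * X * P p.2‖ = ‖P p.1 * Xr * P p.2‖ :=
    fun p => by
      rw [(h.blocks hP hα0 hα1 p.1 p.2).2, norm_smul, Complex.norm_real,
        Real.norm_of_nonneg (hα0 _).le, inv_mul_cancel_left₀ (hα0 _).ne']
  refine ⟨⟨?_, ?_⟩, ?_, ?_⟩
  · simp only [WMem, e1]; exact h.left_mem
  · simp only [WMem, e2]; exact h.right_mem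
  · simp only [wNorm, e1]; rfl
  · simp only [wNorm, e2]; rfl

/-- The factors are built directly from the blocks of `X` divided by `α_l` or `α_j`, which are
square summable by assumption; no bounded inverse of `F` is required. -/
theorem exists_isFactorization {X : E →L[ℂ] E}
    (h1 : WMem P (fun _ l => (alpha P W l)⁻¹) X) (h2 : WMem P (fun j _ => (alpha P W j)⁻¹) X) :
    ∃ Xl Xr, IsFactorization P W X Xl Xr := by
  have hn : ∀ n, ‖((alpha P W n : ℂ))⁻¹‖ = (alpha P W n)⁻¹ := fun n => by
    rw [norm_inv, Complex.norm_real, Real.norm_of_nonneg (hα0 n).le]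
  have hne : ∀ n, (alpha P W n : ℂ) ≠ 0 := fun n => by exact_mod_cast (hα0 n).ne'
  obtain ⟨Xl, hl⟩ := exists_schur hP (X := X) (c := fun _ l => ((alpha P W l : ℂ))⁻¹)
    (by simpa only [hn] using h1)
  obtain ⟨Xr, hr⟩ := exists_schur hP (X := X) (c := fun j _ => ((alpha P W j : ℂ))⁻¹)
    (by simpa only [hn] using h2)
  obtain ⟨F, f1, f2, f3⟩ := exists_weightOp hP hα0 hα1
  have e1 : X = Xl * F := hP.ext_blocks fun j l => by
    rw [mul_assoc (P j) (Xl * F), mul_assoc Xl, f3, mul_smul_comm, mul_smul_comm,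
      ← mul_assoc (P j) Xl, hl,
      smul_smul, mul_inv_cancel₀ (hne l), one_smul]
  have e2 : X = F * Xr := hP.ext_blocks fun j l => by
    rw [← mul_assoc (P j), f2, smul_mul_assoc, smul_mul_assoc, hr, smul_smul,
      mul_inv_cancel₀ (hne j), one_smul]
  refine ⟨Xl, Xr, ?_, ?_, fun x => ?_, fun x => ?_⟩
  · simp only [MemHS, hl, norm_smul, hn]; exact h1
  · simp only [MemHS, hr, norm_smul, hn]; exact h2
  · rw [f1]
    exact congrArg (fun T : E →L[ℂ] E => T x) e1
  · rw [f1]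
    exact congrArg (fun T : E →L[ℂ] E => T x) e2

theorem WMem.memHS_of_col {X : E →L[ℂ] E} (h1 : WMem P (fun _ l => (alpha P W l)⁻¹) X) :
    MemHS P X ∧ hsNorm P X ≤ wNorm P (fun _ l => (alpha P W l)⁻¹) X := by
  have := h1.of_le (w' := fun _ _ => 1) (Y := X) zero_le_one (fun _ _ => zero_le_one) fun j l => by
    rw [one_mul]
    rw [one_mul]
    exact le_mul_of_one_le_left (norm_nonneg _) ((one_le_inv₀ (hα0 l)).2 (hα1 l))
  simpa only [wMem_one, wNorm_one, one_mul] using this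

theorem memM_iff {X : E →L[ℂ] E} : MemM P W X ↔
    WMem P (fun _ l => (alpha P W l)⁻¹) X ∧ WMem P (fun j _ => (alpha P W j)⁻¹) X := by
  constructor
  · rintro ⟨-, Xl, Xr, h⟩
    exact (h.norms hP hα0 hα1).1
  · rintro ⟨h1, h2⟩
    exact ⟨(h1.memHS_of_col hP hα0 hα1).1, exists_isFactorization hP hα0 hα1 h1 h2⟩

theorem normM_eq {X : E →L[ℂ] E} (hX : MemM P W X) :
    normM P W X = max (wNorm P (fun _ l => (alpha P W l)⁻¹) X)
      (wNorm P (fun j _ => (alpha P W j)⁻¹) X) := by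
  obtain ⟨-, Xl, Xr, h⟩ := hX
  have : {r | ∃ Xl Xr, IsFactorization P W X Xl Xr ∧ r = max (hsNorm P Xl) (hsNorm P Xr)}
      = {max (wNorm P (fun _ l => (alpha P W l)⁻¹) X)
          (wNorm P (fun j _ => (alpha P W j)⁻¹) X)} := by
    ext r
    constructor
    · rintro ⟨Yl, Yr, h', rfl⟩
      rw [(h'.norms hP hα0 hα1).2.1, (h'.norms hP hα0 hα1).2.2]
      rfl
    · rintro rfl
      exact ⟨Xl, Xr, h, by rw [(h.norms hP hα0 hα1).2.1, (h.norms hP hα0 hα1).2.2]⟩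
  rw [normM, this, csInf_singleton]

end Admissible

end Weights

/-! ### Inverses of operators `1 + G` with `G` in the Hilbert--Schmidt class -/

section Inverse

variable {E : Type*} [NormedAddCommGroup E] [InnerProductSpace ℂ E] [CompleteSpace E]
variable {P : ℤ → E →L[ℂ] E}

theorem hsNorm_nonneg (X : E →L[ℂ] E) : 0 ≤ hsNorm P X := Real.sqrt_nonneg _

theorem MemHS.add {X Y : E →L[ℂ] E} (hX : MemHS P X) (hY : MemHS P Y) :
    MemHS P (X + Y) ∧ hsNorm P (X + Y) ≤ hsNorm P X + hsNorm P Y := by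
  simpa only [wMem_one, wNorm_one] using
    WMem.add (fun _ _ => zero_le_one) (wMem_one.2 hX) (wMem_one.2 hY)

theorem MemHS.neg {X : E →L[ℂ] E} (hX : MemHS P X) :
    MemHS P (-X) ∧ hsNorm P (-X) = hsNorm P X := by
  simpa only [wMem_one, wNorm_one] using (wMem_one.2 hX).neg

theorem MemHS.sub {X Y : E →L[ℂ] E} (hX : MemHS P X) (hY : MemHS P Y) :
    MemHS P (X - Y) ∧ hsNorm P (X - Y) ≤ hsNorm P X + hsNorm P Y := by
  simpa only [wMem_one, wNorm_one] using
    WMem.sub (fun _ _ => zero_le_one) (wMem_one.2 hX) (wMem_one.2 hY)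

theorem memHS_zero : MemHS P 0 ∧ hsNorm P 0 = 0 := by
  simpa only [wMem_one, wNorm_one] using wMem_zero (P := P) fun _ _ => 1

variable (hP : IsResolutionOfIdentity P)
include hP

theorem memHS_truncation (W : E →L[ℂ] E) (s : Finset ℤ) :
    MemHS P ((∑ i ∈ s, P i) * W * ∑ i ∈ s, P i) := by
  refine summable_of_ne_finset_zero (s := s ×ˢ s) fun p hp => ?_
  rw [Finset.mem_product] at hp
  rw [block_truncation hP, if_neg hp, norm_zero, zero_pow two_ne_zero]

theorem MemHS.exists_truncation {G : E →L[ℂ] E} (hG : MemHS P G) :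
    ∃ s : Finset ℤ, hsNorm P (G - (∑ i ∈ s, P i) * G * ∑ i ∈ s, P i) < 1 := by
  obtain ⟨T, hT⟩ := ((tendsto_tsum_compl_atTop_zero
    fun p : ℤ × ℤ => ‖P p.1 * G * P p.2‖ ^ 2).eventually (gt_mem_nhds zero_lt_one)).exists
  -- `T` carries all but less than `1` of the square sum; collecting its row and column indices
  -- gives a square `s × s` containing it.
  refine ⟨T.image Prod.fst ∪ T.image Prod.snd, ?_⟩
  set s := T.image Prod.fst ∪ T.image Prod.snd
  have hle : ∀ p : ℤ × ℤ, ‖P p.1 * (G - (∑ i ∈ s, P i) * G * ∑ i ∈ s, P i) * P p.2‖ ^ 2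
      ≤ {p | p ∉ T}.indicator (fun p : ℤ × ℤ => ‖P p.1 * G * P p.2‖ ^ 2) p := by
    intro p
    rw [mul_sub, sub_mul, block_truncation hP]
    by_cases hp : p ∈ T
    · have h1 : p.1 ∈ s := Finset.mem_union_left _ (Finset.mem_image_of_mem _ hp)
      have h2 : p.2 ∈ s := Finset.mem_union_right _ (Finset.mem_image_of_mem _ hp)
      simp [h1, h2, hp]
    · rw [Set.indicator_of_mem (by exact hp)]
      split_ifs
      · simp
      · simp
  have hs := (hG.sub (memHS_truncation hP G s)).1
  rw [hsNorm, Real.sqrt_lt' zero_lt_one, one_pow]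
  refine (hs.tsum_le_tsum hle (hG.indicator _)).trans_lt ?_
  rw [← tsum_subtype]
  exact hT

/-- The Neumann series converges in the Hilbert--Schmidt class. -/
theorem MemHS.exists_neumann {R : E →L[ℂ] E} (hR : MemHS P R) (h1 : hsNorm P R < 1) :
    ∃ S : E →L[ℂ] E, MemHS P S ∧ (1 + S) * (1 + R) = 1 ∧ (1 + R) * (1 + S) = 1 := by
  have hr : ‖-R‖ < 1 := by
    rw [norm_neg]
    exact (hR.norm_le hP).trans_lt h1
  set r := hsNorm P R with hrdef
  have hr0 : 0 ≤ r := hsNorm_nonneg _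
  have hs := summable_geometric_of_norm_lt_one hr
  have hs1 : Summable fun n : ℕ => (-R) ^ (n + 1) := (summable_nat_add_iff 1).2 hs
  have hpow : ∀ n : ℕ, MemHS P ((-R) ^ (n + 1)) ∧ hsNorm P ((-R) ^ (n + 1)) ≤ r ^ (n + 1) := by
    intro n
    induction n with
    | zero => simpa using ⟨hR.neg.1, hR.neg.2.le⟩
    | succ n ih =>
      rw [pow_succ (-R), pow_succ r]
      have h := ih.1.mul hP hR.neg.1
      refine ⟨h.1, h.2.trans ?_⟩
      rw [hR.neg.2]
      exact mul_le_mul_of_nonneg_right ih.2 hr0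
  have hpart : ∀ N : ℕ, MemHS P (∑ n ∈ Finset.range N, (-R) ^ (n + 1)) ∧
      hsNorm P (∑ n ∈ Finset.range N, (-R) ^ (n + 1)) ≤ ∑ n ∈ Finset.range N, r ^ (n + 1) := by
    intro N
    induction N with
    | zero => simpa using ⟨memHS_zero.1, memHS_zero.2.le⟩
    | succ N ih =>
      rw [Finset.sum_range_succ, Finset.sum_range_succ]
      have h := ih.1.add (hpow N).1
      exact ⟨h.1, h.2.trans (add_le_add ih.2 (hpow N).2)⟩
  have hgeo : Summable fun n : ℕ => r ^ (n + 1) :=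
    (summable_nat_add_iff 1).2 (summable_geometric_of_lt_one hr0 h1)
  -- The series converges only in operator norm so far; uniformly bounded Hilbert–Schmidt norms of
  -- the partial sums pass to the limit by lower semicontinuity.
  have hmem := (wMem_of_tendsto (P := P) (w := fun _ _ => 1) (C := ∑' n : ℕ, r ^ (n + 1))
    (tsum_nonneg fun _ => by positivity) hs1.hasSum.tendsto_sum_nat
    (Eventually.of_forall fun N => by
      rw [wMem_one, wNorm_one]
      exact ⟨(hpart N).1, (hpart N).2.trans (hgeo.sum_le_tsum _ fun _ _ => by positivity)⟩)).1
  have hS : 1 + ∑' n : ℕ, (-R) ^ (n + 1) = ∑' n : ℕ, (-R) ^ n := by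
    rw [hs.tsum_eq_zero_add, pow_zero]
  refine ⟨∑' n : ℕ, (-R) ^ (n + 1), wMem_one.1 hmem, ?_, ?_⟩
  · rw [hS]
    simpa using geom_series_mul_neg (-R) hr
  · rw [hS]
    simpa using mul_neg_geom_series (-R) hr

/-- The algebra `ℂ 1 + 𝔖₂` is inverse closed. -/
theorem MemHS.inverse_sub_one {G : E →L[ℂ] E} (hG : MemHS P G) (hu : IsUnit (1 + G)) :
    MemHS P (Ring.inverse (1 + G) - 1) := by
  obtain ⟨s, hs⟩ := hG.exists_truncation hP
  set Q := ∑ i ∈ s, P i with hQ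
  have hQQ : Q * Q = Q := by
    rw [hQ, Finset.mul_sum]
    exact Finset.sum_congr rfl fun i hi => by rw [sum_mul_proj hP, if_pos hi]
  have hT := memHS_truncation hP G s
  -- Write `G = R + Q G Q` with `‖R‖₂ < 1` and `(1 + R)⁻¹ = 1 + S`. Then `1 + G = (1 + R)(1 + K)`
  -- with `K = (1 + S) Q G Q`, and `K = K Q`.
  obtain ⟨S, hS, hS1, hS2⟩ := (hG.sub hT).1.exists_neumann hP hs
  rw [← hQ] at hT hS1 hS2
  set R := G - Q * G * Q with hR
  set K := (1 + S) * (Q * G * Q) with hK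
  have hKm : MemHS P K := by
    rw [hK, add_mul, one_mul]
    exact (hT.add (hS.mul hP hT).1).1
  have hKQ : K * Q = K := by
    rw [hK]
    simp only [mul_assoc, hQQ]
  have hfac : 1 + G = (1 + R) * (1 + K) := by
    rw [mul_add, hK, ← mul_assoc, hS2, one_mul, mul_one, hR]
    abel
  set A := Ring.inverse (1 + G) with hA
  have hA1 : A * (1 + G) = 1 := Ring.inverse_mul_cancel _ hu
  have hA2 : (1 + G) * A = 1 := Ring.mul_inverse_cancel _ hu
  set B := A * (1 + R) with hB
  have hB1 : B * (1 + K) = 1 := by rw [hB, mul_assoc, ← hfac, hA1]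
  have hB2 : (1 + K) * B = 1 := by
    have h1 : 1 + K = (1 + S) * (1 + G) := by rw [hfac, ← mul_assoc, hS1, one_mul]
    rw [h1, hB, mul_assoc, ← mul_assoc (1 + G), hA2, one_mul, hS1]
  have hAB : A = B * (1 + S) := by rw [hB, mul_assoc, hS2, mul_one]
  -- Since `K (1 - Q) = 0`, both `1 + K` and its inverse `B` fix `1 - Q`. Hence `B = 1 - K B = 1 - K
  -- (Q B Q)`, and `Q B Q` is in the Hilbert–Schmidt class although `B` itself is only bounded.
  have hQB : Q * B = Q * B * Q := by
    have h1 : B * (1 - Q) = 1 - Q := by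
      have : (1 + K) * (1 - Q) = 1 - Q := by
        rw [add_mul, mul_sub K, hKQ]
        simp
      calc B * (1 - Q) = B * ((1 + K) * (1 - Q)) := by rw [this]
        _ = 1 - Q := by rw [← mul_assoc, hB1, one_mul]
    have h2 : Q * B * (1 - Q) = 0 := by rw [mul_assoc, h1, mul_sub, hQQ, mul_one, sub_self]
    rw [mul_sub, mul_one] at h2
    exact sub_eq_zero.1 h2
  have hBM : B = 1 - K * (Q * B * Q) := by
    rw [← hQB, ← mul_assoc, hKQ]
    rw [add_mul, one_mul] at hB2
    exact eq_sub_of_add_eq hB2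
  have hM : MemHS P (K * (Q * B * Q)) := (hKm.mul hP (memHS_truncation hP B s)).1
  have : A - 1 = S - (K * (Q * B * Q) + K * (Q * B * Q) * S) := by
    rw [hAB]
    conv_lhs => rw [hBM]
    rw [sub_mul, one_mul, mul_add, mul_one]
    abel
  rw [this]
  exact (hS.sub (hM.add (hM.mul hP hS).1).1).1

end Inverse

/-! ### A fixed point principle -/

/-- The contraction principle for a lower semicontinuous norm on a subgroup of a Banach space. -/
theorem exists_unique_fixedPoint {V : Type*} [NormedAddCommGroup V] [CompleteSpace V]
    (S : AddSubgroup V) {N : V → ℝ} (hN0 : ∀ x, 0 ≤ N x) (hz : N 0 = 0)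
    (hle : ∀ x ∈ S, ‖x‖ ≤ N x) (hadd : ∀ x ∈ S, ∀ y ∈ S, N (x + y) ≤ N x + N y)
    (hlsc : ∀ (u : ℕ → V) (x : V) (C : ℝ), 0 ≤ C → Tendsto u atTop (𝓝 x) →
      (∀ᶠ n in atTop, u n ∈ S ∧ N (u n) ≤ C) → x ∈ S ∧ N x ≤ C)
    {Φ : V → V} {b : V} (hb : b ∈ S) {r q : ℝ} (hr : 0 ≤ r) (hq0 : 0 ≤ q) (hq1 : q < 1)
    (hmaps : ∀ x ∈ S, N (x - b) ≤ r → Φ x ∈ S ∧ N (Φ x - b) ≤ r)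
    (hcontr : ∀ x ∈ S, ∀ y ∈ S, N (x - b) ≤ r → N (y - b) ≤ r →
      N (Φ x - Φ y) ≤ q * N (x - y)) :
    ∃ x ∈ S, N (x - b) ≤ r ∧ Φ x = x ∧ ∀ y ∈ S, N (y - b) ≤ r → Φ y = y → y = x := by
  set u : ℕ → V := fun n => Φ^[n] b with hu
  have hsucc : ∀ n, u (n + 1) = Φ (u n) := fun n => Function.iterate_succ_apply' Φ n b
  have hball : ∀ n, u n ∈ S ∧ N (u n - b) ≤ r := by
    intro n
    induction n with
    | zero => exact ⟨hb, by simpa [hu, hz] using hr⟩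
    | succ n ih =>
      rw [hsucc]
      exact hmaps _ ih.1 ih.2
  set D := N (u 1 - u 0)
  have hD : 0 ≤ D := hN0 _
  have hstep : ∀ n, N (u (n + 1) - u n) ≤ D * q ^ n := by
    intro n
    induction n with
    | zero => simp [D]
    | succ n ih =>
      rw [hsucc (n + 1), hsucc n]
      refine (hcontr _ (hsucc n ▸ (hball (n + 1)).1) _ (hball n).1
        (hsucc n ▸ (hball (n + 1)).2) (hball n).2).trans ?_
      rw [← hsucc n, pow_succ]
      nlinarith [mul_le_mul_of_nonneg_left ih hq0]
  have h1q : 0 < 1 - q := sub_pos.2 hq1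
  -- The factor `1 - q ^ i` is the exact partial geometric sum, which closes the induction; it is
  -- dropped afterwards.
  have hdist : ∀ n i, N (u (n + i) - u n) ≤ D * q ^ n * (1 - q ^ i) / (1 - q) := by
    intro n i
    induction i with
    | zero => simp [hz]
    | succ i ih =>
      have h1 : u (n + (i + 1)) - u n = (u (n + i + 1) - u (n + i)) + (u (n + i) - u n) := by
        rw [← add_assoc]
        abel
      rw [h1]
      refine (hadd _ (S.sub_mem (hball _).1 (hball _).1) _
        (S.sub_mem (hball _).1 (hball _).1)).trans ?_
      refine (add_le_add (hstep (n + i)) ih).trans (le_of_eq ?_)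
      field_simp
      ring
  have hcauchy : CauchySeq u := by
    refine cauchySeq_of_le_geometric q D hq1 fun n => ?_
    rw [dist_comm, dist_eq_norm]
    exact (hle _ (S.sub_mem (hball _).1 (hball _).1)).trans (hstep n)
  obtain ⟨x, hx⟩ := cauchySeq_tendsto_of_complete hcauchy
  have hxb := hlsc (fun n => u n - b) (x - b) r hr (hx.sub_const b)
    (Eventually.of_forall fun n => ⟨S.sub_mem (hball n).1 hb, (hball n).2⟩)
  have hxS : x ∈ S := by simpa using S.add_mem hxb.1 hb
  -- Completeness is available only for `‖·‖`; lower semicontinuity turns the uniform bound on `N (u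
  -- m - u n)` into one for the limit.
  have hxu : ∀ n, N (x - u n) ≤ D / (1 - q) * q ^ n := fun n => by
    refine (hlsc (fun m => u m - u n) (x - u n) _ (by positivity) (hx.sub_const _) ?_).2
    filter_upwards [eventually_ge_atTop n] with m hm
    obtain ⟨i, rfl⟩ := Nat.exists_eq_add_of_le hm
    refine ⟨S.sub_mem (hball _).1 (hball _).1, (hdist n i).trans ?_⟩
    rw [div_mul_eq_mul_div]
    refine div_le_div_of_nonneg_right ?_ h1q.le
    have : 0 ≤ q ^ i := pow_nonneg hq0 _
    have h2 : 0 ≤ D * q ^ n := by positivity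
    nlinarith
  -- `Φ` is not assumed continuous for `‖·‖`; the contraction estimate in `N`, which dominates `‖·‖`
  -- on `S`, replaces continuity.
  have hlim : Tendsto (fun n => u (n + 1)) atTop (𝓝 (Φ x)) := by
    rw [tendsto_iff_norm_sub_tendsto_zero]
    have h0 : Tendsto (fun n => q * (D / (1 - q) * q ^ n)) atTop (𝓝 0) := by
      simpa using ((tendsto_pow_atTop_nhds_zero_of_lt_one hq0 hq1).const_mul _).const_mul q
    refine squeeze_zero (fun _ => norm_nonneg _) (fun n => ?_) h0
    rw [norm_sub_rev, hsucc]
    refine (hle _ (S.sub_mem (hmaps x hxS hxb.2).1 (hmaps _ (hball n).1 (hball n).2).1)).trans ?_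
    exact (hcontr x hxS _ (hball n).1 hxb.2 (hball n).2).trans
      (mul_le_mul_of_nonneg_left (hxu n) hq0)
  have hfix : Φ x = x := tendsto_nhds_unique hlim (hx.comp (tendsto_add_atTop_nat 1))
  refine ⟨x, hxS, hxb.2, hfix, fun y hyS hy hyfix => ?_⟩
  have h1 := hcontr y hyS x hxS hy hxb.2
  rw [hfix, hyfix] at h1
  have h2 := hN0 (y - x)
  have h3 : N (y - x) = 0 := by nlinarith
  have h4 := hle _ (S.sub_mem hyS hxS)
  rw [h3] at h4
  exact sub_eq_zero.1 (norm_le_zero_iff.1 h4)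

/-! ### The transforms `J_m`, `Γ_m` on the Hilbert--Schmidt class -/

section WeightBounds

theorem norm_weightJ_le (m : ℕ) (j l : ℤ) : ‖weightJ m j l‖ ≤ 1 := by
  unfold weightJ
  split_ifs <;> simp

variable {ω : ℝ}

theorem freq_sub (j l : ℤ) : freq ω j - freq ω l = 2 * Real.pi * Complex.I / ω * ((j : ℂ) - l) := by
  simp only [freq]
  ring

theorem norm_inv_freq_sub (hω : 0 < ω) (j l : ℤ) :
    ‖1 / (freq ω j - freq ω l)‖ = ω / (2 * Real.pi) / |(j : ℝ) - l| := by
  have h : ‖(j : ℂ) - l‖ = |(j : ℝ) - l| := by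
    rw [← Complex.ofReal_intCast, ← Complex.ofReal_intCast, ← Complex.ofReal_sub,
      Complex.norm_real, Real.norm_eq_abs]
  rw [freq_sub, norm_div, norm_one, norm_mul, h]
  simp only [norm_div, norm_mul, Complex.norm_ofNat, Complex.norm_real, Complex.norm_I,
    Real.norm_eq_abs, abs_of_pos hω, abs_of_pos Real.pi_pos, mul_one]
  field_simp

theorem one_le_abs_sub {j l : ℤ} (h : j ≠ l) : 1 ≤ |(j : ℝ) - l| := by
  have : 1 ≤ |j - l| := Int.one_le_abs (sub_ne_zero.2 h)
  exact_mod_cast this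

theorem norm_weightΓ_le (hω : 0 < ω) (m : ℕ) (j l : ℤ) :
    ‖weightΓ ω m j l‖ ≤ ω / (2 * Real.pi) := by
  unfold weightΓ
  split_ifs with h
  · rw [norm_inv_freq_sub hω]
    exact div_le_self (by positivity) (one_le_abs_sub h.2)
  · rw [norm_zero]
    positivity

theorem norm_weightΓ_symm (hω : 0 < ω) (m : ℕ) (j l : ℤ) :
    ‖weightΓ ω m j l‖ = ‖weightΓ ω m l j‖ := by
  unfold weightΓ
  by_cases h : (m : ℤ) < max |j| |l| ∧ j ≠ l
  · rw [if_pos h, if_pos ⟨max_comm |j| |l| ▸ h.1, h.2.symm⟩, norm_inv_freq_sub hω,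
      norm_inv_freq_sub hω, abs_sub_comm]
  · rw [if_neg h, if_neg fun h' => h ⟨max_comm |l| |j| ▸ h'.1, h'.2.symm⟩]

/-- A nonzero weight forces an index of modulus at least `m + 1`; this is why `α̃_{k+1}`, not
`α̃_k`, enters the estimates. -/
theorem weightΓ_eq_zero_or (m : ℕ) (j l : ℤ) :
    weightΓ ω m j l = 0 ∨ ((m : ℤ) + 1 ≤ |j| ∨ (m : ℤ) + 1 ≤ |l|) ∧ j ≠ l := by
  unfold weightΓ
  split_ifs with h
  · right
    refine ⟨?_, h.2⟩
    rcases lt_max_iff.1 h.1 with h1 | h1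
    · exact Or.inl h1
    · exact Or.inr h1
  · exact Or.inl rfl

end WeightBounds

section Transform

variable {E : Type*} [NormedAddCommGroup E] [InnerProductSpace ℂ E] [CompleteSpace E]
variable {P : ℤ → E →L[ℂ] E} (hP : IsResolutionOfIdentity P)
include hP

/-- Bounded weights preserve square summability, so the operator sought in the definition exists and
the default value `0` is not taken. -/
theorem blockMultiplier_block {c : ℤ → ℤ → ℂ} {C : ℝ} (hc : ∀ j l, ‖c j l‖ ≤ C)
    {X : E →L[ℂ] E} (hX : MemHS P X) (j l : ℤ) :
    P j * blockMultiplier P c (ofBounded X) * P l = c j l • (P j * X * P l) := by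
  have hC : 0 ≤ C := (norm_nonneg _).trans (hc 0 0)
  obtain ⟨Y, hY⟩ := exists_schur hP (X := X) (c := c)
    ((wMem_one.2 hX).of_le hC (fun _ _ => norm_nonneg _) fun j l => by
      rw [one_mul]
      exact mul_le_mul_of_nonneg_right (hc j l) (norm_nonneg _)).1
  have hex : ∃ Y, IsBlockMultiplier P c (ofBounded X) Y := ⟨Y, fun l x => ⟨trivial, fun j =>
    congrArg (fun T : E →L[ℂ] E => T x) (hY j l)⟩⟩
  rw [blockMultiplier, dif_pos hex]
  ext x
  exact (hex.choose_spec l x).2 j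

theorem blockMultiplier_sub {c : ℤ → ℤ → ℂ} {C : ℝ} (hc : ∀ j l, ‖c j l‖ ≤ C)
    {X Y : E →L[ℂ] E} (hX : MemHS P X) (hY : MemHS P Y) :
    blockMultiplier P c (ofBounded (X - Y))
      = blockMultiplier P c (ofBounded X) - blockMultiplier P c (ofBounded Y) :=
  hP.ext_blocks fun j l => by
    rw [blockMultiplier_block hP hc (hX.sub hY).1, mul_sub, sub_mul, smul_sub, mul_sub, sub_mul,
      blockMultiplier_block hP hc hX, blockMultiplier_block hP hc hY]

theorem blockMultiplier_add {c : ℤ → ℤ → ℂ} {C : ℝ} (hc : ∀ j l, ‖c j l‖ ≤ C)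
    {X Y : E →L[ℂ] E} (hX : MemHS P X) (hY : MemHS P Y) :
    blockMultiplier P c (ofBounded (X + Y))
      = blockMultiplier P c (ofBounded X) + blockMultiplier P c (ofBounded Y) :=
  hP.ext_blocks fun j l => by
    rw [blockMultiplier_block hP hc (hX.add hY).1, mul_add, add_mul, smul_add, mul_add, add_mul,
      blockMultiplier_block hP hc hX, blockMultiplier_block hP hc hY]

theorem WMem.blockMultiplier {c : ℤ → ℤ → ℂ} {C : ℝ} (hc : ∀ j l, ‖c j l‖ ≤ C)
    {w : ℤ → ℤ → ℝ} (hw : ∀ j l, 0 ≤ w j l) {X : E →L[ℂ] E} (hX : MemHS P X)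
    (hwX : WMem P w X) : WMem P w (blockMultiplier P c (ofBounded X)) ∧
      wNorm P w (InvolutionOperator.blockMultiplier P c (ofBounded X)) ≤ C * wNorm P w X := by
  refine hwX.of_le ((norm_nonneg _).trans (hc 0 0)) hw fun j l => ?_
  rw [blockMultiplier_block hP hc hX, norm_smul]
  calc w j l * (‖c j l‖ * ‖P j * X * P l‖) = ‖c j l‖ * (w j l * ‖P j * X * P l‖) := by ring
    _ ≤ C * (w j l * ‖P j * X * P l‖) :=
      mul_le_mul_of_nonneg_right (hc j l) (mul_nonneg (hw _ _) (norm_nonneg _))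

theorem MemHS.blockMultiplier {c : ℤ → ℤ → ℂ} {C : ℝ} (hc : ∀ j l, ‖c j l‖ ≤ C)
    {X : E →L[ℂ] E} (hX : MemHS P X) : MemHS P (blockMultiplier P c (ofBounded X)) :=
  wMem_one.1 ((wMem_one.2 hX).blockMultiplier hP hc (fun _ _ => zero_le_one) hX).1

variable {ω : ℝ} (hω : 0 < ω) (m : ℕ)
include hω

/-- `Γ_m X` has no blocks inside the coarse block diagonal, hence neither has `(Γ_m X) (J_m Z)`. -/
theorem transformJ_mul_eq_zero {X Z : E →L[ℂ] E} (hX : MemHS P X) (hZ : MemHS P Z) :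
    blockMultiplier P (weightJ m) (ofBounded (blockMultiplier P (weightΓ ω m) (ofBounded X) *
      blockMultiplier P (weightJ m) (ofBounded Z))) = 0 := by
  have hG := hX.blockMultiplier hP (norm_weightΓ_le hω m)
  have hJ := hZ.blockMultiplier hP (norm_weightJ_le m)
  refine hP.ext_blocks fun j l => ?_
  rw [blockMultiplier_block hP (norm_weightJ_le m) (hG.mul hP hJ).1, mul_zero, zero_mul]
  by_cases h : (|j| ≤ m ∧ |l| ≤ m) ∨ j = l
  · refine smul_eq_zero_of_right _ (ContinuousLinearMap.ext fun x => ?_)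
    refine (hP.hasSum_mul _ _ j l x).unique ?_
    have hz : ∀ n, (P j * InvolutionOperator.blockMultiplier P (weightΓ ω m) (ofBounded X) * P n)
        ((P n * InvolutionOperator.blockMultiplier P (weightJ m) (ofBounded Z) * P l) x) = 0 := by
      intro n
      rw [blockMultiplier_block hP (norm_weightΓ_le hω m) hX,
        blockMultiplier_block hP (norm_weightJ_le m) hZ]
      by_cases hn : (|n| ≤ m ∧ |l| ≤ m) ∨ n = l
      · have : weightΓ ω m j n = 0 := by
          unfold weightΓ
          rw [if_neg]
          rintro ⟨h1, h2⟩
          rcases h with h | h <;> rcases hn with hn | hn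
          · exact absurd (max_le h.1 hn.1) (not_le.2 h1)
          · subst hn
            exact absurd (max_le h.1 h.2) (not_le.2 h1)
          · subst h
            exact absurd (max_le hn.2 hn.1) (not_le.2 h1)
          · exact h2 (h.trans hn.symm)
        simp [this]
      · have : weightJ m n l = 0 := if_neg hn
        simp [this]
    simp only [hz]
    exact hasSum_zero
  · rw [weightJ, if_neg h, zero_smul]

/-- Blockwise form of `L₀ (Γ_m X) - (Γ_m X) L₀ = X - J_m X`: the supports of the two weights are
complementary, and off the support of `J_m` the weight of `Γ_m` inverts `λ_j - λ_l`. -/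
theorem commutator_block {X : E →L[ℂ] E} (hX : MemHS P X) (j l : ℤ) :
    (freq ω j - freq ω l) • (P j * blockMultiplier P (weightΓ ω m) (ofBounded X) * P l)
      = P j * X * P l - P j * blockMultiplier P (weightJ m) (ofBounded X) * P l := by
  rw [blockMultiplier_block hP (norm_weightΓ_le hω m) hX,
    blockMultiplier_block hP (norm_weightJ_le m) hX, smul_smul]
  by_cases h : (|j| ≤ m ∧ |l| ≤ m) ∨ j = l
  · have h1 : weightΓ ω m j l = 0 := by
      unfold weightΓ
      rw [if_neg]
      rintro ⟨h1, h2⟩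
      rcases h with h | h
      · exact absurd (max_le h.1 h.2) (not_le.2 h1)
      · exact h2 h
    rw [weightJ, if_pos h, h1]
    simp
  · have hjl : j ≠ l := fun h' => h (Or.inr h')
    have h2 : (m : ℤ) < max |j| |l| := by
      by_contra h3
      exact h (Or.inl (max_le_iff.1 (not_lt.1 h3)))
    have hne : freq ω j - freq ω l ≠ 0 := by
      rw [freq_sub]
      have h4 : (j : ℂ) - l ≠ 0 := sub_ne_zero.2 (by exact_mod_cast hjl)
      have h5 : (ω : ℂ) ≠ 0 := by exact_mod_cast hω.ne'
      have h6 : (Real.pi : ℂ) ≠ 0 := by exact_mod_cast Real.pi_ne_zero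
      simp [h4, h5, h6]
    rw [weightJ, if_neg h, weightΓ, if_pos ⟨h2, hjl⟩, mul_one_div_cancel hne]
    simp

end Transform

/-! ### Estimates in the space `ℳ` and the fixed point -/

section FixedPoint

variable {E : Type*} [NormedAddCommGroup E] [InnerProductSpace ℂ E] [CompleteSpace E]
variable {P : ℤ → E →L[ℂ] E} (hP : IsResolutionOfIdentity P)
variable {ω : ℝ} (hω : 0 < ω) {W : E →L[ℂ] E} (hW : MemHS P W)

theorem alphaPrime_nonneg (n : ℕ) : 0 ≤ alphaPrime P W n :=
  Real.iSup_nonneg fun _ => div_nonneg (abs_nonneg _) (abs_nonneg _)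

include hω in
theorem alphaTilde_nonneg (n : ℕ) : 0 ≤ alphaTilde P ω W n :=
  mul_nonneg (by positivity)
    (add_nonneg (mul_nonneg zero_le_two (alpha_nonneg W _)) (alphaPrime_nonneg n))

include hP hW

theorem le_alphaPrime {n : ℕ} {i j : ℤ} (hi : (n : ℤ) ≤ |i|) (hj : |j| < n) :
    |alpha P W i - alpha P W j| / |(i : ℝ) - j| ≤ alphaPrime P W n := by
  refine le_ciSup (f := fun p : {p : ℤ × ℤ // (n : ℤ) ≤ |p.1| ∧ |p.2| < n} =>
    |alpha P W p.1.1 - alpha P W p.1.2| / |(p.1.1 : ℝ) - p.1.2|) ?_ ⟨(i, j), hi, hj⟩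
  -- The supremum defining `α'_n` is genuine: `0 ≤ α ≤ 1` and `|i - j| ≥ 1` bound every quotient by
  -- `1`.
  refine ⟨1, ?_⟩
  rintro _ ⟨⟨⟨a, b⟩, ha, hb⟩, rfl⟩
  have hab : a ≠ b := by
    rintro rfl
    exact absurd ha (not_le.2 hb)
  refine div_le_one_of_le₀ (le_trans ?_ (one_le_abs_sub hab)) (abs_nonneg _)
  rw [abs_le]
  constructor <;> linarith [alpha_nonneg (P := P) W a, alpha_nonneg (P := P) W b,
    alpha_le_one hP hW a, alpha_le_one hP hW b]

include hω

/-- If `|j| > k`, monotonicity of `α` suffices. Otherwise `|l| > k` and `α_j ≤ |α_l - α_j| +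
α_{k+1}`; the decay `1/|l - j|` of the weight turns the first term into `α'_{k+1}`. This is the
reason `α'` occurs in `α̃`. -/
theorem alpha_mul_weightΓ_le (k : ℕ) (j l : ℤ) :
    alpha P W j * ‖weightΓ ω k j l‖ ≤ alphaTilde P ω W (k + 1) := by
  have hκ : 0 ≤ ω / (2 * Real.pi) := by positivity
  have ha := alpha_nonneg (P := P) W
  have hα1 := ha (k + 1 : ℕ)
  have hα' := alphaPrime_nonneg (P := P) (W := W) (k + 1)
  have hk : |((k + 1 : ℕ) : ℤ)| = (k : ℤ) + 1 := by
    rw [Nat.abs_cast]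
    push_cast
    rfl
  rcases weightΓ_eq_zero_or (ω := ω) k j l with h | ⟨h, hjl⟩
  · rw [h, norm_zero, mul_zero]
    exact alphaTilde_nonneg hω _
  by_cases hj : (k : ℤ) + 1 ≤ |j|
  · calc alpha P W j * ‖weightΓ ω k j l‖ ≤ alpha P W (k + 1 : ℕ) * (ω / (2 * Real.pi)) :=
          mul_le_mul (alpha_anti hP hW (by rw [hk]; exact hj)) (norm_weightΓ_le hω k j l)
            (norm_nonneg _) hα1
      _ ≤ alphaTilde P ω W (k + 1) := by
          rw [alphaTilde, mul_comm]
          refine mul_le_mul_of_nonneg_left ?_ hκ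
          linarith
  · have hl : (k : ℤ) + 1 ≤ |l| := h.resolve_left hj
    have h1 : alpha P W j ≤ |alpha P W l - alpha P W j| + alpha P W (k + 1 : ℕ) := by
      have := neg_abs_le (alpha P W l - alpha P W j)
      have h2 := alpha_anti hP hW (i := (k + 1 : ℕ)) (j := l) (by rw [hk]; exact hl)
      linarith
    have h2 := le_alphaPrime hP hW (n := k + 1) (i := l) (j := j) (by push_cast; exact hl)
      (by push_cast; exact not_le.1 hj)
    have h3 : ‖weightΓ ω k j l‖ ≤ ω / (2 * Real.pi) / |(l : ℝ) - j| := by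
      unfold weightΓ
      split_ifs
      · rw [norm_inv_freq_sub hω, abs_sub_comm]
      · rw [norm_zero]
        positivity
    calc alpha P W j * ‖weightΓ ω k j l‖
        ≤ |alpha P W l - alpha P W j| * ‖weightΓ ω k j l‖
          + alpha P W (k + 1 : ℕ) * ‖weightΓ ω k j l‖ := by
            rw [← add_mul]
            exact mul_le_mul_of_nonneg_right h1 (norm_nonneg _)
      _ ≤ |alpha P W l - alpha P W j| * (ω / (2 * Real.pi) / |(l : ℝ) - j|)
          + alpha P W (k + 1 : ℕ) * (ω / (2 * Real.pi)) :=
            add_le_add (mul_le_mul_of_nonneg_left h3 (abs_nonneg _))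
              (mul_le_mul_of_nonneg_left (norm_weightΓ_le hω k j l) hα1)
      _ = ω / (2 * Real.pi) * (|alpha P W l - alpha P W j| / |(l : ℝ) - j|
          + alpha P W (k + 1 : ℕ)) := by ring
      _ ≤ alphaTilde P ω W (k + 1) := by
          rw [alphaTilde]
          refine mul_le_mul_of_nonneg_left ?_ hκ
          linarith

variable (hα0 : ∀ n, 0 < alpha P W n)
include hα0

/-- `‖Γ_k X‖₂` is small compared with the norm of `X` in `ℳ`. -/
theorem hsNorm_transformΓ_le (k : ℕ) {X : E →L[ℂ] E} {a : ℝ}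
    (h1 : WMem P (fun _ l => (alpha P W l)⁻¹) X) (h2 : WMem P (fun j _ => (alpha P W j)⁻¹) X)
    (ha1 : wNorm P (fun _ l => (alpha P W l)⁻¹) X ≤ a)
    (ha2 : wNorm P (fun j _ => (alpha P W j)⁻¹) X ≤ a) :
    MemHS P (blockMultiplier P (weightΓ ω k) (ofBounded X)) ∧
      hsNorm P (blockMultiplier P (weightΓ ω k) (ofBounded X))
        ≤ alphaTilde P ω W (k + 1) * a := by
  have hX := (h1.memHS_of_col hP hα0 (alpha_le_one hP hW)).1
  have hG := hX.blockMultiplier hP (norm_weightΓ_le hω k)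
  refine ⟨hG, ?_⟩
  have hk : |((k + 1 : ℕ) : ℤ)| = (k : ℤ) + 1 := by
    rw [Nat.abs_cast]
    push_cast
    rfl
  set b := ω / (2 * Real.pi) * alpha P W (k + 1 : ℕ) with hb
  have hb0 : 0 ≤ b := mul_nonneg (by positivity) (alpha_nonneg W _)
  have hα : ∀ n : ℤ, (k : ℤ) + 1 ≤ |n| → 1 ≤ alpha P W (k + 1 : ℕ) * (alpha P W n)⁻¹ :=
    fun n hn => by
      rw [← div_eq_mul_inv, one_le_div (hα0 n)]
      exact alpha_anti hP hW (by rw [hk]; exact hn)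
  have hinv : ∀ n, 0 ≤ (alpha P W n)⁻¹ := fun n => inv_nonneg.2 (alpha_nonneg W n)
  have hle : ∀ p : ℤ × ℤ,
      ‖P p.1 * InvolutionOperator.blockMultiplier P (weightΓ ω k) (ofBounded X) * P p.2‖ ≤
      b * ((alpha P W p.2)⁻¹ * ‖P p.1 * X * P p.2‖ + (alpha P W p.1)⁻¹ * ‖P p.1 * X * P p.2‖) := by
    rintro ⟨j, l⟩
    rw [blockMultiplier_block hP (norm_weightΓ_le hω k) hX, norm_smul]
    have hx := norm_nonneg (P j * X * P l)
    rcases weightΓ_eq_zero_or (ω := ω) k j l with h | ⟨h, -⟩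
    · rw [h, norm_zero, zero_mul]
      exact mul_nonneg hb0 (add_nonneg (mul_nonneg (hinv _) hx) (mul_nonneg (hinv _) hx))
    · have h3 : 1 ≤ alpha P W (k + 1 : ℕ) * ((alpha P W l)⁻¹ + (alpha P W j)⁻¹) := by
        rw [mul_add]
        have := alpha_nonneg (P := P) W (k + 1 : ℕ)
        rcases h with h | h
        · linarith [hα _ h, mul_nonneg this (hinv l)]
        · linarith [hα _ h, mul_nonneg this (hinv j)]
      calc ‖weightΓ ω k j l‖ * ‖P j * X * P l‖
          ≤ ω / (2 * Real.pi) * (‖P j * X * P l‖ *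
            (alpha P W (k + 1 : ℕ) * ((alpha P W l)⁻¹ + (alpha P W j)⁻¹))) :=
            mul_le_mul (norm_weightΓ_le hω k j l) (le_mul_of_one_le_right hx h3) hx
              (by positivity)
        _ = _ := by rw [hb]; ring
  have hadd := summable_sq_add
    (fun p : ℤ × ℤ => mul_nonneg (hinv p.2) (norm_nonneg (P p.1 * X * P p.2)))
    (fun p : ℤ × ℤ => mul_nonneg (hinv p.1) (norm_nonneg (P p.1 * X * P p.2))) h1 h2
  -- Minkowski's inequality for the column and row weighted norms gives `a + a`, the source of the
  -- coefficient `2` of `α_{k+1}` in `α̃_{k+1}`.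
  have h4 : hsNorm P (InvolutionOperator.blockMultiplier P (weightΓ ω k) (ofBounded X))
      ≤ b * (a + a) := by
    refine le_trans ?_ (mul_le_mul_of_nonneg_left (hadd.2.trans (add_le_add ha1 ha2)) hb0)
    refine Real.sqrt_le_iff.2 ⟨mul_nonneg hb0 (Real.sqrt_nonneg _), ?_⟩
    rw [mul_pow, Real.sq_sqrt (tsum_nonneg fun _ => sq_nonneg _), ← tsum_mul_left]
    refine Summable.tsum_le_tsum (fun p => ?_) hG (hadd.1.mul_left _)
    rw [← mul_pow]
    exact pow_le_pow_left₀ (norm_nonneg _) (hle p) 2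
  have ha0 : 0 ≤ a := (wNorm_nonneg _ _).trans ha1
  refine h4.trans ?_
  have h5 : b * (a + a) = ω / (2 * Real.pi) * (2 * alpha P W (k + 1 : ℕ)) * a := by
    rw [hb]
    ring
  rw [h5, alphaTilde]
  refine mul_le_mul_of_nonneg_right (mul_le_mul_of_nonneg_left ?_ (by positivity)) ha0
  linarith [alphaPrime_nonneg (P := P) (W := W) (k + 1)]

/-- The weight `α_j / α_l` is the one that composes with a column weight on the left:
`(1/α_n)(α_n/α_l) = 1/α_l`. The row version below composes on the other side. -/
theorem wNorm_transformΓ_col_le (k : ℕ) {X : E →L[ℂ] E}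
    (h1 : WMem P (fun _ l => (alpha P W l)⁻¹) X) :
    WMem P (fun j l => alpha P W j * (alpha P W l)⁻¹)
        (blockMultiplier P (weightΓ ω k) (ofBounded X)) ∧
      wNorm P (fun j l => alpha P W j * (alpha P W l)⁻¹)
          (blockMultiplier P (weightΓ ω k) (ofBounded X))
        ≤ alphaTilde P ω W (k + 1) * wNorm P (fun _ l => (alpha P W l)⁻¹) X := by
  have hX := (h1.memHS_of_col hP hα0 (alpha_le_one hP hW)).1
  refine h1.of_le (alphaTilde_nonneg hω _)
    (fun j l => mul_nonneg (alpha_nonneg W j) (inv_nonneg.2 (alpha_nonneg W l))) fun j l => ?_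
  rw [blockMultiplier_block hP (norm_weightΓ_le hω k) hX, norm_smul]
  calc alpha P W j * (alpha P W l)⁻¹ * (‖weightΓ ω k j l‖ * ‖P j * X * P l‖)
      = (alpha P W j * ‖weightΓ ω k j l‖) * ((alpha P W l)⁻¹ * ‖P j * X * P l‖) := by ring
    _ ≤ _ := mul_le_mul_of_nonneg_right (alpha_mul_weightΓ_le hP hω hW k j l)
      (mul_nonneg (inv_nonneg.2 (alpha_nonneg W l)) (norm_nonneg _))

theorem wNorm_transformΓ_row_le (k : ℕ) {X : E →L[ℂ] E} (hX : MemHS P X)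
    (h1 : WMem P (fun j _ => (alpha P W j)⁻¹) X) :
    WMem P (fun j l => (alpha P W j)⁻¹ * alpha P W l)
        (blockMultiplier P (weightΓ ω k) (ofBounded X)) ∧
      wNorm P (fun j l => (alpha P W j)⁻¹ * alpha P W l)
          (blockMultiplier P (weightΓ ω k) (ofBounded X))
        ≤ alphaTilde P ω W (k + 1) * wNorm P (fun j _ => (alpha P W j)⁻¹) X := by
  refine h1.of_le (alphaTilde_nonneg hω _)
    (fun j l => mul_nonneg (inv_nonneg.2 (alpha_nonneg W j)) (alpha_nonneg W l)) fun j l => ?_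
  rw [blockMultiplier_block hP (norm_weightΓ_le hω k) hX, norm_smul]
  calc (alpha P W j)⁻¹ * alpha P W l * (‖weightΓ ω k j l‖ * ‖P j * X * P l‖)
      = (alpha P W l * ‖weightΓ ω k j l‖) * ((alpha P W j)⁻¹ * ‖P j * X * P l‖) := by ring
    _ ≤ _ := by
      rw [norm_weightΓ_symm hω]
      exact mul_le_mul_of_nonneg_right (alpha_mul_weightΓ_le hP hω hW k l j)
        (mul_nonneg (inv_nonneg.2 (alpha_nonneg W j)) (norm_nonneg _))

end FixedPoint

section MainFixedPoint

variable {E : Type*} [NormedAddCommGroup E] [InnerProductSpace ℂ E] [CompleteSpace E]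
variable {P : ℤ → E →L[ℂ] E}

variable (P) in
/-- The operators in the weighted space `ℳ`. -/
def weightedSubgroup (W : E →L[ℂ] E) : AddSubgroup (E →L[ℂ] E) where
  carrier := {X | WMem P (fun _ l => (alpha P W l)⁻¹) X ∧ WMem P (fun j _ => (alpha P W j)⁻¹) X}
  add_mem' hX hY :=
    ⟨(hX.1.add (fun _ l => inv_nonneg.2 (alpha_nonneg W l)) hY.1).1,
      (hX.2.add (fun j _ => inv_nonneg.2 (alpha_nonneg W j)) hY.2).1⟩
  zero_mem' := ⟨(wMem_zero _).1, (wMem_zero _).1⟩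
  neg_mem' hX := ⟨hX.1.neg.1, hX.2.neg.1⟩

variable (P) in
/-- The norm of the weighted space `ℳ`. -/
def weightedNorm (W X : E →L[ℂ] E) : ℝ :=
  max (wNorm P (fun _ l => (alpha P W l)⁻¹) X) (wNorm P (fun j _ => (alpha P W j)⁻¹) X)

theorem weightedNorm_nonneg (W X : E →L[ℂ] E) : 0 ≤ weightedNorm P W X :=
  (wNorm_nonneg _ _).trans (le_max_left _ _)

theorem weightedNorm_add_le (W : E →L[ℂ] E) {X Y : E →L[ℂ] E} (hX : X ∈ weightedSubgroup P W)
    (hY : Y ∈ weightedSubgroup P W) :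
    weightedNorm P W (X + Y) ≤ weightedNorm P W X + weightedNorm P W Y :=
  max_le
    ((hX.1.add (fun _ l => inv_nonneg.2 (alpha_nonneg W l)) hY.1).2.trans
      (add_le_add (le_max_left _ _) (le_max_left _ _)))
    ((hX.2.add (fun j _ => inv_nonneg.2 (alpha_nonneg W j)) hY.2).2.trans
      (add_le_add (le_max_right _ _) (le_max_right _ _)))

theorem weightedNorm_neg (W : E →L[ℂ] E) {X : E →L[ℂ] E} (hX : X ∈ weightedSubgroup P W) :
    weightedNorm P W (-X) = weightedNorm P W X := by
  rw [weightedNorm, hX.1.neg.2, hX.2.neg.2, weightedNorm]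

theorem weightedNorm_sub_le (W : E →L[ℂ] E) {X Y : E →L[ℂ] E} (hX : X ∈ weightedSubgroup P W)
    (hY : Y ∈ weightedSubgroup P W) :
    weightedNorm P W (X - Y) ≤ weightedNorm P W X + weightedNorm P W Y := by
  rw [sub_eq_add_neg, ← weightedNorm_neg W hY]
  exact weightedNorm_add_le W hX (neg_mem hY)

variable (P) in
/-- The nonlinear map `X ↦ B Γ_k X - (Γ_k X) (J_k B) - (Γ_k X) J_k (B Γ_k X) + B`. -/
def abstractΦ (ω : ℝ) (k : ℕ) (B X : E →L[ℂ] E) : E →L[ℂ] E :=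
  B * blockMultiplier P (weightΓ ω k) (ofBounded X)
    - blockMultiplier P (weightΓ ω k) (ofBounded X) * blockMultiplier P (weightJ k) (ofBounded B)
    - blockMultiplier P (weightΓ ω k) (ofBounded X) * blockMultiplier P (weightJ k)
      (ofBounded (B * blockMultiplier P (weightΓ ω k) (ofBounded X))) + B

variable (hP : IsResolutionOfIdentity P) {ω : ℝ} (hω : 0 < ω) {W : E →L[ℂ] E} (hW : MemHS P W)
  (hα0 : ∀ n, 0 < alpha P W n)
include hP hW hα0

theorem memHS_of_mem_weightedSubgroup {X : E →L[ℂ] E} (hX : X ∈ weightedSubgroup P W) :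
    MemHS P X ∧ ‖X‖ ≤ weightedNorm P W X := by
  have h := hX.1.memHS_of_col hP hα0 (alpha_le_one hP hW)
  exact ⟨h.1, (h.1.norm_le hP).trans (h.2.trans (le_max_left _ _))⟩

theorem transformJ_mem (k : ℕ) {X : E →L[ℂ] E} (hX : X ∈ weightedSubgroup P W) :
    blockMultiplier P (weightJ k) (ofBounded X) ∈ weightedSubgroup P W ∧
      weightedNorm P W (blockMultiplier P (weightJ k) (ofBounded X)) ≤ weightedNorm P W X := by
  have hs := (memHS_of_mem_weightedSubgroup hP hW hα0 hX).1
  have h1 := hX.1.blockMultiplier hP (norm_weightJ_le k)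
    (fun _ l => inv_nonneg.2 (alpha_nonneg W l)) hs
  have h2 := hX.2.blockMultiplier hP (norm_weightJ_le k)
    (fun j _ => inv_nonneg.2 (alpha_nonneg W j)) hs
  rw [one_mul] at h1 h2
  exact ⟨⟨h1.1, h2.1⟩, max_le_max h1.2 h2.2⟩

include hω

theorem hsNorm_transformΓ_le_weightedNorm (k : ℕ) {X : E →L[ℂ] E}
    (hX : X ∈ weightedSubgroup P W) :
    MemHS P (blockMultiplier P (weightΓ ω k) (ofBounded X)) ∧
      hsNorm P (blockMultiplier P (weightΓ ω k) (ofBounded X))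
        ≤ alphaTilde P ω W (k + 1) * weightedNorm P W X :=
  hsNorm_transformΓ_le hP hω hW hα0 k hX.1 hX.2 (le_max_left _ _) (le_max_right _ _)

/-- For the column norm the weight is split as `(1/α_n)(α_n/α_l)`; for the row norm the factor `X`
already carries the weight and only `‖Γ_k Y‖₂` is needed. -/
theorem mul_transformΓ_mem (k : ℕ) {X Y : E →L[ℂ] E} (hX : X ∈ weightedSubgroup P W)
    (hY : Y ∈ weightedSubgroup P W) :
    X * blockMultiplier P (weightΓ ω k) (ofBounded Y) ∈ weightedSubgroup P W ∧
      weightedNorm P W (X * blockMultiplier P (weightΓ ω k) (ofBounded Y))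
        ≤ alphaTilde P ω W (k + 1) * weightedNorm P W X * weightedNorm P W Y := by
  have hγ := alphaTilde_nonneg (P := P) hω (W := W) (k + 1)
  have hN := weightedNorm_nonneg (P := P) W
  have hinv : ∀ n, 0 ≤ (alpha P W n)⁻¹ := fun n => inv_nonneg.2 (alpha_nonneg W n)
  have h1 := wNorm_transformΓ_col_le hP hω hW hα0 k hY.1
  have h2 := hsNorm_transformΓ_le_weightedNorm hP hω hW hα0 k hY
  have h3 := hX.1.mul hP (w := fun _ l => (alpha P W l)⁻¹) (fun _ l => hinv l) (fun j n l => by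
    rw [inv_mul_cancel_left₀ (hα0 n).ne']) h1.1
  have h4 := hX.2.mul hP (w := fun j _ => (alpha P W j)⁻¹) (fun j _ => hinv j)
    (fun j n l => by rw [mul_one]) (wMem_one.2 h2.1)
  rw [wNorm_one] at h4
  refine ⟨⟨h3.1, h4.1⟩, max_le (h3.2.trans ?_) (h4.2.trans ?_)⟩
  · calc _ ≤ weightedNorm P W X * (alphaTilde P ω W (k + 1) * weightedNorm P W Y) :=
          mul_le_mul (le_max_left _ _)
            (h1.2.trans (mul_le_mul_of_nonneg_left (le_max_left _ _) hγ)) (wNorm_nonneg _ _) (hN _)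
      _ = _ := by ring
  · calc _ ≤ weightedNorm P W X * (alphaTilde P ω W (k + 1) * weightedNorm P W Y) :=
          mul_le_mul (le_max_right _ _) h2.2 (hsNorm_nonneg _) (hN _)
      _ = _ := by ring

theorem transformΓ_mul_mem (k : ℕ) {X Y : E →L[ℂ] E} (hX : X ∈ weightedSubgroup P W)
    (hY : Y ∈ weightedSubgroup P W) :
    blockMultiplier P (weightΓ ω k) (ofBounded X) * Y ∈ weightedSubgroup P W ∧
      weightedNorm P W (blockMultiplier P (weightΓ ω k) (ofBounded X) * Y)
        ≤ alphaTilde P ω W (k + 1) * weightedNorm P W X * weightedNorm P W Y := by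
  have hγ := alphaTilde_nonneg (P := P) hω (W := W) (k + 1)
  have hN := weightedNorm_nonneg (P := P) W
  have hinv : ∀ n, 0 ≤ (alpha P W n)⁻¹ := fun n => inv_nonneg.2 (alpha_nonneg W n)
  have h1 := wNorm_transformΓ_row_le hP hω hW hα0 k
    (memHS_of_mem_weightedSubgroup hP hW hα0 hX).1 hX.2
  have h2 := hsNorm_transformΓ_le_weightedNorm hP hω hW hα0 k hX
  have h3 := h1.1.mul hP (w := fun j _ => (alpha P W j)⁻¹) (fun j _ => hinv j) (fun j n l => by
    rw [mul_assoc, mul_inv_cancel₀ (hα0 n).ne', mul_one]) hY.2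
  have h4 := (wMem_one.2 h2.1).mul hP (w := fun _ l => (alpha P W l)⁻¹) (fun _ l => hinv l)
    (fun j n l => by rw [one_mul]) hY.1
  rw [wNorm_one] at h4
  refine ⟨⟨h4.1, h3.1⟩, max_le (h4.2.trans ?_) (h3.2.trans ?_)⟩
  · exact mul_le_mul h2.2 (le_max_left _ _) (wNorm_nonneg _ _) (mul_nonneg hγ (hN _))
  · exact mul_le_mul (h1.2.trans (mul_le_mul_of_nonneg_left (le_max_right _ _) hγ))
      (le_max_right _ _) (wNorm_nonneg _ _) (mul_nonneg hγ (hN _))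

/-- `J_k` does not increase the norm of `ℳ`, so the first two terms each contribute a bilinear
bound, and applying the product estimate twice gives the quadratic one. -/
theorem abstractΦ_sub_mem (k : ℕ) {B X : E →L[ℂ] E} (hB : B ∈ weightedSubgroup P W)
    (hX : X ∈ weightedSubgroup P W) :
    abstractΦ P ω k B X - B ∈ weightedSubgroup P W ∧
      weightedNorm P W (abstractΦ P ω k B X - B)
        ≤ 2 * (alphaTilde P ω W (k + 1) * weightedNorm P W B * weightedNorm P W X)
          + alphaTilde P ω W (k + 1) ^ 2 * weightedNorm P W B * weightedNorm P W X ^ 2 := by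
  have hγ := alphaTilde_nonneg (P := P) hω (W := W) (k + 1)
  have hx := weightedNorm_nonneg (P := P) W X
  have hb := weightedNorm_nonneg (P := P) W B
  have h1 := mul_transformΓ_mem hP hω hW hα0 k hB hX
  have hJB := transformJ_mem hP hW hα0 k hB
  have h2 := transformΓ_mul_mem hP hω hW hα0 k hX hJB.1
  have hJ := transformJ_mem hP hW hα0 k h1.1
  have h3 := transformΓ_mul_mem hP hω hW hα0 k hX hJ.1
  rw [abstractΦ, add_sub_cancel_right]
  refine ⟨sub_mem (sub_mem h1.1 h2.1) h3.1, ?_⟩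
  refine (weightedNorm_sub_le W (sub_mem h1.1 h2.1) h3.1).trans ?_
  have h12 := weightedNorm_sub_le W h1.1 h2.1
  have e2 := h2.2.trans (mul_le_mul_of_nonneg_left hJB.2 (mul_nonneg hγ hx))
  have e3 := h3.2.trans (mul_le_mul_of_nonneg_left (hJ.2.trans h1.2) (mul_nonneg hγ hx))
  calc _ ≤ _ := add_le_add (h12.trans (add_le_add h1.2 e2)) e3
    _ = _ := by ring

theorem abstractΦ_sub_abstractΦ_le (k : ℕ) {B X Y : E →L[ℂ] E} (hB : B ∈ weightedSubgroup P W)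
    (hX : X ∈ weightedSubgroup P W) (hY : Y ∈ weightedSubgroup P W) :
    weightedNorm P W (abstractΦ P ω k B X - abstractΦ P ω k B Y)
      ≤ (2 * (alphaTilde P ω W (k + 1) * weightedNorm P W B)
        + alphaTilde P ω W (k + 1) ^ 2 * weightedNorm P W B *
          (weightedNorm P W X + weightedNorm P W Y)) * weightedNorm P W (X - Y) := by
  have hγ := alphaTilde_nonneg (P := P) hω (W := W) (k + 1)
  have hb := weightedNorm_nonneg (P := P) W B
  have hN := weightedNorm_nonneg (P := P) W
  have hmem := fun {Z} => memHS_of_mem_weightedSubgroup hP hW hα0 (X := Z)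
  have hXY : X - Y ∈ weightedSubgroup P W := sub_mem hX hY
  set G : (E →L[ℂ] E) → (E →L[ℂ] E) := fun Z => blockMultiplier P (weightΓ ω k) (ofBounded Z)
    with hG
  set J : (E →L[ℂ] E) → (E →L[ℂ] E) := fun Z => blockMultiplier P (weightJ k) (ofBounded Z)
    with hJ
  have hGs : G X - G Y = G (X - Y) :=
    (blockMultiplier_sub hP (norm_weightΓ_le hω k) (hmem hX).1 (hmem hY).1).symm
  have h1 := mul_transformΓ_mem hP hω hW hα0 k hB hXY
  have hBX := mul_transformΓ_mem hP hω hW hα0 k hB hX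
  have hBY := mul_transformΓ_mem hP hω hW hα0 k hB hY
  have hJs : J (B * G X) - J (B * G Y) = J (B * G (X - Y)) := by
    rw [← hGs, mul_sub]
    exact (blockMultiplier_sub hP (norm_weightJ_le k) (hmem hBX.1).1 (hmem hBY.1).1).symm
  have hJB := transformJ_mem hP hW hα0 k hB
  have h2 := transformΓ_mul_mem hP hω hW hα0 k hXY hJB.1
  have hJX := transformJ_mem hP hW hα0 k hBX.1
  have h3 := transformΓ_mul_mem hP hω hW hα0 k hXY hJX.1
  have hJ1 := transformJ_mem hP hW hα0 k h1.1
  have h4 := transformΓ_mul_mem hP hω hW hα0 k hY hJ1.1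
  -- Everything but one term is affine in `X`; the quadratic term is polarized so that each piece
  -- contains `Γ_k (X - Y)`.
  have hdecomp : abstractΦ P ω k B X - abstractΦ P ω k B Y =
      B * G (X - Y) - G (X - Y) * J B - (G (X - Y) * J (B * G X) + G Y * J (B * G (X - Y))) := by
    rw [← hJs, ← hGs]
    simp only [abstractΦ, hG, hJ]
    noncomm_ring
  rw [hdecomp]
  have e2 := h2.2.trans (mul_le_mul_of_nonneg_left hJB.2 (mul_nonneg hγ (hN _)))
  have e3 := h3.2.trans (mul_le_mul_of_nonneg_left (hJX.2.trans hBX.2) (mul_nonneg hγ (hN _)))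
  have e4 := h4.2.trans (mul_le_mul_of_nonneg_left (hJ1.2.trans h1.2) (mul_nonneg hγ (hN _)))
  refine (weightedNorm_sub_le W (sub_mem h1.1 h2.1) (add_mem h3.1 h4.1)).trans ?_
  calc _ ≤ _ := add_le_add ((weightedNorm_sub_le W h1.1 h2.1).trans (add_le_add h1.2 e2))
        ((weightedNorm_add_le W h3.1 h4.1).trans (add_le_add e3 e4))
    _ = _ := by ring

/-- Under the smallness condition the nonlinear map has a unique fixed point in the ball. -/
theorem exists_unique_fixedPoint_abstractΦ (k : ℕ) {B : E →L[ℂ] E}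
    (hB : B ∈ weightedSubgroup P W)
    (hk : 4 * alphaTilde P ω W (k + 1) * weightedNorm P W B < 1) :
    ∃ X ∈ weightedSubgroup P W, weightedNorm P W (X - B) ≤ 3 * weightedNorm P W B ∧
      abstractΦ P ω k B X = X ∧
      ∀ Y ∈ weightedSubgroup P W, weightedNorm P W (Y - B) ≤ 3 * weightedNorm P W B →
        abstractΦ P ω k B Y = Y → Y = X := by
  have hγ := alphaTilde_nonneg (P := P) hω (W := W) (k + 1)
  have hb := weightedNorm_nonneg (P := P) W B
  have hmem := fun {Z} => memHS_of_mem_weightedSubgroup hP hW hα0 (X := Z)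
  set γ := alphaTilde P ω W (k + 1)
  set b := weightedNorm P W B
  have hγb : 0 ≤ γ * b := mul_nonneg hγ hb
  have hγb1 : γ * b < 1 / 4 := by linarith
  have hball : ∀ X ∈ weightedSubgroup P W, weightedNorm P W (X - B) ≤ 3 * b →
      weightedNorm P W X ≤ 4 * b := fun X hX h => by
    have := weightedNorm_add_le W (sub_mem hX hB) hB
    rw [sub_add_cancel] at this
    linarith
  -- On the ball `‖X‖_ℳ ≤ 4 b`, so the Lipschitz constant is at most `2 γ b + γ² b (4 b + 4 b)`,
  -- which is below `1/2 + 1/2` because `γ b < 1/4`.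
  refine exists_unique_fixedPoint (weightedSubgroup P W) (N := weightedNorm P W)
    (q := 2 * (γ * b) + 8 * (γ * b) ^ 2) (weightedNorm_nonneg W) ?_ (fun X hX => (hmem hX).2)
    (fun X hX Y hY => weightedNorm_add_le W hX hY) ?_ hB (by positivity) (by positivity)
    (by nlinarith) ?_ ?_
  · simp [weightedNorm, (wMem_zero _).2]
  · intro u X C hC hu h
    have h1 := wMem_of_tendsto hC hu (h.mono fun n hn =>
      ⟨hn.1.1, (le_max_left _ _).trans hn.2⟩)
    have h2 := wMem_of_tendsto hC hu (h.mono fun n hn =>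
      ⟨hn.1.2, (le_max_right _ _).trans hn.2⟩)
    exact ⟨⟨h1.1, h2.1⟩, max_le h1.2 h2.2⟩
  · intro X hX hXB
    have h := abstractΦ_sub_mem hP hω hW hα0 k hB hX
    have hx := hball X hX hXB
    have hx0 := weightedNorm_nonneg (P := P) W X
    refine ⟨by simpa using add_mem h.1 hB, h.2.trans ?_⟩
    -- As `‖X‖_ℳ ≤ 4 b` and `γ b < 1/4`, one has `γ ‖X‖_ℳ ≤ 1`; the two terms are at most `2 b` and
    -- `b`, which explains the radius `3 b`.
    change 2 * (γ * b * weightedNorm P W X) + γ ^ 2 * b * weightedNorm P W X ^ 2 ≤ 3 * b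
    have h1 : γ * b * weightedNorm P W X ≤ b := by nlinarith
    have h2 : γ ^ 2 * b * weightedNorm P W X ^ 2 = γ * weightedNorm P W X *
      (γ * b * weightedNorm P W X) := by ring
    have h3 : γ * weightedNorm P W X ≤ 1 := by nlinarith
    have h4 : 0 ≤ γ * b * weightedNorm P W X := mul_nonneg hγb hx0
    rw [h2]
    nlinarith
  · intro X hX Y hY hXB hYB
    refine (abstractΦ_sub_abstractΦ_le hP hω hW hα0 k hB hX hY).trans ?_
    refine mul_le_mul_of_nonneg_right ?_ (weightedNorm_nonneg _ _)
    change 2 * (γ * b) + γ ^ 2 * b * (weightedNorm P W X + weightedNorm P W Y) ≤ _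
    have h1 : weightedNorm P W X + weightedNorm P W Y ≤ 8 * b := by
      linarith [hball X hX hXB, hball Y hY hYB]
    have h2 := mul_le_mul_of_nonneg_left h1 (mul_nonneg (sq_nonneg γ) hb)
    nlinarith

/-- The chain `‖Γ_k X‖ ≤ ‖Γ_k X‖₂ ≤ α̃_{k+1} · 4 ‖B‖_ℳ < 1` makes `I + Γ_k X` invertible under the
same smallness condition. -/
theorem norm_transformΓ_lt_one (k : ℕ) {B X : E →L[ℂ] E} (hB : B ∈ weightedSubgroup P W)
    (hk : 4 * alphaTilde P ω W (k + 1) * weightedNorm P W B < 1) (hX : X ∈ weightedSubgroup P W)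
    (hXB : weightedNorm P W (X - B) ≤ 3 * weightedNorm P W B) :
    ‖blockMultiplier P (weightΓ ω k) (ofBounded X)‖ < 1 := by
  have h := hsNorm_transformΓ_le_weightedNorm hP hω hW hα0 k hX
  have hγ := alphaTilde_nonneg (P := P) hω (W := W) (k + 1)
  have h1 := weightedNorm_add_le W (sub_mem hX hB) hB
  rw [sub_add_cancel] at h1
  have h2 : weightedNorm P W X ≤ 4 * weightedNorm P W B := by linarith
  refine ((h.1.norm_le hP).trans h.2).trans_lt ?_
  nlinarith [mul_le_mul_of_nonneg_left h2 hγ]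

omit hα0 hW in
/-- A fixed point of the nonlinear map solves `X = B + B Γ_k X - (Γ_k X) J_k X`. -/
theorem eq_of_abstractΦ_eq (k : ℕ) {B X : E →L[ℂ] E} (hB : MemHS P B) (hX : MemHS P X)
    (hfix : abstractΦ P ω k B X = X) :
    X = B + B * blockMultiplier P (weightΓ ω k) (ofBounded X)
      - blockMultiplier P (weightΓ ω k) (ofBounded X) *
        blockMultiplier P (weightJ k) (ofBounded X) := by
  set G := blockMultiplier P (weightΓ ω k) (ofBounded X) with hG
  have hGm : MemHS P G := hX.blockMultiplier hP (norm_weightΓ_le hω k)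
  have hBG : MemHS P (B * G) := (hB.mul hP hGm).1
  have hJB := hB.blockMultiplier hP (norm_weightJ_le k)
  have hJBG := hBG.blockMultiplier hP (norm_weightJ_le k)
  have hc := norm_weightJ_le k
  have hfix' : X = B * G - G * blockMultiplier P (weightJ k) (ofBounded B)
      - G * blockMultiplier P (weightJ k) (ofBounded (B * G)) + B := hfix.symm
  -- Applying `J_k` to the fixed point equation kills the two terms of the form `(Γ_k X) J_k Z`.
  have hJX : blockMultiplier P (weightJ k) (ofBounded X)
      = blockMultiplier P (weightJ k) (ofBounded (B * G))
        + blockMultiplier P (weightJ k) (ofBounded B) := by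
    have h1 := (hGm.mul hP hJB).1
    have h2 := (hGm.mul hP hJBG).1
    conv_lhs => rw [hfix']
    rw [blockMultiplier_add hP hc ((hBG.sub h1).1.sub h2).1 hB,
      blockMultiplier_sub hP hc (hBG.sub h1).1 h2, blockMultiplier_sub hP hc hBG h1,
      transformJ_mul_eq_zero hP hω k hX hB, transformJ_mul_eq_zero hP hω k hX hBG]
    simp
  rw [hJX]
  conv_lhs => rw [hfix']
  rw [mul_add]
  abel

end MainFixedPoint

/-! ### Fourier series of square integrable functions -/

section FourierSeries

variable (ω : ℝ)

theorem freq_neg (n : ℤ) : freq ω (-n) = -freq ω n := by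
  simp only [freq]
  push_cast
  ring

theorem expMode_mul (m n : ℤ) (s : ℝ) : expMode ω m s * expMode ω n s = expMode ω (m + n) s := by
  simp only [expMode, ← Complex.exp_add, freq]
  congr 1
  push_cast
  ring

theorem conj_expMode (n : ℤ) (s : ℝ) :
    (starRingEnd ℂ) (expMode ω n s) = expMode ω (-n) s := by
  simp only [expMode, ← Complex.exp_conj, freq]
  congr 1
  simp only [map_mul, map_div₀, Complex.conj_ofReal, Complex.conj_I, map_intCast, map_ofNat]
  push_cast
  ring

theorem hasDerivAt_expMode (n : ℤ) (s : ℝ) :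
    HasDerivAt (expMode ω n) (freq ω n * expMode ω n s) s := by
  have h := ((hasDerivAt_id (s : ℂ)).const_mul (freq ω n)).cexp.comp_ofReal
  rw [mul_one, mul_comm] at h
  exact h

theorem expMode_zero_left (s : ℝ) : expMode ω 0 s = 1 := by simp [expMode, freq]

variable [Fact (0 < ω)]

theorem expMode_period (n : ℤ) : expMode ω n ω = 1 := by
  have hω : (ω : ℂ) ≠ 0 := by exact_mod_cast (Fact.out : 0 < ω).ne'
  rw [expMode, freq, div_mul_cancel₀ _ hω, mul_comm, Complex.exp_int_mul_two_pi_mul_I]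

theorem expMode_reflect (n : ℤ) (s : ℝ) : expMode ω n (ω - s) = expMode ω (-n) s := by
  have h : expMode ω n (ω - s) = expMode ω n ω * expMode ω (-n) s := by
    simp only [expMode, ← Complex.exp_add, freq_neg]
    congr 1
    push_cast
    ring
  rw [h, expMode_period, one_mul]

theorem integral_meanMeasure {F : Type*} [NormedAddCommGroup F] [NormedSpace ℝ F] (f : ℝ → F) :
    ∫ s, f s ∂(meanMeasure ω) = ω⁻¹ • ∫ s in (0 : ℝ)..ω, f s := by
  have hω : 0 < ω := Fact.out
  rw [meanMeasure, integral_smul_measure, intervalIntegral.integral_of_le hω.le,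
    integral_Icc_eq_integral_Ioc, ENNReal.toReal_inv, ENNReal.toReal_ofReal hω.le]

theorem integral_expMode (n : ℤ) :
    ∫ s, expMode ω n s ∂(meanMeasure ω) = if n = 0 then 1 else 0 := by
  have hω : 0 < ω := Fact.out
  split_ifs with h
  · subst h
    simp only [expMode_zero_left]
    simp
  · have hf : freq ω n ≠ 0 := by
      have h1 : (ω : ℂ) ≠ 0 := by exact_mod_cast hω.ne'
      have h2 : (n : ℂ) ≠ 0 := by exact_mod_cast h
      have h3 : (Real.pi : ℂ) ≠ 0 := by exact_mod_cast Real.pi_ne_zero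
      simp [freq, h1, h2, h3]
    rw [integral_meanMeasure]
    have := integral_exp_mul_complex (a := 0) (b := ω) hf
    change ∫ s in (0 : ℝ)..ω, expMode ω n s = _ at this
    rw [this]
    have h1 := expMode_period ω n
    rw [expMode] at h1
    simp [h1]

variable {H : Type*} [NormedAddCommGroup H] [InnerProductSpace ℂ H]

theorem coeff_apply (n : ℤ) (x : L2 ω H) :
    coeff ω H n x = ∫ s, expMode ω (-n) s • x s ∂(meanMeasure ω) := rfl

theorem coeFn_mode (n : ℤ) (h : H) :
    (mode ω H n h : ℝ → H) =ᵐ[meanMeasure ω] fun s => expMode ω n s • h :=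
  (memLp_mode ω H n h).coeFn_toLp

theorem integrable_L2 (x : L2 ω H) : Integrable (x : ℝ → H) (meanMeasure ω) :=
  (Lp.memLp x).integrable (by norm_num)

theorem integrable_expMode_smul (n : ℤ) {f : ℝ → H} (hf : Integrable f (meanMeasure ω)) :
    Integrable (fun s => expMode ω n s • f s) (meanMeasure ω) :=
  hf.bdd_smul 1 (continuous_expMode ω n).aestronglyMeasurable
    (Eventually.of_forall fun s => (norm_expMode ω n s).le)

variable [CompleteSpace H]

theorem coeff_mode (n l : ℤ) (h : H) :
    coeff ω H n (mode ω H l h) = if n = l then h else 0 := by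
  have h1 : coeff ω H n (mode ω H l h) = ∫ s, expMode ω (l - n) s • h ∂(meanMeasure ω) := by
    rw [coeff_apply]
    refine integral_congr_ae ?_
    filter_upwards [coeFn_mode ω l h] with s hs
    rw [hs, smul_smul, expMode_mul, neg_add_eq_sub]
  rw [h1, integral_smul_const, integral_expMode]
  by_cases hn : n = l
  · simp [hn]
  · rw [if_neg hn, if_neg (sub_ne_zero.2 (Ne.symm hn)), zero_smul]

/-- `mode n` and `coeff n` are adjoint to each other; isometry of the modes, their orthogonality and
self-adjointness of `P_n` all come from this. -/
theorem inner_mode (n : ℤ) (h : H) (x : L2 ω H) :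
    inner ℂ (mode ω H n h) x = inner ℂ h (coeff ω H n x) := by
  rw [L2.inner_def, coeff_apply, ← integral_inner (integrable_expMode_smul ω (-n)
    (integrable_L2 ω x))]
  refine integral_congr_ae ?_
  filter_upwards [coeFn_mode ω n h] with s hs
  rw [hs, inner_smul_left, inner_smul_right, conj_expMode]

theorem norm_mode (n : ℤ) (h : H) : ‖mode ω H n h‖ = ‖h‖ := by
  have h1 := inner_mode ω n h (mode ω H n h)
  rw [coeff_mode, if_pos rfl, inner_self_eq_norm_sq_to_K, inner_self_eq_norm_sq_to_K] at h1
  have h2 : ‖mode ω H n h‖ ^ 2 = ‖h‖ ^ 2 := by exact_mod_cast h1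
  exact (pow_left_inj₀ (norm_nonneg _) (norm_nonneg _) two_ne_zero).1 h2

/-- Integration of an `L²` function against continuous periodic functions. -/
theorem integral_continuous_smul_eq_zero {x : L2 ω H} (hx : ∀ n, coeff ω H n x = 0)
    (φ : C(AddCircle ω, ℂ)) : ∫ s, φ (s : AddCircle ω) • x s ∂(meanMeasure ω) = 0 := by
  have hint : ∀ φ : C(AddCircle ω, ℂ),
      Integrable (fun s : ℝ => φ (s : AddCircle ω) • x s) (meanMeasure ω) := fun φ =>
    (integrable_L2 ω x).bdd_smul ‖φ‖
      (φ.continuous.comp (AddCircle.continuous_mk' ω)).aestronglyMeasurable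
      (Eventually.of_forall fun s => φ.norm_coe_le_norm _)
  let Λ : C(AddCircle ω, ℂ) →L[ℂ] H := LinearMap.mkContinuous
    { toFun := fun φ => ∫ s, φ (s : AddCircle ω) • x s ∂(meanMeasure ω)
      map_add' := fun φ ψ => by
        rw [← integral_add (hint φ) (hint ψ)]
        simp only [ContinuousMap.add_apply, add_smul]
      map_smul' := fun c φ => by
        rw [RingHom.id_apply, ← integral_smul]
        simp only [ContinuousMap.smul_apply, smul_assoc] }
    (∫ s, ‖x s‖ ∂(meanMeasure ω)) fun φ => by
      refine (norm_integral_le_integral_norm _).trans ?_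
      rw [mul_comm, ← integral_const_mul]
      refine integral_mono (hint φ).norm ((integrable_L2 ω x).norm.const_mul _) fun s => ?_
      simp only [norm_smul]
      exact mul_le_mul_of_nonneg_right (φ.norm_coe_le_norm _) (norm_nonneg _)
  -- Trigonometric polynomials are annihilated by hypothesis, and they are dense in the continuous
  -- functions on the circle.
  have hker : Submodule.span ℂ (Set.range (fourier (T := ω))) ≤
      (Λ : C(AddCircle ω, ℂ) →ₗ[ℂ] H).ker := by
    rw [Submodule.span_le]
    rintro _ ⟨n, rfl⟩
    change ∫ s, fourier n (s : AddCircle ω) • x s ∂(meanMeasure ω) = 0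
    have h1 := hx (-n)
    rw [coeff_apply, neg_neg] at h1
    rw [← h1]
    refine integral_congr_ae (Eventually.of_forall fun s => ?_)
    simp only [fourier_coe_apply, expMode, freq]
    congr 2
    ring
  have htop := Submodule.topologicalClosure_minimal _ hker Λ.isClosed_ker
  rw [span_fourier_closure_eq_top] at htop
  exact htop (Submodule.mem_top : φ ∈ ⊤)

/-- An `L²` function with vanishing Fourier coefficients is zero. -/
theorem eq_zero_of_coeff_eq_zero {x : L2 ω H} (hx : ∀ n, coeff ω H n x = 0) : x = 0 := by
  have hω : 0 < ω := Fact.out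
  refine Lp.ext (EventuallyEq.trans ?_ (Lp.coeFn_zero H 2 (meanMeasure ω)).symm)
  refine (ae_meanMeasure_iff ω).2 ?_
  rw [← restrict_Ioo_eq_restrict_Icc, ae_restrict_iff' measurableSet_Ioo]
  refine IsOpen.ae_eq_zero_of_integral_contDiff_smul_eq_zero isOpen_Ioo
    ((integrableOn_L2 ω H x).mono_set Set.Ioo_subset_Icc_self).locallyIntegrableOn ?_
  intro g hg _ hgs
  have hg0 : ∀ s, s ∉ Set.Ioo 0 ω → g s = 0 := fun s hs =>
    image_eq_zero_of_notMem_tsupport fun h => hs (hgs h)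
  -- A test function supported in the open interval vanishes at both endpoints, hence is continuous
  -- on the circle.
  let φ : C(AddCircle ω, ℂ) := ⟨AddCircle.liftIco ω 0 fun s => (g s : ℂ),
    AddCircle.liftIco_continuous (by simp [hg0]) (by
      exact (Complex.continuous_ofReal.comp hg.continuous).continuousOn)⟩
  have h0 := integral_continuous_smul_eq_zero ω hx φ
  rw [integral_meanMeasure, smul_eq_zero_iff_right (inv_ne_zero hω.ne'),
    intervalIntegral.integral_of_le hω.le, ← integral_Ico_eq_integral_Ioc] at h0
  rw [← setIntegral_eq_integral_of_forall_compl_eq_zero (s := Set.Ico 0 ω), ← h0]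
  · refine setIntegral_congr_fun measurableSet_Ico fun s hs => ?_
    have h1 : φ (s : AddCircle ω) = (g s : ℂ) :=
      AddCircle.liftIco_coe_apply (p := ω) (a := 0) (f := fun s => (g s : ℂ)) (by simpa using hs)
    simp only [h1]
    exact (Complex.coe_smul (g s) (x s)).symm
  · intro s hs
    rw [hg0 s fun h => hs (Set.Ioo_subset_Ico_self h), zero_smul]

/-- The maps `mode n` as isometries. -/
def modeIsometry (n : ℤ) : H →ₗᵢ[ℂ] L2 ω H :=
  ⟨(mode ω H n : H →ₗ[ℂ] L2 ω H), norm_mode ω n⟩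

theorem isHilbertSum_mode : IsHilbertSum ℂ (fun _ : ℤ => H) (modeIsometry ω (H := H)) := by
  refine IsHilbertSum.mk ?_ (ge_of_eq ?_)
  · intro i j hij v w
    change inner ℂ (mode ω H i v) (mode ω H j w) = 0
    rw [inner_mode, coeff_mode, if_neg hij, inner_zero_right]
  · rw [Submodule.topologicalClosure_eq_top_iff, Submodule.eq_bot_iff]
    intro x hx
    rw [Submodule.mem_orthogonal] at hx
    refine eq_zero_of_coeff_eq_zero ω fun n => ?_
    have h1 := hx (mode ω H n (coeff ω H n x))
      (Submodule.mem_iSup_of_mem n ⟨coeff ω H n x, rfl⟩)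
    rw [inner_mode] at h1
    exact inner_self_eq_zero.1 h1

theorem hasSum_proj (x : L2 ω H) : HasSum (fun n => proj ω H n x) x ∧
    HasSum (fun n => ‖proj ω H n x‖ ^ 2) (‖x‖ ^ 2) := by
  set e := (isHilbertSum_mode ω (H := H)).linearIsometryEquiv
  have h1 := (isHilbertSum_mode ω (H := H)).hasSum_linearIsometryEquiv_symm (e x)
  rw [e.symm_apply_apply] at h1
  have hw : ∀ n, (e x : ℤ → H) n = coeff ω H n x := fun n => by
    have h2 := h1.mapL (coeff ω H n)
    have h3 : ∀ i, coeff ω H n (modeIsometry ω i ((e x : ℤ → H) i))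
        = if n = i then (e x : ℤ → H) i else 0 := fun i => coeff_mode ω n i _
    simp only [h3] at h2
    refine HasSum.unique ?_ h2
    convert hasSum_ite_eq n ((e x : ℤ → H) n) using 1
    funext i
    by_cases hi : n = i
    · simp [hi]
    · simp [hi, Ne.symm hi]
  refine ⟨?_, ?_⟩
  · simp only [hw] at h1
    exact h1
  · have h2 := lp.hasSum_norm (p := 2) (by norm_num) (e x)
    rw [e.norm_map] at h2
    have h3 : ∀ n, ‖proj ω H n x‖ = ‖(e x : ℤ → H) n‖ := fun n => by
      rw [hw]
      exact norm_mode ω n _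
    simp only [h3]
    simpa using h2

theorem proj_apply (n : ℤ) (x : L2 ω H) : proj ω H n x = mode ω H n (coeff ω H n x) := rfl

theorem coeff_proj (n l : ℤ) (x : L2 ω H) :
    coeff ω H n (proj ω H l x) = if n = l then coeff ω H n x else 0 := by
  rw [proj_apply, coeff_mode]
  split_ifs with h
  · rw [h]
  · rfl

theorem isResolutionOfIdentity_proj [Nontrivial H] : IsResolutionOfIdentity (proj ω H) where
  ne_zero i h := by
    obtain ⟨v, hv⟩ := exists_ne (0 : H)
    have h1 := congrArg (fun T : L2 ω H →L[ℂ] L2 ω H => T (mode ω H i v)) h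
    simp only [proj_apply, coeff_mode, if_pos, zero_apply] at h1
    have h2 := norm_mode ω i v
    rw [h1, norm_zero] at h2
    exact hv (norm_eq_zero.1 h2.symm)
  selfAdjoint i := by
    rw [ContinuousLinearMap.isSelfAdjoint_iff_isSymmetric]
    intro x y
    change inner ℂ (mode ω H i (coeff ω H i x)) y = inner ℂ x (mode ω H i (coeff ω H i y))
    rw [inner_mode, ← inner_conj_symm x, inner_mode, inner_conj_symm]
  idempotent i := ContinuousLinearMap.ext fun x => by
    change mode ω H i (coeff ω H i (proj ω H i x)) = _
    rw [coeff_proj, if_pos rfl, proj_apply]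
  orthogonal i j hij := ContinuousLinearMap.ext fun x => by
    change mode ω H i (coeff ω H i (proj ω H j x)) = 0
    rw [coeff_proj, if_neg hij, map_zero]
  hasSum x := (hasSum_proj ω x).1
  hasSum_norm x := (hasSum_proj ω x).2

/-! ### The operator `L₀` in Fourier coordinates -/

omit [Fact (0 < ω)] in
/-- Integration by parts against a primitive of an integrable function. -/
theorem integral_smul_eq_sub {u u' : ℝ → ℂ} (hω : 0 ≤ ω) (hu : ∀ s, HasDerivAt u (u' s) s)
    (hu' : Continuous u') {y : ℝ → H} (hy : IntervalIntegrable y volume 0 ω) :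
    ∫ s in (0 : ℝ)..ω, u s • y s = u ω • (∫ s in (0 : ℝ)..ω, y s)
      - ∫ s in (0 : ℝ)..ω, u' s • ∫ τ in (0 : ℝ)..s, y τ := by
  have huc : Continuous u := continuous_iff_continuousAt.2 fun s => (hu s).continuousAt
  obtain ⟨A, hA⟩ := isCompact_Icc.exists_bound_of_continuousOn (s := Set.Icc 0 ω) huc.continuousOn
  obtain ⟨B, hB⟩ := isCompact_Icc.exists_bound_of_continuousOn (s := Set.Icc 0 ω)
    hu'.continuousOn
  have hA0 : 0 ≤ A := (norm_nonneg _).trans (hA 0 ⟨le_rfl, hω⟩)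
  have hB0 : 0 ≤ B := (norm_nonneg _).trans (hB 0 ⟨le_rfl, hω⟩)
  have hprim : ∀ {z : ℝ → H}, IntervalIntegrable z volume 0 ω →
      IntervalIntegrable (fun s => u' s • ∫ τ in (0 : ℝ)..s, z τ) volume 0 ω := fun {z} hz => by
    refine ContinuousOn.intervalIntegrable (hu'.continuousOn.smul ?_)
    exact intervalIntegral.continuousOn_primitive_interval'
      (hz) Set.left_mem_uIcc
  have hsub : ∀ {z : ℝ → H} {s : ℝ}, IntervalIntegrable z volume 0 ω → s ∈ Set.Icc 0 ω →
      IntervalIntegrable z volume 0 s := fun hz hs =>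
    hz.mono_set (by
      rw [Set.uIcc_of_le hω, Set.uIcc_of_le hs.1]
      exact Set.Icc_subset_Icc_right hs.2)
  -- `I z` is the defect in the formula. It is additive under differences, zero for continuous `z`,
  -- and bounded by a multiple of the `L¹` norm, so density of continuous functions gives `I y = 0`.
  set I : (ℝ → H) → H := fun z => (∫ s in (0 : ℝ)..ω, u s • z s) - (u ω • ∫ s in (0 : ℝ)..ω, z s)
    + ∫ s in (0 : ℝ)..ω, u' s • ∫ τ in (0 : ℝ)..s, z τ with hI
  suffices hI0 : I y = 0 by
    have h1 : (∫ s in (0 : ℝ)..ω, u s • y s) = I y + (u ω • ∫ s in (0 : ℝ)..ω, y s)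
        - ∫ s in (0 : ℝ)..ω, u' s • ∫ τ in (0 : ℝ)..s, y τ := by
      simp only [hI]
      abel
    rw [h1, hI0, zero_add]
  have hIsub : ∀ {z w : ℝ → H}, IntervalIntegrable z volume 0 ω →
      IntervalIntegrable w volume 0 ω → I (fun s => z s - w s) = I z - I w := by
    intro z w hz hw
    have e1 : ∫ s in (0 : ℝ)..ω, u s • (z s - w s)
        = (∫ s in (0 : ℝ)..ω, u s • z s) - ∫ s in (0 : ℝ)..ω, u s • w s := by
      simp only [smul_sub]
      exact intervalIntegral.integral_sub (hz.continuousOn_smul huc.continuousOn)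
        (hw.continuousOn_smul huc.continuousOn)
    have e2 : ∫ s in (0 : ℝ)..ω, u' s • ∫ τ in (0 : ℝ)..s, (z τ - w τ)
        = (∫ s in (0 : ℝ)..ω, u' s • ∫ τ in (0 : ℝ)..s, z τ)
          - ∫ s in (0 : ℝ)..ω, u' s • ∫ τ in (0 : ℝ)..s, w τ := by
      rw [← intervalIntegral.integral_sub (hprim hz) (hprim hw)]
      refine intervalIntegral.integral_congr fun s hs => ?_
      rw [Set.uIcc_of_le hω] at hs
      rw [intervalIntegral.integral_sub (hsub hz hs) (hsub hw hs), smul_sub]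
    simp only [hI]
    rw [e1, e2, intervalIntegral.integral_sub hz hw, smul_sub]
    abel
  have hIcont : ∀ {g : ℝ → H}, Continuous g → I g = 0 := by
    intro g hg
    have h1 := intervalIntegral.integral_smul_deriv_eq_deriv_smul (a := 0) (b := ω)
      (fun s _ => hu s)
      (fun s _ => intervalIntegral.integral_hasDerivAt_right (hg.intervalIntegrable 0 s)
        (hg.stronglyMeasurableAtFilter _ _) hg.continuousAt)
      (hu'.intervalIntegrable _ _) (hg.intervalIntegrable _ _)
    simp only [hI]
    rw [h1, intervalIntegral.integral_same, smul_zero, sub_zero]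
    abel
  have hIbound : ∀ {z : ℝ → H}, IntervalIntegrable z volume 0 ω →
      ‖I z‖ ≤ (A + A + B * ω) * ∫ s in (0 : ℝ)..ω, ‖z s‖ := by
    intro z hz
    have hz0 : 0 ≤ ∫ s in (0 : ℝ)..ω, ‖z s‖ :=
      intervalIntegral.integral_nonneg hω fun _ _ => norm_nonneg _
    have b1 : ‖∫ s in (0 : ℝ)..ω, u s • z s‖ ≤ A * ∫ s in (0 : ℝ)..ω, ‖z s‖ := by
      refine (intervalIntegral.norm_integral_le_integral_norm hω).trans ?_
      rw [← intervalIntegral.integral_const_mul]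
      refine intervalIntegral.integral_mono_on hω (hz.continuousOn_smul huc.continuousOn).norm
        (hz.norm.const_mul _) fun s hs => ?_
      rw [norm_smul]
      exact mul_le_mul_of_nonneg_right (hA s hs) (norm_nonneg _)
    have b2 : ‖u ω • ∫ s in (0 : ℝ)..ω, z s‖ ≤ A * ∫ s in (0 : ℝ)..ω, ‖z s‖ := by
      rw [norm_smul]
      exact mul_le_mul (hA ω ⟨hω, le_rfl⟩)
        (intervalIntegral.norm_integral_le_integral_norm hω) (norm_nonneg _) hA0
    have b3 : ‖∫ s in (0 : ℝ)..ω, u' s • ∫ τ in (0 : ℝ)..s, z τ‖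
        ≤ B * ω * ∫ s in (0 : ℝ)..ω, ‖z s‖ := by
      have h1 := intervalIntegral.norm_integral_le_of_norm_le_const
        (a := 0) (b := ω) (C := B * ∫ s in (0 : ℝ)..ω, ‖z s‖)
        (f := fun s => u' s • ∫ τ in (0 : ℝ)..s, z τ) fun s hs => by
          rw [Set.uIoc_of_le hω] at hs
          have hs' : s ∈ Set.Icc 0 ω := ⟨hs.1.le, hs.2⟩
          rw [norm_smul]
          refine mul_le_mul (hB s hs') ?_ (norm_nonneg _) hB0
          refine (intervalIntegral.norm_integral_le_integral_norm hs'.1).trans ?_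
          exact intervalIntegral.integral_mono_interval le_rfl hs'.1 hs'.2
            (Eventually.of_forall fun _ => norm_nonneg _) hz.norm
      rw [sub_zero, abs_of_nonneg hω] at h1
      linarith
    calc ‖I z‖ ≤ _ := (norm_add_le _ _).trans (add_le_add (norm_sub_le _ _) le_rfl)
      _ ≤ _ := add_le_add (add_le_add b1 b2) b3
      _ = _ := by ring
  have hCpos : 0 ≤ A + A + B * ω := by positivity
  refine norm_le_zero_iff.1 (le_of_forall_pos_le_add fun ε hε => ?_)
  rw [zero_add]
  have hyI : Integrable y (volume.restrict (Set.Ioc 0 ω)) :=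
    (intervalIntegrable_iff_integrableOn_Ioc_of_le hω).1 hy
  obtain ⟨g, -, hg1, hg2, -⟩ := hyI.exists_hasCompactSupport_integral_sub_le
    (ε := ε / (A + A + B * ω + 1)) (by positivity)
  have h1 : I y = I fun s => y s - g s := by
    rw [hIsub hy (hg2.intervalIntegrable _ _), hIcont hg2, sub_zero]
  rw [h1]
  refine (hIbound (hy.sub (hg2.intervalIntegrable _ _))).trans ?_
  rw [intervalIntegral.integral_of_le hω]
  refine (mul_le_mul_of_nonneg_left hg1 hCpos).trans ?_
  rw [mul_div_assoc', div_le_iff₀ (by positivity)]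
  nlinarith

/-- Integration by parts: the boundary term vanishes because `y` has mean zero, and the constant `c`
only contributes to `n = 0`, where the eigenvalue is zero. -/
theorem coeff_of_primitive {x y : L2 ω H} {c : H}
    (hx : (x : ℝ → H) =ᵐ[meanMeasure ω] fun s => c + ∫ τ in (0 : ℝ)..s, y τ)
    (hy : ∫ τ in (0 : ℝ)..ω, y τ = 0) (n : ℤ) :
    coeff ω H n y = freq ω n • coeff ω H n x := by
  have hω : 0 < ω := Fact.out
  have hyi : IntervalIntegrable (y : ℝ → H) volume 0 ω :=
    intervalIntegrable_L2 ω H y ⟨hω.le, le_rfl⟩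
  have hpart := integral_smul_eq_sub ω hω.le (hasDerivAt_expMode ω (-n))
    (by have := continuous_expMode ω (-n); fun_prop) hyi
  rw [hy, smul_zero, zero_sub] at hpart
  have hcont : ContinuousOn (fun s => ∫ τ in (0 : ℝ)..s, y τ) (Set.uIcc 0 ω) :=
    intervalIntegral.continuousOn_primitive_interval' hyi Set.left_mem_uIcc
  have e1 : coeff ω H n x = (∫ s, expMode ω (-n) s ∂(meanMeasure ω)) • c
      + ω⁻¹ • ∫ s in (0 : ℝ)..ω, expMode ω (-n) s • ∫ τ in (0 : ℝ)..s, y τ := by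
    have h1 : coeff ω H n x = ∫ s, expMode ω (-n) s • (c + ∫ τ in (0 : ℝ)..s, y τ)
        ∂(meanMeasure ω) := by
      rw [coeff_apply]
      refine integral_congr_ae ?_
      filter_upwards [hx] with s hs
      rw [hs]
    rw [h1, integral_meanMeasure, integral_meanMeasure]
    simp only [smul_add]
    rw [intervalIntegral.integral_add, smul_add, intervalIntegral.integral_smul_const, smul_assoc]
    · exact ((continuous_expMode ω (-n)).smul continuous_const).intervalIntegrable _ _
    · exact ((continuous_expMode ω (-n)).continuousOn.smul hcont).intervalIntegrable
  have e2 : freq ω n • (∫ s, expMode ω (-n) s ∂(meanMeasure ω)) = 0 := by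
    rw [integral_expMode]
    split_ifs with h
    · simp [freq, neg_eq_zero.1 h]
    · simp
  rw [e1, smul_add, ← smul_assoc, e2, zero_smul, zero_add, coeff_apply, integral_meanMeasure,
    hpart, smul_comm (freq ω n)]
  congr 1
  simp only [mul_smul]
  rw [intervalIntegral.integral_smul, freq_neg, neg_smul, neg_neg]

/-- For the converse, the relation at `n = 0` says that `y` has mean zero, so its primitive is
periodic. The primitive and `x` have equal coefficients for `n ≠ 0` and thus differ by a constant.
-/
theorem mem_derivGraph_iff (x y : L2 ω H) :
    (x, y) ∈ derivGraph ω H ↔ ∀ n, coeff ω H n y = freq ω n • coeff ω H n x := by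
  have hω : 0 < ω := Fact.out
  have hmem : ω ∈ Set.Icc 0 ω := ⟨hω.le, le_rfl⟩
  constructor
  · rintro ⟨f, hf1, hf2, hf3⟩ n
    refine coeff_of_primitive ω (c := f 0) ?_ ?_ n
    · refine hf1.trans ((ae_meanMeasure_iff ω).2 ?_)
      filter_upwards [ae_restrict_mem measurableSet_Icc] with s hs
      exact hf2 s hs
    · have := hf2 ω hmem
      rw [← hf3] at this
      exact left_eq_add.1 this
  · intro h
    have hyi : IntervalIntegrable (y : ℝ → H) volume 0 ω := intervalIntegrable_L2 ω H y hmem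
    have hy0 : ∫ τ in (0 : ℝ)..ω, y τ = 0 := by
      have h0 := h 0
      rw [coeff_apply, integral_meanMeasure] at h0
      simpa [freq, expMode_zero_left, hω.ne'] using h0
    have hcont : ContinuousOn (fun s => ∫ τ in (0 : ℝ)..s, y τ) (Set.Icc 0 ω) := by
      have := intervalIntegral.continuousOn_primitive_interval' hyi Set.left_mem_uIcc
      rwa [Set.uIcc_of_le hω.le] at this
    obtain ⟨C, hC⟩ := isCompact_Icc.exists_bound_of_continuousOn hcont
    have hmeas : AEStronglyMeasurable (fun s => ∫ τ in (0 : ℝ)..s, y τ) (meanMeasure ω) :=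
      (hcont.aestronglyMeasurable measurableSet_Icc).smul_measure _
    have hLp : MemLp (fun s => ∫ τ in (0 : ℝ)..s, y τ) 2 (meanMeasure ω) :=
      MemLp.of_bound hmeas C ((ae_meanMeasure_iff ω).2 (by
        filter_upwards [ae_restrict_mem measurableSet_Icc] with s hs
        exact hC s hs))
    have hz := coeff_of_primitive ω (x := hLp.toLp _) (y := y) (c := 0)
      (by
        filter_upwards [hLp.coeFn_toLp] with s hs
        rw [hs, zero_add]) hy0
    set z := hLp.toLp _ with hzdef
    set c := coeff ω H 0 (x - z) with hc
    have hxz : x = z + mode ω H 0 c := by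
      rw [← sub_eq_zero]
      refine eq_zero_of_coeff_eq_zero ω fun n => ?_
      have h1 : x - (z + mode ω H 0 c) = (x - z) - mode ω H 0 c := by abel
      rw [h1, map_sub, coeff_mode]
      by_cases hn : n = 0
      · simp [hn, hc]
      · rw [if_neg hn, sub_zero, map_sub, sub_eq_zero]
        have hf : freq ω n ≠ 0 := by
          have h1 : (ω : ℂ) ≠ 0 := by exact_mod_cast hω.ne'
          have h2 : (n : ℂ) ≠ 0 := by exact_mod_cast hn
          have h3 : (Real.pi : ℂ) ≠ 0 := by exact_mod_cast Real.pi_ne_zero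
          simp [freq, h1, h2, h3]
        exact smul_right_injective H hf ((h n).symm.trans (hz n))
    refine ⟨fun s => c + ∫ τ in (0 : ℝ)..s, y τ, ?_, fun s hs => by simp, ?_⟩
    · change (x : ℝ → H) =ᵐ[meanMeasure ω] _
      rw [hxz]
      filter_upwards [Lp.coeFn_add z (mode ω H 0 c), hLp.coeFn_toLp, coeFn_mode ω 0 c]
        with s h1 h2 h3
      rw [h1, Pi.add_apply, h2, h3, expMode_zero_left, one_smul, add_comm]
    · simp [hy0]

end FourierSeries

/-! ### The perturbation in Fourier coordinates -/

section Perturbation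

variable {ω : ℝ} [Fact (0 < ω)]
variable {H : Type*} [NormedAddCommGroup H] [InnerProductSpace ℂ H] [CompleteSpace H]
variable {𝒱 : ℝ → H →L[ℂ] H} (h𝒱 : ∀ x : H, MemLp (fun s => 𝒱 s x) 2 (meanMeasure ω))

/-- The operator `V` is closed on its natural domain. -/
theorem isClosed_perturbation_graph :
    IsClosed ((perturbation ω 𝒱).graph : Set (L2 ω H × L2 ω H)) := by
  refine IsSeqClosed.isClosed ?_
  rintro u ⟨y, z⟩ hu hlim
  have hy : Tendsto (fun n => (u n).1) atTop (𝓝 y) := (continuous_fst.tendsto _).comp hlim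
  have hz : Tendsto (fun n => (u n).2) atTop (𝓝 z) := (continuous_snd.tendsto _).comp hlim
  have hun : ∀ n, ((u n).2 : ℝ → H) =ᵐ[meanMeasure ω] fun s => 𝒱 s ((u n).1 (ω - s)) := by
    intro n
    obtain ⟨w, hw1, hw2⟩ := (LinearPMap.mem_graph_iff _).1 (hu n)
    rw [← hw2, ← hw1]
    exact MemLp.coeFn_toLp w.2
  -- Almost everywhere convergence of both components holds along a subsequence of a subsequence;
  -- the reflected null sets stay null, and continuity of each `𝒱 s` concludes.
  obtain ⟨ns, hns, h1⟩ := (tendstoInMeasure_of_tendsto_Lp hy).exists_seq_tendsto_ae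
  obtain ⟨ms, hms, h2⟩ := (tendstoInMeasure_of_tendsto_Lp
    (hz.comp hns.tendsto_atTop)).exists_seq_tendsto_ae
  have h1' := (measurePreserving_reflect ω).quasiMeasurePreserving.ae h1
  have hzy : (z : ℝ → H) =ᵐ[meanMeasure ω] fun s => 𝒱 s (y (ω - s)) := by
    filter_upwards [h1', h2, ae_all_iff.2 hun] with s h3 h4 h5
    refine tendsto_nhds_unique h4 ?_
    have h6 := (((𝒱 s).continuous.tendsto _).comp h3).comp hms.tendsto_atTop
    refine h6.congr fun n => ?_
    exact (h5 (ns (ms n))).symm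
  have hmem : MemLp (fun s => 𝒱 s (y (ω - s))) 2 (meanMeasure ω) := (Lp.memLp z).ae_eq hzy
  refine (LinearPMap.mem_graph_iff _).2 ⟨⟨y, hmem⟩, rfl, Lp.ext ?_⟩
  exact (MemLp.coeFn_toLp hmem).trans hzy.symm

omit [Fact (0 < ω)] [CompleteSpace H] in
include h𝒱 in
theorem memLp_perturbationMode (n : ℤ) (h : H) :
    MemLp (fun s => expMode ω (-n) s • 𝒱 s h) 2 (meanMeasure ω) :=
  (h𝒱 h).of_le ((continuous_expMode ω (-n)).aestronglyMeasurable.smul (h𝒱 h).1)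
    (Eventually.of_forall fun s => by rw [norm_smul, norm_expMode, one_mul])

/-- The function `s ↦ e^{λ_{-n} s} 𝒱(s) h`, which is `V (e^{λ_n ·} h)`. -/
def perturbationMode (n : ℤ) (h : H) : L2 ω H := (memLp_perturbationMode h𝒱 n h).toLp _

theorem coeFn_perturbationMode (n : ℤ) (h : H) :
    (perturbationMode h𝒱 n h : ℝ → H) =ᵐ[meanMeasure ω] fun s => expMode ω (-n) s • 𝒱 s h :=
  MemLp.coeFn_toLp _

/-- Periodicity gives `e^{λ_n (ω - s)} = e^{-λ_n s}`, so modes are in the domain of `V` even though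
`V` may be unbounded. -/
theorem mode_mem_graph (n : ℤ) (h : H) :
    (mode ω H n h, perturbationMode h𝒱 n h) ∈ (perturbation ω 𝒱).graph := by
  have hae : (perturbationMode h𝒱 n h : ℝ → H) =ᵐ[meanMeasure ω]
      fun s => 𝒱 s (mode ω H n h (ω - s)) := by
    filter_upwards [coeFn_perturbationMode h𝒱 n h,
      (measurePreserving_reflect ω).quasiMeasurePreserving.ae (coeFn_mode ω n h)] with s h1 h2
    rw [h1, h2, expMode_reflect, map_smul]
  have hmem : MemLp (fun s => 𝒱 s (mode ω H n h (ω - s))) 2 (meanMeasure ω) :=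
    (Lp.memLp _).ae_eq hae
  refine (LinearPMap.mem_graph_iff _).2 ⟨⟨mode ω H n h, hmem⟩, rfl, Lp.ext ?_⟩
  exact (MemLp.coeFn_toLp hmem).trans hae.symm

theorem norm_perturbationMode_le (n : ℤ) (h : H) :
    ‖perturbationMode h𝒱 n h‖ ≤ ‖potentialMap ω 𝒱 h𝒱‖ * ‖h‖ := by
  refine le_trans (le_of_eq ?_) ((potentialMap ω 𝒱 h𝒱).le_opNorm h)
  rw [Lp.norm_def, Lp.norm_def]
  congr 1
  refine eLpNorm_congr_norm_ae ?_
  have h2 : (potentialMap ω 𝒱 h𝒱 h : ℝ → H) =ᵐ[meanMeasure ω] fun s => 𝒱 s h :=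
    (h𝒱 h).coeFn_toLp
  filter_upwards [coeFn_perturbationMode h𝒱 n h, h2] with s h1 h2
  rw [h1, h2, norm_smul, norm_expMode, one_mul]

/-- The reflection turns the Toeplitz structure of multiplication by `𝒱` into a Hankel one: the
index is a sum, not a difference. -/
theorem coeff_perturbationMode (j n : ℤ) (h : H) :
    coeff ω H j (perturbationMode h𝒱 n h) = potentialCoeff ω 𝒱 h𝒱 (j + n) h := by
  have h0 : potentialCoeff ω 𝒱 h𝒱 (j + n) h
      = coeff ω H (j + n) (potentialMap ω 𝒱 h𝒱 h) := rfl
  rw [h0, coeff_apply, coeff_apply]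
  refine integral_congr_ae ?_
  have h2 : (potentialMap ω 𝒱 h𝒱 h : ℝ → H) =ᵐ[meanMeasure ω] fun s => 𝒱 s h :=
    (h𝒱 h).coeFn_toLp
  filter_upwards [coeFn_perturbationMode h𝒱 n h, h2] with s h1 h2
  rw [h1, h2, smul_smul, expMode_mul, neg_add]

theorem norm_coeff_le_one (n : ℤ) : ‖coeff ω H n‖ ≤ 1 := by
  unfold coeff
  exact LinearMap.mkContinuous_norm_le _ zero_le_one _

/-- The operator with a single block `T : H → H` in position `(j, l)`. -/
def modeBlock (ω : ℝ) [Fact (0 < ω)] (j l : ℤ) (T : H →L[ℂ] H) : L2 ω H →L[ℂ] L2 ω H :=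
  mode ω H j ∘L T ∘L coeff ω H l

theorem modeBlock_apply (j l : ℤ) (T : H →L[ℂ] H) (x : L2 ω H) :
    modeBlock ω j l T x = mode ω H j (T (coeff ω H l x)) := rfl

theorem norm_modeBlock_le (j l : ℤ) (T : H →L[ℂ] H) : ‖modeBlock ω j l T‖ ≤ ‖T‖ := by
  refine ContinuousLinearMap.opNorm_le_bound _ (norm_nonneg _) fun x => ?_
  rw [modeBlock_apply, norm_mode]
  refine (T.le_opNorm _).trans (mul_le_mul_of_nonneg_left ?_ (norm_nonneg _))
  simpa using (coeff ω H l).le_of_opNorm_le (norm_coeff_le_one l) x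

theorem proj_mul_modeBlock_mul_proj (j l : ℤ) (T : H →L[ℂ] H) :
    proj ω H j * modeBlock ω j l T * proj ω H l = modeBlock ω j l T := by
  ext1 x
  change proj ω H j (modeBlock ω j l T (proj ω H l x)) = _
  rw [modeBlock_apply, coeff_proj, if_pos rfl, proj_apply, coeff_mode, if_pos rfl]
  rfl

theorem summable_sq_sum {ι κ : Type*} {f : κ → ι → ℝ} (s : Finset κ) (hf0 : ∀ k i, 0 ≤ f k i)
    (hf : ∀ k ∈ s, Summable fun i => f k i ^ 2) : Summable fun i => (∑ k ∈ s, f k i) ^ 2 := by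
  classical
  induction s using Finset.induction_on with
  | empty => simp
  | insert a s ha ih =>
    simp only [Finset.sum_insert ha]
    exact (summable_sq_add (hf0 a) (fun i => Finset.sum_nonneg fun k _ => hf0 k i)
      (hf a (Finset.mem_insert_self _ _))
      (ih fun k hk => hf k (Finset.mem_insert_of_mem hk))).1

theorem exists_modeBlock_sum [Nontrivial H] {T : ℤ → ℤ → H →L[ℂ] H}
    (hT : Summable fun p : ℤ × ℤ => ‖T p.1 p.2‖ ^ 2) :
    ∃ Y : L2 ω H →L[ℂ] L2 ω H, (∀ j l, proj ω H j * Y * proj ω H l = modeBlock ω j l (T j l)) ∧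
      MemHS (proj ω H) Y := by
  have hle : ∀ p : ℤ × ℤ, ‖modeBlock ω p.1 p.2 (T p.1 p.2)‖ ^ 2 ≤ ‖T p.1 p.2‖ ^ 2 := fun p =>
    pow_le_pow_left₀ (norm_nonneg _) (norm_modeBlock_le _ _ _) 2
  have hs := Summable.of_nonneg_of_le (fun _ => sq_nonneg _) hle hT
  obtain ⟨Y, hY⟩ := exists_of_blocks (isResolutionOfIdentity_proj ω (H := H))
    (A := fun p => modeBlock ω p.1 p.2 (T p.1 p.2))
    (fun p => proj_mul_modeBlock_mul_proj _ _ _) hs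
  refine ⟨Y, hY, ?_⟩
  simpa only [MemHS, hY] using hs

/-- Common source of `J_m V` and `Γ_m V`: the ranges of `P_l` lie in the domain of `V`, and square
summability of the weighted Hankel blocks produces the operator. -/
theorem perturbation_block_multiplier [Nontrivial H] {c : ℤ → ℤ → ℂ}
    (hc : Summable fun p : ℤ × ℤ => (‖c p.1 p.2‖ * ‖potentialCoeff ω 𝒱 h𝒱 (p.1 + p.2)‖) ^ 2) :
    IsBlockMultiplier (proj ω H) c (perturbation ω 𝒱)
        (blockMultiplier (proj ω H) c (perturbation ω 𝒱)) ∧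
      MemHS (proj ω H) (blockMultiplier (proj ω H) c (perturbation ω 𝒱)) ∧
      ∀ j l, proj ω H j * blockMultiplier (proj ω H) c (perturbation ω 𝒱) * proj ω H l =
        modeBlock ω j l (c j l • potentialCoeff ω 𝒱 h𝒱 (j + l)) := by
  have key : ∀ l (x : L2 ω H), ∃ hx : proj ω H l x ∈ (perturbation ω 𝒱).domain,
      ∀ j, proj ω H j (perturbation ω 𝒱 ⟨proj ω H l x, hx⟩)
        = modeBlock ω j l (potentialCoeff ω 𝒱 h𝒱 (j + l)) x := by
    intro l x
    obtain ⟨w, hw1, hw2⟩ :=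
      (LinearPMap.mem_graph_iff _).1 (mode_mem_graph h𝒱 l (coeff ω H l x))
    have hw1' : (w : L2 ω H) = proj ω H l x := hw1
    refine ⟨hw1' ▸ w.2, fun j => ?_⟩
    have hw3 : (⟨proj ω H l x, hw1' ▸ w.2⟩ : (perturbation ω 𝒱).domain) = w :=
      Subtype.ext hw1'.symm
    rw [hw3, hw2, proj_apply, coeff_perturbationMode, modeBlock_apply]
  obtain ⟨Y, hY, hYm⟩ := exists_modeBlock_sum (ω := ω)
    (T := fun j l => c j l • potentialCoeff ω 𝒱 h𝒱 (j + l)) (by simpa only [norm_smul] using hc)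
  have hex : ∃ Y, IsBlockMultiplier (proj ω H) c (perturbation ω 𝒱) Y := by
    refine ⟨Y, fun l x => ?_⟩
    obtain ⟨hx, hk⟩ := key l x
    refine ⟨hx, fun j => ?_⟩
    rw [hk]
    have := congrArg (fun T : L2 ω H →L[ℂ] L2 ω H => T x) (hY j l)
    refine this.trans ?_
    simp [modeBlock_apply]
  have hspec : IsBlockMultiplier (proj ω H) c (perturbation ω 𝒱)
      (blockMultiplier (proj ω H) c (perturbation ω 𝒱)) := by
    rw [blockMultiplier, dif_pos hex]
    exact hex.choose_spec
  have hblk : ∀ j l, proj ω H j * blockMultiplier (proj ω H) c (perturbation ω 𝒱) * proj ω H l =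
      modeBlock ω j l (c j l • potentialCoeff ω 𝒱 h𝒱 (j + l)) := fun j l => by
    ext1 x
    obtain ⟨hx, hk⟩ := key l x
    refine ((hspec l x).2 j).trans ?_
    rw [hk]
    simp [modeBlock_apply]
  refine ⟨hspec, ?_, hblk⟩
  simp only [MemHS, hblk, ← hY]
  exact hYm

theorem summable_inv_sq_int : Summable fun d : ℤ => (|(d : ℝ)|⁻¹) ^ 2 := by
  have h := Real.summable_one_div_int_pow.2 (by norm_num : 1 < 2)
  refine h.congr fun d => ?_
  rw [one_div, inv_pow, sq_abs]

theorem norm_weightΓ_le_inv (hω : 0 < ω) (m : ℕ) (j l : ℤ) :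
    ‖weightΓ ω m j l‖ ≤ ω / (2 * Real.pi) * |((j - l : ℤ) : ℝ)|⁻¹ := by
  unfold weightΓ
  split_ifs
  · rw [norm_inv_freq_sub hω, div_eq_mul_inv _ |_|]
    push_cast
    rfl
  · rw [norm_zero]
    positivity

/-- In the injective coordinates `(j + l, j - l)` the double sum is dominated by `∑ v_n²` times `∑
d⁻²`. The term `d = 0` is zero by convention, as is the weight on the diagonal. -/
theorem summable_weightΓ_mul (hω : 0 < ω) (m : ℕ) {v : ℤ → ℝ} (hv : Summable fun n => v n ^ 2) :
    Summable fun p : ℤ × ℤ => (‖weightΓ ω m p.1 p.2‖ * v (p.1 + p.2)) ^ 2 := by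
  have h1 : Summable fun q : ℤ × ℤ => v q.1 ^ 2 * (|(q.2 : ℝ)|⁻¹) ^ 2 :=
    hv.mul_of_nonneg summable_inv_sq_int (fun _ => sq_nonneg _) fun _ => sq_nonneg _
  have hinj : Function.Injective fun p : ℤ × ℤ => (p.1 + p.2, p.1 - p.2) := by
    rintro ⟨a, b⟩ ⟨c, d⟩ h
    simp only [Prod.mk.injEq] at h ⊢
    omega
  refine Summable.of_nonneg_of_le (fun _ => sq_nonneg _) (fun p => ?_)
    ((h1.comp_injective hinj).mul_left ((ω / (2 * Real.pi)) ^ 2))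
  calc (‖weightΓ ω m p.1 p.2‖ * v (p.1 + p.2)) ^ 2
      = ‖weightΓ ω m p.1 p.2‖ ^ 2 * v (p.1 + p.2) ^ 2 := mul_pow _ _ _
    _ ≤ (ω / (2 * Real.pi) * |((p.1 - p.2 : ℤ) : ℝ)|⁻¹) ^ 2 * v (p.1 + p.2) ^ 2 :=
      mul_le_mul_of_nonneg_right
        (pow_le_pow_left₀ (norm_nonneg _) (norm_weightΓ_le_inv hω m _ _) 2) (sq_nonneg _)
    _ = _ := by
      simp only [Function.comp]
      ring

/-- The support of the weight is a finite square together with the diagonal, and `v (2 l)` is square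
summable along the latter. -/
theorem summable_weightJ_mul (m : ℕ) {v : ℤ → ℝ} (hv : Summable fun n => v n ^ 2) :
    Summable fun p : ℤ × ℤ => (‖weightJ m p.1 p.2‖ * v (p.1 + p.2)) ^ 2 := by
  classical
  have h1 : Summable fun p : ℤ × ℤ =>
      if |p.1| ≤ (m : ℤ) ∧ |p.2| ≤ (m : ℤ) then v (p.1 + p.2) ^ 2 else 0 := by
    refine summable_of_ne_finset_zero
      (s := Finset.Icc (-(m : ℤ)) m ×ˢ Finset.Icc (-(m : ℤ)) m) fun p hp => ?_
    rw [Finset.mem_product, Finset.mem_Icc, Finset.mem_Icc, ← abs_le, ← abs_le] at hp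
    rw [if_neg hp]
  have h2 : Summable fun p : ℤ × ℤ => if p.1 = p.2 then v (p.1 + p.2) ^ 2 else 0 := by
    have hi : Function.Injective fun l : ℤ => (l, l) := fun a b h => (Prod.mk.inj h).1
    refine (hi.summable_iff ?_).1 ?_
    · rintro ⟨a, b⟩ hp
      exact if_neg fun h => hp ⟨a, by simpa using h⟩
    · have : Function.Injective fun l : ℤ => l + l := fun a b h => by
        simp only at h
        omega
      refine (hv.comp_injective this).congr fun l => ?_
      simp
  refine Summable.of_nonneg_of_le (fun _ => sq_nonneg _) (fun p => ?_) (h1.add h2)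
  have hsq := sq_nonneg (v (p.1 + p.2))
  unfold weightJ
  by_cases h3 : |p.1| ≤ (m : ℤ) ∧ |p.2| ≤ (m : ℤ)
  · rw [if_pos h3, if_pos (Or.inl h3), norm_one, one_mul]
    refine le_add_of_nonneg_right ?_
    split_ifs
    exacts [hsq, le_rfl]
  · rw [if_neg h3, zero_add]
    by_cases h4 : p.1 = p.2
    · rw [if_pos h4, if_pos (Or.inr h4), norm_one, one_mul]
    · rw [if_neg h4, if_neg (not_or.2 ⟨h3, h4⟩), norm_zero, zero_mul]
      norm_num

/-! ### Existence of `V Γ_m V` -/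

variable (hcoeff : Summable fun n : ℤ => ‖potentialCoeff ω 𝒱 h𝒱 n‖ ^ 2)
include hcoeff

theorem summable_shift_sq (j : ℤ) : Summable fun n => ‖potentialCoeff ω 𝒱 h𝒱 (j + n)‖ ^ 2 :=
  hcoeff.comp_injective (add_right_injective j)

theorem summable_weight_product (w : ℤ → ℂ) {C : ℝ} (hw : ∀ n, ‖w n‖ ≤ C) (j l : ℤ) :
    Summable fun n => w n •
      (potentialCoeff ω 𝒱 h𝒱 (j + n) * potentialCoeff ω 𝒱 h𝒱 (l + n)) := by
  have h := summable_mul_of_sq (fun _ => norm_nonneg _) (fun _ => norm_nonneg _)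
    (summable_shift_sq h𝒱 hcoeff j) (summable_shift_sq h𝒱 hcoeff l)
  refine Summable.of_norm_bounded (h.mul_left C) fun n => ?_
  rw [norm_smul]
  exact mul_le_mul (hw n) (norm_mul_le _ _) (norm_nonneg _) ((norm_nonneg _).trans (hw n))

/-- The block matrix of `V Γ_m V` is square summable. -/
theorem summable_product_blocks (hprod : Summable fun p : ℤ × ℤ =>
      ‖∑' n : {n : ℤ // n ≠ p.2}, (1 / ((p.2 : ℂ) - (n : ℤ))) •
        (potentialCoeff ω 𝒱 h𝒱 (p.1 + n) * potentialCoeff ω 𝒱 h𝒱 (p.2 + n))‖ ^ 2) (m : ℕ) :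
    Summable fun p : ℤ × ℤ => ‖∑' n, weightΓ ω m n p.2 •
      (potentialCoeff ω 𝒱 h𝒱 (p.1 + n) * potentialCoeff ω 𝒱 h𝒱 (p.2 + n))‖ ^ 2 := by
  have hω : 0 < ω := Fact.out
  set v := potentialCoeff ω 𝒱 h𝒱 with hv
  set K : ℤ → ℤ → H →L[ℂ] H := fun j l =>
    ∑' n : ℤ, (1 / ((l : ℂ) - n)) • (v (j + n) * v (l + n)) with hK
  have hKeq : ∀ p : ℤ × ℤ, ∑' n : {n : ℤ // n ≠ p.2}, (1 / ((p.2 : ℂ) - (n : ℤ))) •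
      (v (p.1 + n) * v (p.2 + n)) = K p.1 p.2 := fun p => by
    refine tsum_subtype_eq_of_support_subset (s := {n : ℤ | n ≠ p.2})
      (f := fun n : ℤ => (1 / ((p.2 : ℂ) - n)) • (v (p.1 + n) * v (p.2 + n))) fun n hn => ?_
    rintro rfl
    simp at hn
  simp only [hKeq] at hprod
  set c₀ : ℂ := -(ω / (2 * Real.pi * Complex.I)) with hc₀
  have hfreq : ∀ n l : ℤ, 1 / (freq ω n - freq ω l) = c₀ * (1 / ((l : ℂ) - n)) := fun n l => by
    rw [freq_sub, hc₀, ← neg_sub (l : ℂ) n]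
    have h5 : (ω : ℂ) ≠ 0 := by exact_mod_cast hω.ne'
    have h6 : (Real.pi : ℂ) ≠ 0 := by exact_mod_cast Real.pi_ne_zero
    by_cases h : (l : ℂ) - n = 0
    · simp [h]
    · field_simp
  -- `d` corrects the full weight `1 / (λ_n - λ_l)` to that of `Γ_m`. It vanishes for `|n| > m`, and
  -- at `n = l` since `1 / 0 = 0`. Only finitely many products `v (j + n) * v (l + n)` remain, each
  -- square summable in `(j, l)`.
  set d : ℤ → ℤ → ℂ := fun n l => weightΓ ω m n l - 1 / (freq ω n - freq ω l) with hd
  set κ := ω / (2 * Real.pi) with hκ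
  have hκ0 : 0 ≤ κ := by positivity
  have hinv : ∀ n l, ‖1 / (freq ω n - freq ω l)‖ ≤ κ := fun n l => by
    by_cases h : n = l
    · simp [h, hκ0]
    · rw [norm_inv_freq_sub hω]
      exact div_le_self hκ0 (one_le_abs_sub h)
  have hdz : ∀ n l, n ∉ Finset.Icc (-(m : ℤ)) m → d n l = 0 := fun n l hn => by
    rw [Finset.mem_Icc, ← abs_le, not_le] at hn
    simp only [hd, weightΓ]
    by_cases h : n = l
    · simp [h]
    · rw [if_pos ⟨lt_max_of_lt_left hn, h⟩, sub_self]
  have hdz' : ∀ n l : ℤ, (m : ℤ) < |l| → d n l = 0 := fun n l hn => by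
    simp only [hd, weightΓ]
    by_cases h : n = l
    · simp [h]
    · rw [if_pos ⟨lt_max_of_lt_right hn, h⟩, sub_self]
  have hdle : ∀ n l, ‖d n l‖ ≤ 2 * κ := fun n l => by
    refine (norm_sub_le _ _).trans ?_
    linarith [norm_weightΓ_le hω m n l, hinv n l]
  have hsplit : ∀ j l, ∑' n, weightΓ ω m n l • (v (j + n) * v (l + n))
      = c₀ • K j l + ∑ n ∈ Finset.Icc (-(m : ℤ)) m, d n l • (v (j + n) * v (l + n)) := by
    intro j l
    have s1 := summable_weight_product h𝒱 hcoeff (fun n => 1 / (freq ω n - freq ω l))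
      (fun n => hinv n l) j l
    have s2 := summable_weight_product h𝒱 hcoeff (fun n => d n l) (fun n => hdle n l) j l
    have e1 : ∀ n, weightΓ ω m n l • (v (j + n) * v (l + n))
        = (1 / (freq ω n - freq ω l)) • (v (j + n) * v (l + n))
          + d n l • (v (j + n) * v (l + n)) := fun n => by
      rw [← add_smul]
      simp only [hd]
      congr 1
      ring
    rw [tsum_congr e1, s1.tsum_add s2]
    congr 1
    · simp only [hfreq, mul_smul, hK]
      rw [tsum_const_smul'' c₀]
    · exact tsum_eq_sum fun n hn => by rw [hdz n l hn, zero_smul]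
  have hbound : ∀ p : ℤ × ℤ, ‖∑' n, weightΓ ω m n p.2 • (v (p.1 + n) * v (p.2 + n))‖ ≤
      ‖c₀‖ * ‖K p.1 p.2‖ + ∑ n ∈ Finset.Icc (-(m : ℤ)) m,
        2 * κ * (‖v (n + p.1)‖ * ‖v (n + p.2)‖) := by
    intro p
    rw [hsplit]
    refine (norm_add_le _ _).trans (add_le_add (norm_smul_le _ _)
      ((norm_sum_le _ _).trans (Finset.sum_le_sum fun n _ => ?_)))
    rw [norm_smul, add_comm n, add_comm n]
    exact mul_le_mul (hdle _ _) (norm_mul_le _ _) (norm_nonneg _) (by positivity)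
  refine Summable.of_nonneg_of_le (fun _ => sq_nonneg _)
    (fun p => pow_le_pow_left₀ (norm_nonneg _) (hbound p) 2) ?_
  refine (summable_sq_add (fun _ => by positivity)
    (fun _ => Finset.sum_nonneg fun _ _ => by positivity) ?_ ?_).1
  · simp only [mul_pow]
    exact hprod.mul_left _
  · refine summable_sq_sum (f := fun n (p : ℤ × ℤ) => 2 * κ * (‖v (n + p.1)‖ * ‖v (n + p.2)‖))
      _ (fun _ _ => by positivity) fun n _ => ?_
    simp only [mul_pow]
    refine Summable.mul_left _ ?_
    have := summable_shift_sq h𝒱 hcoeff n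
    exact this.mul_of_nonneg this (fun _ => sq_nonneg _) fun _ => sq_nonneg _

end Perturbation

/-! ### `L₀`, `Γ_m V` and `V Γ_m V` on blocks; `Ṽ` in the Hilbert–Schmidt class. -/

section Extension

variable {ω : ℝ} [Fact (0 < ω)]
variable {H : Type*} [NormedAddCommGroup H] [InnerProductSpace ℂ H] [CompleteSpace H]

theorem mem_derivOp_domain {x : L2 ω H} :
    x ∈ (derivOp ω H).domain ↔ ∃ y, (x, y) ∈ derivGraph ω H := by
  rw [LinearPMap.mem_domain_iff, derivOp_graph]

theorem derivOp_eq {x y : L2 ω H} (h : (x, y) ∈ derivGraph ω H) (hx : x ∈ (derivOp ω H).domain) :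
    derivOp ω H ⟨x, hx⟩ = y := by
  rw [← derivOp_graph] at h
  obtain ⟨w, hw1, hw2⟩ := (LinearPMap.mem_graph_iff _).1 h
  have : (⟨x, hx⟩ : (derivOp ω H).domain) = w := Subtype.ext hw1.symm
  rw [this, hw2]

theorem mem_derivGraph_iff_proj (x y : L2 ω H) :
    (x, y) ∈ derivGraph ω H ↔ ∀ n, proj ω H n y = freq ω n • proj ω H n x := by
  rw [mem_derivGraph_iff]
  refine forall_congr' fun n => ⟨fun h => ?_, fun h => ?_⟩
  · rw [proj_apply, h, map_smul, proj_apply]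
  · have := congrArg (coeff ω H n) h
    rwa [map_smul, coeff_proj, coeff_proj, if_pos rfl, if_pos rfl] at this

theorem proj_mem_derivOp_domain (l : ℤ) (x : L2 ω H) :
    proj ω H l x ∈ (derivOp ω H).domain := by
  refine mem_derivOp_domain.2 ⟨freq ω l • proj ω H l x, (mem_derivGraph_iff _ _ _).2 fun n => ?_⟩
  rw [map_smul, coeff_proj]
  split_ifs with h
  · rw [h]
  · simp

variable [Nontrivial H] {𝒱 : ℝ → H →L[ℂ] H}
  (h𝒱 : ∀ x : H, MemLp (fun s => 𝒱 s x) 2 (meanMeasure ω))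
  (hcoeff : Summable fun n : ℤ => ‖potentialCoeff ω 𝒱 h𝒱 n‖ ^ 2)
include hcoeff

theorem ΓV_spec (m : ℕ) :
    IsBlockMultiplier (proj ω H) (weightΓ ω m) (perturbation ω 𝒱) (ΓV ω 𝒱 m) ∧
      MemHS (proj ω H) (ΓV ω 𝒱 m) ∧ ∀ j l, proj ω H j * ΓV ω 𝒱 m * proj ω H l =
        modeBlock ω j l (weightΓ ω m j l • potentialCoeff ω 𝒱 h𝒱 (j + l)) :=
  perturbation_block_multiplier h𝒱 (summable_weightΓ_mul (v := fun n => ‖potentialCoeff ω 𝒱 h𝒱 n‖)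
    (Fact.out : 0 < ω) m hcoeff)

theorem JV_spec (m : ℕ) :
    IsBlockMultiplier (proj ω H) (weightJ m) (perturbation ω 𝒱) (JV ω 𝒱 m) ∧
      MemHS (proj ω H) (JV ω 𝒱 m) :=
  have h := perturbation_block_multiplier h𝒱
    (summable_weightJ_mul (v := fun n => ‖potentialCoeff ω 𝒱 h𝒱 n‖) m hcoeff)
  ⟨h.1, h.2.1⟩

/-- A product of two square summable sequences is summable. Summability of the norms, not only of
their squares, allows `V` to be applied to `Γ_m V P_l x` mode by mode. -/
theorem summable_weightΓ_potentialCoeff (m : ℕ) (l : ℤ) (h : H) :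
    Summable fun n => ‖(weightΓ ω m n l • potentialCoeff ω 𝒱 h𝒱 (l + n)) h‖ := by
  have hω : 0 < ω := Fact.out
  have h1 : Summable fun n : ℤ => ‖weightΓ ω m n l‖ ^ 2 := by
    have hi : Function.Injective fun n : ℤ => n - l := sub_left_injective
    refine Summable.of_nonneg_of_le (fun _ => sq_nonneg _) (fun n => ?_)
      ((summable_inv_sq_int.comp_injective hi).mul_left ((ω / (2 * Real.pi)) ^ 2))
    simp only [Function.comp]
    rw [← mul_pow]
    exact pow_le_pow_left₀ (norm_nonneg _) (norm_weightΓ_le_inv hω m n l) 2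
  have h2 := summable_mul_of_sq (fun _ => norm_nonneg _) (fun _ => norm_nonneg _) h1
    (summable_shift_sq h𝒱 hcoeff l)
  refine Summable.of_nonneg_of_le (fun _ => norm_nonneg _) (fun n => ?_) (h2.mul_right ‖h‖)
  rw [← norm_smul]
  exact ContinuousLinearMap.le_opNorm _ _

variable (hprod : Summable fun p : ℤ × ℤ =>
      ‖∑' n : {n : ℤ // n ≠ p.2}, (1 / ((p.2 : ℂ) - (n : ℤ))) •
        (potentialCoeff ω 𝒱 h𝒱 (p.1 + n) * potentialCoeff ω 𝒱 h𝒱 (p.2 + n))‖ ^ 2)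
include hprod

/-- `V` need not commute with infinite sums, but it is closed and the images `V (e^{λ_n ·} a_n)`
have norm at most a constant times `‖a_n‖`. The graph of `V` therefore contains `(Γ_m V P_l x, Y P_l
x)`, where `Y` has the expected block matrix. -/
theorem VΓV_spec (m : ℕ) :
    IsCompExtension (perturbation ω 𝒱) (derivOp ω H).domain (ΓV ω 𝒱 m) (VΓV ω 𝒱 m) ∧
      MemHS (proj ω H) (VΓV ω 𝒱 m) := by
  have hP := isResolutionOfIdentity_proj ω (H := H)
  have hω : 0 < ω := Fact.out
  obtain ⟨-, -, hG⟩ := ΓV_spec h𝒱 hcoeff m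
  set v := potentialCoeff ω 𝒱 h𝒱 with hv
  obtain ⟨Y, hY, hYm⟩ := exists_modeBlock_sum (ω := ω)
    (T := fun j l => ∑' n, weightΓ ω m n l • (v (j + n) * v (l + n)))
    (summable_product_blocks h𝒱 hcoeff hprod m)
  have hblock : ∀ l x, (ΓV ω 𝒱 m (proj ω H l x), Y (proj ω H l x))
      ∈ (perturbation ω 𝒱).graph := by
    intro l x
    set h := coeff ω H l x with hh
    set a : ℤ → H := fun n => (weightΓ ω m n l • v (l + n)) h with ha
    have hsa : Summable fun n => ‖a n‖ := summable_weightΓ_potentialCoeff h𝒱 hcoeff m l h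
    have h1 : HasSum (fun n => mode ω H n (a n)) (ΓV ω 𝒱 m (proj ω H l x)) := by
      have h2 : ∀ n, mode ω H n (a n) = proj ω H n (ΓV ω 𝒱 m (proj ω H l x)) := fun n => by
        have := congrArg (fun T : L2 ω H →L[ℂ] L2 ω H => T x) (hG n l)
        simp only [modeBlock_apply] at this
        rw [add_comm n l] at this
        exact this.symm
      simp only [h2]
      exact hP.hasSum _
    have hsv : Summable fun n => perturbationMode h𝒱 n (a n) :=
      Summable.of_norm_bounded (hsa.mul_left _) fun n => norm_perturbationMode_le h𝒱 n (a n)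
    have hz : ∑' n, perturbationMode h𝒱 n (a n) = Y (proj ω H l x) := by
      rw [← sub_eq_zero]
      refine eq_zero_of_coeff_eq_zero ω fun j => ?_
      rw [map_sub, sub_eq_zero, (coeff ω H j).map_tsum hsv]
      have hs := summable_weight_product h𝒱 hcoeff (fun n => weightΓ ω m n l)
        (fun n => norm_weightΓ_le hω m n l) j l
      have h3 := (hs.hasSum.mapL (ContinuousLinearMap.apply ℂ H h)).tsum_eq
      have h4 : coeff ω H j (Y (proj ω H l x))
          = (∑' n, weightΓ ω m n l • (v (j + n) * v (l + n))) h := by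
        have := congrArg (fun T : L2 ω H →L[ℂ] L2 ω H => coeff ω H j (T x)) (hY j l)
        simp only [modeBlock_apply, coeff_mode, if_pos] at this
        rw [← this]
        change _ = coeff ω H j (proj ω H j (Y (proj ω H l x)))
        rw [coeff_proj, if_pos rfl]
      rw [h4]
      refine Eq.trans (tsum_congr fun n => ?_) h3
      rw [coeff_perturbationMode]
      simp [ha, hv]
    have h5 := h1.prodMk (hz ▸ hsv.hasSum)
    refine isClosed_perturbation_graph.mem_of_tendsto h5 (Eventually.of_forall fun s => ?_)
    exact sum_mem fun n _ => mode_mem_graph h𝒱 n (a n)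
  -- Closedness a second time, now for `x = ∑ P_l x`: `Γ_m V` maps the whole space, not just
  -- `D(L₀)`, into the domain of `V`.
  have hall : ∀ x, (ΓV ω 𝒱 m x, Y x) ∈ (perturbation ω 𝒱).graph := by
    intro x
    have h5 := ((hP.hasSum x).mapL (ΓV ω 𝒱 m)).prodMk ((hP.hasSum x).mapL Y)
    exact isClosed_perturbation_graph.mem_of_tendsto h5
      (Eventually.of_forall fun s => sum_mem fun n _ => hblock n x)
  have hYext : IsCompExtension (perturbation ω 𝒱) (derivOp ω H).domain (ΓV ω 𝒱 m) Y := by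
    intro x _
    obtain ⟨w, hw1, hw2⟩ := (LinearPMap.mem_graph_iff _).1 (hall x)
    have hw1' : (w : L2 ω H) = ΓV ω 𝒱 m x := hw1
    refine ⟨hw1' ▸ w.2, ?_⟩
    have hw3 : (⟨ΓV ω 𝒱 m x, hw1' ▸ w.2⟩ : (perturbation ω 𝒱).domain) = w :=
      Subtype.ext hw1'.symm
    rw [hw3, hw2]
  have hex : ∃ Y, IsCompExtension (perturbation ω 𝒱) (derivOp ω H).domain (ΓV ω 𝒱 m) Y :=
    ⟨Y, hYext⟩
  have hspec : IsCompExtension (perturbation ω 𝒱) (derivOp ω H).domain (ΓV ω 𝒱 m)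
      (VΓV ω 𝒱 m) := by
    rw [VΓV, compExtension, dif_pos hex]
    exact hex.choose_spec
  refine ⟨hspec, ?_⟩
  -- The chosen extension agrees with `Y` on `D(L₀)`, which contains all ranges of `P_l`.
  have heq : VΓV ω 𝒱 m = Y := hP.ext_blocks fun j l => by
    ext1 x
    change proj ω H j (VΓV ω 𝒱 m (proj ω H l x)) = proj ω H j (Y (proj ω H l x))
    obtain ⟨h1, h2⟩ := hspec _ (proj_mem_derivOp_domain l x)
    obtain ⟨h3, h4⟩ := hYext _ (proj_mem_derivOp_domain l x)
    rw [h2, h4]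
  rw [heq]
  exact hYm

/-- Writing the inverse as `I` plus an element of `𝔖₂` leaves only sums and products inside `𝔖₂`. -/
theorem memHS_tildeV (m : ℕ) (hm : IsUnit (1 + ΓV ω 𝒱 m)) :
    MemHS (proj ω H) (tildeV ω 𝒱 m) := by
  have hP := isResolutionOfIdentity_proj ω (H := H)
  have hG := (ΓV_spec h𝒱 hcoeff m).2.1
  have hJ := (JV_spec h𝒱 hcoeff m).2
  have hT := ((VΓV_spec h𝒱 hcoeff hprod m).2.sub (hG.mul hP hJ).1).1
  have hZ := hG.inverse_sub_one hP hm
  have : tildeV ω 𝒱 m = JV ω 𝒱 m + ((VΓV ω 𝒱 m - ΓV ω 𝒱 m * JV ω 𝒱 m)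
      + (Ring.inverse (1 + ΓV ω 𝒱 m) - 1) * (VΓV ω 𝒱 m - ΓV ω 𝒱 m * JV ω 𝒱 m)) := by
    rw [tildeV, sub_mul (Ring.inverse _), one_mul, add_sub_cancel]
  rw [this]
  exact (hJ.add (hT.add (hZ.mul hP hT).1).1).1

end Extension

/-! ### Similarity -/

section Similarity

variable {ω : ℝ} [Fact (0 < ω)]
variable {H : Type*} [NormedAddCommGroup H] [InnerProductSpace ℂ H] [CompleteSpace H] [Nontrivial H]

theorem freq_re (n : ℤ) : (freq ω n).re = 0 := by
  have : freq ω n = ((2 * Real.pi * n / ω : ℝ) : ℂ) * Complex.I := by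
    simp only [freq]
    push_cast
    ring
  rw [this, Complex.re_ofReal_mul, Complex.I_re, mul_zero]

/-- The resolvent of `L₀` at a positive real point. -/
theorem exists_resolvent {μ : ℝ} (hμ : 0 < μ) : ∃ R : L2 ω H →L[ℂ] L2 ω H,
    (∀ n, proj ω H n * R = (freq ω n - μ)⁻¹ • proj ω H n) ∧
      (∀ n, R * proj ω H n = (freq ω n - μ)⁻¹ • proj ω H n) ∧ ‖R‖ ≤ μ⁻¹ ∧
      ∀ x y, (x, y) ∈ derivGraph ω H ↔ ∃ z, x = R z ∧ y = z + (μ : ℂ) • R z := by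
  have hP := isResolutionOfIdentity_proj ω (H := H)
  -- The eigenvalues are purely imaginary, so their distance to `μ` is at least `μ`.
  have hre : ∀ n, μ ≤ ‖freq ω n - μ‖ := fun n => by
    have h := Complex.abs_re_le_norm (freq ω n - μ)
    rw [Complex.sub_re, freq_re, Complex.ofReal_re, zero_sub, abs_neg, abs_of_pos hμ] at h
    exact h
  have hne : ∀ n, freq ω n - μ ≠ 0 := fun n => norm_pos_iff.1 (hμ.trans_le (hre n))
  obtain ⟨R, -, h1, h2, h3⟩ := hP.exists_diagonal (c := fun n => (freq ω n - μ)⁻¹) (C := μ⁻¹)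
    fun n => by
      rw [norm_inv]
      exact inv_anti₀ hμ (hre n)
  have hR : ∀ n z, proj ω H n (R z) = (freq ω n - μ)⁻¹ • proj ω H n z := fun n z =>
    congrArg (fun T : L2 ω H →L[ℂ] L2 ω H => T z) (h1 n)
  refine ⟨R, h1, h2, h3, fun x y => ?_⟩
  rw [mem_derivGraph_iff_proj]
  constructor
  · intro h
    have hx : x = R (y - (μ : ℂ) • x) := hP.ext_vec fun n => by
      rw [hR, map_sub, map_smul, h, ← sub_smul, smul_smul, inv_mul_cancel₀ (hne n), one_smul]
    refine ⟨y - (μ : ℂ) • x, hx, ?_⟩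
    rw [← hx, sub_add_cancel]
  · rintro ⟨z, rfl, rfl⟩ n
    rw [map_add, map_smul, hR, smul_smul, smul_smul]
    nth_rewrite 1 [← one_smul ℂ (proj ω H n z)]
    rw [← add_smul]
    congr 1
    have := hne n
    field_simp
    ring

/-- The commutator identity and the equation for `X` give the intertwining at once. The domains are
handled through `D(L₀) = Im R`: for large `μ` one has `G R = R G'` with `‖G'‖ < 1`, so `1 + G` maps
`Im R` onto itself. -/
theorem isSimilarityTransform_of_eq (k : ℕ) {B X : L2 ω H →L[ℂ] L2 ω H}
    (hX : MemHS (proj ω H) X) (hlt : ‖bddΓ ω k X‖ < 1)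
    (heq : X = B + B * bddΓ ω k X - bddΓ ω k X * bddJ ω k X) :
    IsSimilarityTransform (derivOp ω H - ofBounded B) (derivOp ω H - ofBounded (bddJ ω k X))
      (1 + bddΓ ω k X) := by
  have hP := isResolutionOfIdentity_proj ω (H := H)
  have hω : 0 < ω := Fact.out
  have hcomm : ∀ j l, (freq ω j - freq ω l) • (proj ω H j * bddΓ ω k X * proj ω H l)
      = proj ω H j * (X - bddJ ω k X) * proj ω H l := fun j l => by
    rw [mul_sub, sub_mul]
    exact commutator_block hP hω k hX j l
  set G := bddΓ ω k X with hG
  set J := bddJ ω k X with hJ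
  -- Chosen so that `‖X - J‖ / μ < 1 - ‖G‖`, which makes `‖G'‖ < 1` below.
  set μ : ℝ := (‖X - J‖ + 1) / (1 - ‖G‖) with hμdef
  have hg : 0 < 1 - ‖G‖ := sub_pos.2 hlt
  have hμ : 0 < μ := by positivity
  obtain ⟨R, hR1, hR2, hR3, hR4⟩ := exists_resolvent (ω := ω) (H := H) hμ
  set G' := G + (X - J) * R with hG'
  have hGlt : ‖G'‖ < 1 := by
    have h1 : ‖(X - J) * R‖ ≤ ‖X - J‖ * μ⁻¹ :=
      (norm_mul_le _ _).trans (mul_le_mul_of_nonneg_left hR3 (norm_nonneg _))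
    have h2 : ‖X - J‖ * μ⁻¹ < 1 - ‖G‖ := by
      rw [hμdef, inv_div, mul_div_assoc', div_lt_iff₀ (by positivity)]
      nlinarith [norm_nonneg (X - J)]
    have := norm_add_le G ((X - J) * R)
    linarith
  -- The relation `L₀ G - G L₀ = X - J` multiplied by `R` on both sides, so that only bounded
  -- operators occur.
  have hGR : G * R = R * G' := hP.ext_blocks fun j l => by
    have e1 : proj ω H j * (G * R) * proj ω H l
        = (freq ω l - μ)⁻¹ • (proj ω H j * G * proj ω H l) := by
      rw [mul_assoc, mul_assoc G, hR2, mul_smul_comm, mul_smul_comm, mul_assoc]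
    have e2 : proj ω H j * (R * G') * proj ω H l = (freq ω j - μ)⁻¹ •
        (proj ω H j * G * proj ω H l
          + (freq ω l - μ)⁻¹ • (proj ω H j * (X - J) * proj ω H l)) := by
      rw [← mul_assoc, hR1, smul_mul_assoc, smul_mul_assoc, hG', mul_add, add_mul,
        mul_assoc (proj ω H j) ((X - J) * R), mul_assoc (X - J) R, hR2, mul_smul_comm,
        mul_smul_comm, ← mul_assoc (proj ω H j) (X - J)]
    have hne : ∀ n, freq ω n - μ ≠ 0 := fun n h => by
      have := congrArg Complex.re h
      rw [Complex.sub_re, freq_re, Complex.ofReal_re, zero_sub, Complex.zero_re] at this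
      linarith
    rw [e1, e2, ← hcomm, smul_smul, smul_add, smul_smul, ← add_smul]
    congr 1
    have h1 := hne j
    have h2 := hne l
    field_simp
    ring
  have hGR' : ∀ z, G (R z) = R (G' z) := fun z =>
    congrArg (fun T : L2 ω H →L[ℂ] L2 ω H => T z) hGR
  have hgraph : ∀ x y, (x, y) ∈ derivGraph ω H →
      ((1 + G) x, y + G y + (X - J) x) ∈ derivGraph ω H := by
    intro x y hxy
    have h : (G x, G y + (X - J) x) ∈ derivGraph ω H := by
      obtain ⟨z, rfl, rfl⟩ := (hR4 _ _).1 hxy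
      refine (hR4 _ _).2 ⟨G' z, hGR' z, ?_⟩
      rw [← hGR', map_add, map_smul, hG']
      change _ = G z + (X - J) (R z) + _
      abel
    have e : ((1 + G) x, y + G y + (X - J) x) = (x, y) + (G x, G y + (X - J) x) := by
      rw [Prod.mk_add_mk, add_assoc]
      rfl
    rw [e]
    exact add_mem hxy h
  have hdom₁ : ∀ x, x ∈ (derivOp ω H - ofBounded B).domain ↔ x ∈ (derivOp ω H).domain := fun x =>
    ⟨fun h => h.1, fun h => ⟨h, trivial⟩⟩
  have hdom₂ : ∀ x, x ∈ (derivOp ω H - ofBounded J).domain ↔ x ∈ (derivOp ω H).domain := fun x =>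
    ⟨fun h => h.1, fun h => ⟨h, trivial⟩⟩
  refine ⟨?_, ?_, ?_⟩
  · have := isUnit_one_sub_of_norm_lt_one (x := -G) (by rwa [norm_neg])
    rwa [sub_neg_eq_add] at this
  · ext x
    rw [hdom₁]
    constructor
    · rintro ⟨w, hw, rfl⟩
      obtain ⟨y, hy⟩ := mem_derivOp_domain.1 ((hdom₂ w).1 hw)
      exact mem_derivOp_domain.2 ⟨_, hgraph w y hy⟩
    · intro hx
      obtain ⟨y, hy⟩ := mem_derivOp_domain.1 hx
      obtain ⟨z, rfl, -⟩ := (hR4 _ _).1 hy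
      have hu : IsUnit (1 + G') := by
        have := isUnit_one_sub_of_norm_lt_one (x := -G') (by rwa [norm_neg])
        rwa [sub_neg_eq_add] at this
      -- Then `(1 + G) R w = R (1 + G') w = R z`, so `R z` is attained from within `D(L₀)`.
      set w := Ring.inverse (1 + G') z with hw
      have hwz : w + G' w = z :=
        congrArg (fun T : L2 ω H →L[ℂ] L2 ω H => T z) (Ring.mul_inverse_cancel _ hu)
      refine ⟨R w, (hdom₂ _).2 (mem_derivOp_domain.2 ⟨_, (hR4 _ _).2 ⟨w, rfl, rfl⟩⟩), ?_⟩
      change R w + G (R w) = R z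
      rw [hGR', ← map_add, hwz]
  · rintro ⟨x, hx⟩ hUx
    obtain ⟨y, hy⟩ := mem_derivOp_domain.1 ((hdom₂ x).1 hx)
    have e1 : (derivOp ω H - ofBounded B) ⟨(1 + G) x, hUx⟩
        = (y + G y + (X - J) x) - B ((1 + G) x) := by
      rw [LinearPMap.sub_apply]
      congr 1
      exact derivOp_eq (hgraph x y hy) _
    have e2 : (derivOp ω H - ofBounded J) ⟨x, hx⟩ = y - J x := by
      rw [LinearPMap.sub_apply]
      congr 1
      exact derivOp_eq hy _
    rw [e2]
    refine e1.trans ?_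
    have e3 : X x = B x + B (G x) - G (J x) :=
      congrArg (fun T : L2 ω H →L[ℂ] L2 ω H => T x) heq
    change y + G y + (X x - J x) - B (x + G x) = (y - J x) + G (y - J x)
    rw [e3, map_add, map_sub]
    abel

end Similarity

/-! ### The orthogonal direct sum -/

section DirectSum

theorem hasSum_option {α M : Type*} [AddCommGroup M] [TopologicalSpace M] [ContinuousAdd M]
    {f : Option α → M} {a : M} (h : HasSum (fun x => f (some x)) a) :
    HasSum f (f none + a) := by
  classical
  have h1 : HasSum (fun x : Option α => if x = none then f none else 0) (f none) :=
    hasSum_ite_eq none (f none)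
  have h2 : HasSum (fun x : Option α => if x = none then 0 else f x) a := by
    refine ((Option.some_injective α).hasSum_iff ?_).1 ?_
    · rintro (_ | x) hx
      · simp
      · exact absurd ⟨x, rfl⟩ hx
    · simpa [Function.comp_def] using h
  convert h1.add h2 using 1
  funext x
  cases x <;> simp

variable (ω : ℝ) [Fact (0 < ω)]
variable (H : Type*) [NormedAddCommGroup H] [InnerProductSpace ℂ H] [CompleteSpace H]

/-- The indices of the projections summed in a member of the coarse family. -/
def coarseSet (k : ℕ) : Option {l : ℤ // (k : ℤ) < |l|} → Finset ℤ
  | none => Finset.Icc (-(k : ℤ)) k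
  | some l => {(l : ℤ)}

theorem coarseProj_eq (k : ℕ) (i : Option {l : ℤ // (k : ℤ) < |l|}) :
    coarseProj ω H k i = ∑ l ∈ coarseSet k i, proj ω H l := by
  cases i
  · rfl
  · exact (Finset.sum_singleton _ _).symm

theorem coarseSet_disjoint (k : ℕ) {i j : Option {l : ℤ // (k : ℤ) < |l|}} (h : i ≠ j) {n : ℤ}
    (hi : n ∈ coarseSet k i) : n ∉ coarseSet k j := by
  intro hj
  rcases i with _ | ⟨a, ha⟩ <;> rcases j with _ | ⟨b, hb⟩ <;>
    simp only [coarseSet, Finset.mem_Icc, ← abs_le, Finset.mem_singleton] at hi hj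
  · exact h rfl
  · subst hj
    exact absurd hi (not_le.2 hb)
  · subst hi
    exact absurd hj (not_le.2 ha)
  · subst hi hj
    exact h rfl

/-- Indices joined by a nonzero weight of `J_k` belong to the same coarse block; hence `J_k X`
commutes with the coarse projections. -/
theorem mem_coarseSet_iff (k : ℕ) (i : Option {l : ℤ // (k : ℤ) < |l|}) {j l : ℤ}
    (h : (|j| ≤ k ∧ |l| ≤ k) ∨ j = l) : j ∈ coarseSet k i ↔ l ∈ coarseSet k i := by
  rcases h with h | rfl
  · rcases i with _ | ⟨a, ha⟩ <;>
      simp only [coarseSet, Finset.mem_Icc, ← abs_le, Finset.mem_singleton]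
    · simp [h]
    · constructor
      · rintro rfl
        exact absurd h.1 (not_le.2 ha)
      · rintro rfl
        exact absurd h.2 (not_le.2 ha)
  · rfl

theorem hasSum_coarse {M : Type*} [AddCommGroup M] [TopologicalSpace M] [IsTopologicalAddGroup M]
    (k : ℕ) {f : ℤ → M} {a : M} (h : HasSum f a) :
    HasSum (fun i : Option {l : ℤ // (k : ℤ) < |l|} => ∑ l ∈ coarseSet k i, f l) a := by
  classical
  have h1 : HasSum (fun l => if l ∈ Finset.Icc (-(k : ℤ)) k then f l else 0)
      (∑ l ∈ Finset.Icc (-(k : ℤ)) k, f l) := by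
    have := hasSum_sum_of_ne_finset_zero (L := .unconditional _)
      (f := fun l => if l ∈ Finset.Icc (-(k : ℤ)) k then f l else 0)
      (s := Finset.Icc (-(k : ℤ)) k) fun l hl => if_neg hl
    rwa [Finset.sum_congr rfl fun l hl => if_pos hl] at this
  have h2 : HasSum (fun l : {l : ℤ // (k : ℤ) < |l|} => f l)
      (a - ∑ l ∈ Finset.Icc (-(k : ℤ)) k, f l) := by
    refine (hasSum_subtype_iff_indicator (s := {l : ℤ | (k : ℤ) < |l|})).2 ?_
    convert h.sub h1 using 1
    funext l
    have : (l ∈ Finset.Icc (-(k : ℤ)) k) ↔ ¬ (k : ℤ) < |l| := by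
      rw [Finset.mem_Icc, ← abs_le, not_lt]
    by_cases hl : (k : ℤ) < |l|
    · rw [Set.indicator_of_mem (by exact hl), if_neg fun h' => this.1 h' hl, sub_zero]
    · rw [Set.indicator_of_notMem (by exact hl), if_pos (this.2 hl), sub_self]
  have h3 := hasSum_option (f := fun i : Option {l : ℤ // (k : ℤ) < |l|} =>
    ∑ l ∈ coarseSet k i, f l) (a := a - ∑ l ∈ Finset.Icc (-(k : ℤ)) k, f l)
    (by simpa [coarseSet] using h2)
  have h4 : ∑ l ∈ coarseSet k none, f l = ∑ l ∈ Finset.Icc (-(k : ℤ)) k, f l := rfl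
  rwa [h4, add_sub_cancel] at h3

variable [Nontrivial H]

theorem isResolutionOfIdentity_coarseProj (k : ℕ) :
    IsResolutionOfIdentity (coarseProj ω H k) := by
  have hP := isResolutionOfIdentity_proj ω (H := H)
  have hmul : ∀ i n, coarseProj ω H k i * proj ω H n
      = if n ∈ coarseSet k i then proj ω H n else 0 := fun i n => by
    rw [coarseProj_eq, sum_mul_proj hP]
  have happ : ∀ i n x, proj ω H n (coarseProj ω H k i x)
      = if n ∈ coarseSet k i then proj ω H n x else 0 := fun i n x => by
    have := congrArg (fun T : L2 ω H →L[ℂ] L2 ω H => T x) (proj_mul_sum hP (coarseSet k i) n)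
    rw [coarseProj_eq]
    refine this.trans ?_
    split_ifs <;> rfl
  refine ⟨fun i h => ?_, fun i => ?_, fun i => ?_, fun i j hij => ?_, fun x => ?_, fun x => ?_⟩
  · obtain ⟨n, hn⟩ : (coarseSet k i).Nonempty := by
      rcases i with _ | l
      · exact ⟨0, by simp [coarseSet]⟩
      · exact ⟨l, by simp [coarseSet]⟩
    have := hmul i n
    rw [h, zero_mul, if_pos hn] at this
    exact hP.ne_zero n this.symm
  · rw [coarseProj_eq]
    exact isSelfAdjoint_sum _ fun l _ => hP.selfAdjoint l
  · nth_rewrite 2 [coarseProj_eq]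
    rw [Finset.mul_sum, coarseProj_eq]
    refine Finset.sum_congr rfl fun n hn => ?_
    rw [← coarseProj_eq, hmul, if_pos hn]
  · rw [coarseProj_eq ω H k j, Finset.mul_sum]
    refine Finset.sum_eq_zero fun n hn => ?_
    rw [hmul, if_neg (coarseSet_disjoint k (Ne.symm hij) hn)]
  · have := hasSum_coarse k (hP.hasSum x)
    simpa only [coarseProj_eq, sum_apply] using this
  · have hn : ∀ i, ‖coarseProj ω H k i x‖ ^ 2 = ∑ n ∈ coarseSet k i, ‖proj ω H n x‖ ^ 2 := by
      intro i
      refine (hP.hasSum_norm _).unique ?_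
      have h1 := hasSum_sum_of_ne_finset_zero (L := .unconditional _)
        (f := fun n => ‖proj ω H n (coarseProj ω H k i x)‖ ^ 2) (s := coarseSet k i)
        fun n hn => by simp [happ, hn]
      rwa [Finset.sum_congr rfl fun n hn => by rw [happ, if_pos hn]] at h1
    simpa only [hn] using hasSum_coarse k (hP.hasSum_norm x)

/-- Commuting with the coarse projections, `J_k X` restricts to each of their ranges. As it is
bounded, the square summability condition on the domain holds for every vector. -/
theorem exists_isOrthogonalDirectSum (k : ℕ) {X : L2 ω H →L[ℂ] L2 ω H}
    (hX : MemHS (proj ω H) X) : ∃ part,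
      IsOrthogonalDirectSum (ofBounded (bddJ ω k X)) (coarseProj ω H k) part := by
  have hP := isResolutionOfIdentity_proj ω (H := H)
  have hQ := isResolutionOfIdentity_coarseProj ω H k
  set J := bddJ ω k X with hJ
  have hcomm : ∀ i, coarseProj ω H k i * J = J * coarseProj ω H k i := fun i => by
    refine hP.ext_blocks fun j l => ?_
    have hb : proj ω H j * J * proj ω H l = weightJ k j l • (proj ω H j * X * proj ω H l) :=
      blockMultiplier_block hP (norm_weightJ_le k) hX j l
    have e1 : proj ω H j * (coarseProj ω H k i * J) * proj ω H l
        = if j ∈ coarseSet k i then proj ω H j * J * proj ω H l else 0 := by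
      rw [← mul_assoc, coarseProj_eq, proj_mul_sum hP]
      split_ifs <;> simp
    have e2 : proj ω H j * (J * coarseProj ω H k i) * proj ω H l
        = if l ∈ coarseSet k i then proj ω H j * J * proj ω H l else 0 := by
      rw [mul_assoc, mul_assoc J, coarseProj_eq, sum_mul_proj hP]
      split_ifs <;> simp [mul_assoc]
    rw [e1, e2, hb]
    by_cases h : (|j| ≤ k ∧ |l| ≤ k) ∨ j = l
    · simp only [mem_coarseSet_iff k i h]
    · rw [weightJ, if_neg h, zero_smul, ite_self, ite_self]
  have hcomm' : ∀ i x, coarseProj ω H k i (J x) = J (coarseProj ω H k i x) := fun i x =>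
    congrArg (fun T : L2 ω H →L[ℂ] L2 ω H => T x) (hcomm i)
  refine ⟨fun i => (J ∘L Submodule.subtypeL _).codRestrict _ ?_, ?_⟩
  · rintro ⟨_, y, rfl⟩
    exact ⟨J y, hcomm' i y⟩
  · refine ⟨hQ, ?_, fun x => ⟨fun _ => ?_, fun _ => trivial⟩, fun i => le_top, fun i x => rfl,
      fun x => ?_⟩
    · have hg : ((ofBounded J).graph : Set (L2 ω H × L2 ω H)) = {p | J p.1 = p.2} := by
        ext ⟨x, y⟩
        constructor
        · intro h
          obtain ⟨w, hw1, hw2⟩ := (LinearPMap.mem_graph_iff _).1 h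
          have hw1' : (w : L2 ω H) = x := hw1
          have hw2' : J w = y := hw2
          change J x = y
          rw [← hw1', hw2']
        · intro h
          exact (LinearPMap.mem_graph_iff _).2 ⟨⟨x, trivial⟩, rfl, h⟩
      change IsClosed ((ofBounded J).graph : Set (L2 ω H × L2 ω H))
      rw [hg]
      exact isClosed_eq (J.continuous.comp continuous_fst) continuous_snd
    · refine Summable.of_nonneg_of_le (fun _ => sq_nonneg _) (fun i => ?_)
        ((hQ.hasSum_norm x).summable.mul_left (‖J‖ ^ 2))
      rw [← mul_pow]
      exact pow_le_pow_left₀ (norm_nonneg _) (J.le_opNorm _) 2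
    · exact (hQ.hasSum (x : L2 ω H)).mapL J

end DirectSum

end InvolutionOperator

end

/-! ### The theorem. -/

open InvolutionOperator
theorem theorem5p1 {H : Type*} [NormedAddCommGroup H] [InnerProductSpace ℂ H] [CompleteSpace H]
    (ω : ℝ) [Fact (0 < ω)]
    (𝒱 : ℝ → H →L[ℂ] H)
    (h𝒱 : ∀ x : H, MemLp (fun s => 𝒱 s x) 2 (meanMeasure ω))
    (hcoeff : Summable fun n : ℤ => ‖potentialCoeff ω 𝒱 h𝒱 n‖ ^ 2)
    (hprod : Summable fun p : ℤ × ℤ =>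
      ‖∑' n : {n : ℤ // n ≠ p.2}, (1 / ((p.2 : ℂ) - (n : ℤ))) •
        (potentialCoeff ω 𝒱 h𝒱 (p.1 + n) * potentialCoeff ω 𝒱 h𝒱 (p.2 + n))‖ ^ 2)
    (m : ℕ) (hm : IsUnit (1 + ΓV ω 𝒱 m))
    (hnondeg : ∀ n : ℕ,
      centralProj ω H n * tildeV ω 𝒱 m * centralProj ω H n ≠ tildeV ω 𝒱 m)
    (k : ℕ) (hmk : m ≤ k)
    (hk : 4 * alphaTilde (proj ω H) ω (tildeV ω 𝒱 m) (k + 1) *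
      normM (proj ω H) (tildeV ω 𝒱 m) (tildeV ω 𝒱 m) < 1) :
    HasBoundedTransforms ω 𝒱 m ∧
    MemM (proj ω H) (tildeV ω 𝒱 m) (tildeV ω 𝒱 m) ∧
    ∃ X : L2 ω H →L[ℂ] L2 ω H,
      IsFixedPointInBall ω k (tildeV ω 𝒱 m) X ∧
      (∀ Y : L2 ω H →L[ℂ] L2 ω H, IsFixedPointInBall ω k (tildeV ω 𝒱 m) Y → Y = X) ∧
      IsSimilarityTransform
        (derivOp ω H - ofBounded (tildeV ω 𝒱 m))
        (derivOp ω H - ofBounded (bddJ ω k X))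
        (1 + bddΓ ω k X) ∧
      ∃ part, IsOrthogonalDirectSum (ofBounded (bddJ ω k X)) (coarseProj ω H k) part := by
  have hω : 0 < ω := Fact.out
  -- If `H = 0`, then `Ṽ = 0` equals its truncation, against nondegeneracy; `H ≠ 0` is what makes
  -- the projections nonzero.
  obtain hH | hH := subsingleton_or_nontrivial H
  · refine absurd (ContinuousLinearMap.ext fun x => Lp.ext ?_) (hnondeg 0)
    exact Eventually.of_forall fun s => Subsingleton.elim _ _
  have hP := isResolutionOfIdentity_proj ω (H := H)
  have hW := memHS_tildeV h𝒱 hcoeff hprod m hm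
  have hbdd : HasBoundedTransforms ω 𝒱 m :=
    ⟨(JV_spec h𝒱 hcoeff m).1, (ΓV_spec h𝒱 hcoeff m).1, (VΓV_spec h𝒱 hcoeff hprod m).1⟩
  set W := tildeV ω 𝒱 m
  have hα0 : ∀ n, 0 < alpha (proj ω H) W n := alpha_pos hP hW hnondeg
  have hα1 := alpha_le_one hP hW
  have hN : 0 < hsNorm (proj ω H) W :=
    hsNorm_pos hP hW fun h => hnondeg 0 (by rw [h, mul_zero, zero_mul])
  have hiff : ∀ {X}, MemM (proj ω H) W X ↔ X ∈ weightedSubgroup (proj ω H) W := fun {X} =>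
    memM_iff hP hα0 hα1
  have hnorm : ∀ {X}, X ∈ weightedSubgroup (proj ω H) W →
      normM (proj ω H) W X = weightedNorm (proj ω H) W X := fun {X} hX =>
    normM_eq hP hα0 hα1 (hiff.2 hX)
  have hB : W ∈ weightedSubgroup (proj ω H) W := ⟨wMem_self_col hP hW hN, wMem_self_row hP hW hN⟩
  rw [hnorm hB] at hk
  obtain ⟨X, hX, hXB, hfix, huniq⟩ :=
    exists_unique_fixedPoint_abstractΦ hP hω hW hα0 k hB hk
  have hXs := (memHS_of_mem_weightedSubgroup hP hW hα0 hX).1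
  refine ⟨hbdd, hiff.2 hB, X, ⟨hiff.2 hX, ?_, hfix⟩, fun Y hY => ?_, ?_, ?_⟩
  · rwa [hnorm (sub_mem hX hB), hnorm hB]
  · have hYm := hiff.1 hY.mem
    refine huniq Y hYm ?_ hY.fixed
    have := hY.ball
    rwa [hnorm (sub_mem hYm hB), hnorm hB] at this
  · exact isSimilarityTransform_of_eq k hXs
      (norm_transformΓ_lt_one hP hω hW hα0 k hB hk hX hXB)
      (eq_of_abstractΦ_eq hP hω k hW hXs hfix)
  · exact exists_isOrthogonalDirectSum ω H k hXs
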